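/- **Setting.** Fix a set of operation symbols. The types of the effect handler calculus $\lambda_{\mathrm{eff}}$ are: value types $A,B ::= A\to C \mid \prod_{i=1}^n A_i$ ($n\ge 0$), computation types $C ::= A!\Sigma$, and signatures $\Sigma$, i.e. finite partial functions sending operation symbols to pairs of value types, written $(\mathtt{op}:A_{\mathtt{op}}\rightarrowtriangle B_{\mathtt{op}})\in\Sigma$. Its simply typed value terms $\Gamma\vdash V:A$, computation terms $\Gamma\vdash M:C$ and handlers $\Gamma\vdash H:\Sigma\Rightarrow C$ (terms being identified with their typing derivations) are $$V,W ::= x\mid\lambda x.M\mid\langle V_1,\dots,V_n\rangle\mid\pi_i V,$$ $$M,N ::= V\,W\mid\mathtt{return}\,V\mid\mathtt{let}\,x=M\,\mathtt{in}\,N\mid\mathtt{op}(V)\mid\mathtt{with}\,H\,\mathtt{handle}\,M\,\mathtt{to}\,x.N,\qquad H=\{\mathtt{op}(x,k)\mapsto M_{\mathtt{op}}\}_{\mathtt{op}\in\Sigma}.$$ Derivable equality is the least typed congruence containing the $\beta\eta$-laws of functions and tuples, the three monad laws for $\mathtt{let}$, and the equations $\mathtt{with}\,H\,\mathtt{handle}\,\mathtt{return}\,V\,\mathtt{to}\,x.M=M[V/x]$;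 $\mathtt{with}\,H\,\mathtt{handle}\,(\mathtt{let}\,x=L\,\mathtt{in}\,M)\,\mathtt{to}\,y.N=\mathtt{with}\,H\,\mathtt{handle}\,L\,\mathtt{to}\,x.(\mathtt{with}\,H\,\mathtt{handle}\,M\,\mathtt{to}\,y.N)$; $\mathtt{with}\,H\,\mathtt{handle}\,\mathtt{op}(V)\,\mathtt{to}\,x.M=M_{\mathtt{op}}[V/x,\lambda x.M/k]$. The relation $\leadsto$ on closed computation terms is the least relation that is closed under evaluation contexts $\mathcal C::=[\,]\mid\mathtt{let}\,x=\mathcal C\,\mathtt{in}\,N\mid\mathtt{with}\,H\,\mathtt{handle}\,\mathcal C\,\mathtt{to}\,x.M$ and contains $\mathtt{let}\,x=\mathtt{return}\,V\,\mathtt{in}\,M\leadsto M[V/x]$, $(\lambda x.M)V\leadsto M[V/x]$, $\mathtt{with}\,H\,\mathtt{handle}\,\mathtt{return}\,V\,\mathtt{to}\,x.M\leadsto M[V/x]$ and, if $\mathcal C$ contains no handle-with, $\mathtt{with}\,H\,\mathtt{handle}\,\mathcal C[\mathtt{op}(V)]\,\mathtt{to}\,x.M\leadsto M_{\mathtt{op}}[V/x,\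 \lambda y.\,\mathtt{with}\,H\,\mathtt{handle}\,\mathcal C[\mathtt{return}\,y]\,\mathtt{to}\,x.M\,/k]$. **CPS transformation.** The target is System F with types $X\mid 1\mid A\times B\mid A\to B\mid\forall X.A$ and typed $\beta\eta$-equality; finite products are iterated binary products. Put $\mathcal H_S[\beta]=\prod_{(\mathtt{op}:A_{\mathtt{op}}\rightarrowtriangle B_{\mathtt{op}})\in S}\big(A_{\mathtt{op}}\times(B_{\mathtt{op}}\to\beta)\to\beta\big)$ and $D_SX=\forall\beta.(X\to\beta)\to\mathcal H_S[\beta]\to\beta$. Let $[\![-]\!]$ be homomorphic on value types and value terms and on application, and put $[\![A!\Sigma]\!]=D_{[\![\Sigma]\!]}[\![A]\!]$, $$[\![\mathtt{return}\,V]\!]=\Lambda\beta.\lambda k.\lambda h.\,k\,[\![V]\!],\qquad [\![\mathtt{let}\,x=M\,\mathtt{in}\,N]\!]=\Lambda\beta.\lambda k.\lambda h.\,[\![M]\!]\,\beta\,(\lambda x.[\![N]\!]\,\beta\,k\,h)\,h,$$ $$[\![\mathtt{op}(V)]\!]=\Lambda\beta.\lambda k.\lambda h.\,\pi_{\mathtt{op}}\,h\,\langle[\![V]\!],k\rangle,\qquad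 [\![\mathtt{with}\,H\,\mathtt{handle}\,M\,\mathtt{to}\,x.N]\!]=[\![M]\!]\,[\![C]\!]\,(\lambda x.[\![N]\!])\,[\![H]\!]\quad(N:C),$$ $$[\![\{\mathtt{op}(x,k)\mapsto M_{\mathtt{op}}\}_{\mathtt{op}\in\Sigma}]\!]=\langle\lambda\langle x,k\rangle.[\![M_{\mathtt{op}}]\!]\rangle_{\mathtt{op}\in\Sigma}.$$ **CPS model.** A $\lambda_{\mathrm{eff}}$-model is a cartesian category with a family of strong monads $T_S$ (given as strong Kleisli triples) indexed by semantic signatures $S$ (finite partial functions from operation symbols to pairs of objects), Kleisli exponentials, morphisms $A_{\mathtt{op}}\to T_SB_{\mathtt{op}}$ for $\mathtt{op}\in S$, and morphisms $\mathbf{handle}_{S,S',X}:\mathcal H_S[X]\times T_ST_{S'}X\to T_{S'}X$, where here $\mathcal H_S[X]$ is the product over $\mathtt{op}\in S$ of the $T_{S'}$-Kleisli exponentials from $A_{\mathtt{op}}\times(B_{\mathtt{op}}\Rightarrow X)$ to $X$; $\mathbf{handle}$ must satisfy the unit and multiplication laws of an Eilenberg–Moore algebra, parametrized by $\mathcal H_S[X]$,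 and the law that handling $\mathtt{op}$ evaluates the $\mathtt{op}$-component of the handler. Every well-typed value term, computation term and handler is interpreted in such a model by induction on typing. The CPS model lives on the category of closed System F types and terms $x:A\vdash t:B$ modulo $\beta\eta$. Its strong monads are the $D_S$, with unit $\Lambda\beta.\lambda k.\lambda h.\,k\,x$ and with strong Kleisli extension sending $x_1:A_1,x_2:A_2\vdash t:D_SB$ to $\Lambda\beta.\lambda k.\lambda h.\,x_2\,\beta\,(\lambda x_2.\,t\,\beta\,k\,h)\,h$; its Kleisli exponentials are $Y\to D_SZ$; operations are $\Lambda\beta.\lambda k.\lambda h.\,\pi_{\mathtt{op}}\,h\,\langle x,k\rangle$; and $\mathbf{handle}_{S,S',A}$ is $h,x\mapsto x\,(D_{S'}A)\,(\lambda y.y)\,h$. **Theorem.** These data form a $\lambda_{\mathrm{eff}}$-model, and the interpretation in it of every value term $\Gamma\vdash V:A$, every computation term $\Gamma\vdash M:A!\Sigma$ and every handler $\Gamma\vdash H:\Sigma\Rightarrow C$ equals the $\beta\eta$-equivalence class of its CPS transform, which is a System F term of type $[\![A]\!]$, $[\![A!\Sigma]\!]$ and $\mathcal H_{[\![\Sigma]\!]}[[\![C]\!]]$,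 respectively, in context $[\![\Gamma]\!]$. (A term in context $x_1:A_1,\dots,x_n:A_n$ is regarded as a morphism out of the product of the $A_i$ by substituting the projections for the variables.) **Corollary.** If $\Gamma\vdash M=N:A!\Sigma$ is derivable in $\lambda_{\mathrm{eff}}$, then $[\![M]\!]$ and $[\![N]\!]$ are $\beta\eta$-equal in System F, and likewise for derivably equal value terms and handlers. In particular, if $M\leadsto N$ for closed well-typed computation terms of the same type, then $[\![M]\!]$ and $[\![N]\!]$ are $\beta\eta$-equal. -/

import Mathlib

universe u v w

open CategoryTheory MonoidalCategory CartesianMonoidalCategory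

namespace SysF

/-! ### Types -/

/-- `Ty m`: the well-formed types `Δ ⊢ A` of System F over a context `Δ` of `m` type variables
(de Bruijn indices, `0` being the innermost variable). -/
inductive Ty : ℕ → Type
  | var {m : ℕ} (i : Fin m) : Ty m
  | unit {m : ℕ} : Ty m
  | prod {m : ℕ} (A B : Ty m) : Ty m
  | arr {m : ℕ} (A B : Ty m) : Ty m
  | all {m : ℕ} (A : Ty (m + 1)) : Ty m

/-- Lifting of a renaming of type variables under a binder. -/
def upR {m n : ℕ} (ξ : Fin m → Fin n) : Fin (m + 1) → Fin (n + 1) :=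
  Fin.cases 0 (fun i => (ξ i).succ)

/-- Renaming of type variables in types. -/
def Ty.ren : {m n : ℕ} → (Fin m → Fin n) → Ty m → Ty n
  | _, _, ξ, .var i => .var (ξ i)
  | _, _, _, .unit => .unit
  | _, _, ξ, .prod A B => .prod (A.ren ξ) (B.ren ξ)
  | _, _, ξ, .arr A B => .arr (A.ren ξ) (B.ren ξ)
  | _, _, ξ, .all A => .all (A.ren (upR ξ))

/-- Weakening of a type by one (innermost) type variable. -/
def Ty.wk {m : ℕ} (A : Ty m) : Ty (m + 1) := A.ren Fin.succ

/-- Lifting of a substitution of types for type variables under a binder. -/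
def upT {m n : ℕ} (θ : Fin m → Ty n) : Fin (m + 1) → Ty (n + 1) :=
  Fin.cases (.var 0) (fun i => (θ i).wk)

/-- Simultaneous substitution of types for type variables in types. -/
def Ty.subst : {m n : ℕ} → (Fin m → Ty n) → Ty m → Ty n
  | _, _, θ, .var i => θ i
  | _, _, _, .unit => .unit
  | _, _, θ, .prod A B => .prod (A.subst θ) (B.subst θ)
  | _, _, θ, .arr A B => .arr (A.subst θ) (B.subst θ)
  | _, _, θ, .all A => .all (A.subst (upT θ))

/-- The substitution `[B / X₀]` of `B` for the innermost type variable. -/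
def instT {m : ℕ} (B : Ty m) : Fin (m + 1) → Ty m := Fin.cases B Ty.var

/-- `A[B / X₀]`. -/
def Ty.inst {m : ℕ} (A : Ty (m + 1)) (B : Ty m) : Ty m := A.subst (instT B)

/-! ### Terms -/

/-- Raw (Church-style) terms over `m` type variables; term variables are de Bruijn indices. -/
inductive Tm : ℕ → Type
  | var {m : ℕ} (i : ℕ) : Tm m
  | star {m : ℕ} : Tm m
  | pair {m : ℕ} (t s : Tm m) : Tm m
  | fst {m : ℕ} (t : Tm m) : Tm m
  | snd {m : ℕ} (t : Tm m) : Tm m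
  | lam {m : ℕ} (A : Ty m) (t : Tm m) : Tm m
  | app {m : ℕ} (t s : Tm m) : Tm m
  | tlam {m : ℕ} (t : Tm (m + 1)) : Tm m
  | tapp {m : ℕ} (t : Tm m) (A : Ty m) : Tm m

/-- Lifting of a renaming of term variables under a binder. -/
def upV (ρ : ℕ → ℕ) : ℕ → ℕ
  | 0 => 0
  | i + 1 => ρ i + 1

/-- Simultaneous renaming of type variables (by `ξ`) and term variables (by `ρ`). -/
def Tm.ren : {m n : ℕ} → (Fin m → Fin n) → (ℕ → ℕ) → Tm m → Tm n
  | _, _, _, ρ, .var i => .var (ρ i)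
  | _, _, _, _, .star => .star
  | _, _, ξ, ρ, .pair t s => .pair (t.ren ξ ρ) (s.ren ξ ρ)
  | _, _, ξ, ρ, .fst t => .fst (t.ren ξ ρ)
  | _, _, ξ, ρ, .snd t => .snd (t.ren ξ ρ)
  | _, _, ξ, ρ, .lam A t => .lam (A.ren ξ) (t.ren ξ (upV ρ))
  | _, _, ξ, ρ, .app t s => .app (t.ren ξ ρ) (s.ren ξ ρ)
  | _, _, ξ, ρ, .tlam t => .tlam (t.ren (upR ξ) ρ)
  | _, _, ξ, ρ, .tapp t A => .tapp (t.ren ξ ρ) (A.ren ξ)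

/-- Weakening by one term variable. -/
def Tm.wk {m : ℕ} (t : Tm m) : Tm m := t.ren id (· + 1)

/-- Weakening by one type variable. -/
def Tm.twk {m : ℕ} (t : Tm m) : Tm (m + 1) := t.ren Fin.succ id

/-- Lifting of a substitution for term variables under a term binder. -/
def upS {m : ℕ} (σ : ℕ → Tm m) : ℕ → Tm m
  | 0 => .var 0
  | i + 1 => (σ i).wk

/-- Simultaneous substitution of types for type variables (`θ`) and terms for term
variables (`σ`). -/
def Tm.subst : {m n : ℕ} → (Fin m → Ty n) → (ℕ → Tm n) → Tm m → Tm n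
  | _, _, _, σ, .var i => σ i
  | _, _, _, _, .star => .star
  | _, _, θ, σ, .pair t s => .pair (t.subst θ σ) (s.subst θ σ)
  | _, _, θ, σ, .fst t => .fst (t.subst θ σ)
  | _, _, θ, σ, .snd t => .snd (t.subst θ σ)
  | _, _, θ, σ, .lam A t => .lam (A.subst θ) (t.subst θ (upS σ))
  | _, _, θ, σ, .app t s => .app (t.subst θ σ) (s.subst θ σ)
  | _, _, θ, σ, .tlam t => .tlam (t.subst (upT θ) (fun i => (σ i).twk))
  | _, _, θ, σ, .tapp t A => .tapp (t.subst θ σ) (A.subst θ)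

/-- The substitution `[s / x₀]`. -/
def instS {m : ℕ} (s : Tm m) : ℕ → Tm m
  | 0 => s
  | i + 1 => .var i

/-- `t[s / x₀]`. -/
def Tm.inst {m : ℕ} (t s : Tm m) : Tm m := t.subst Ty.var (instS s)

/-- `t[B / X₀]`. -/
def Tm.tinst {m : ℕ} (t : Tm (m + 1)) (B : Ty m) : Tm m := t.subst (instT B) Tm.var

/-! ### Typing and `βη`-equality -/

/-- The typing judgement `Δ ∣ Γ ⊢ t : A`; a context `Γ` is the list of the types of the term
variables, the innermost variable first. -/
inductive HasType : {m : ℕ} → List (Ty m) → Tm m → Ty m → Prop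
  | var {m : ℕ} {Γ : List (Ty m)} {i : ℕ} {A : Ty m} : Γ[i]? = some A → HasType Γ (.var i) A
  | star {m : ℕ} {Γ : List (Ty m)} : HasType Γ .star .unit
  | pair {m : ℕ} {Γ : List (Ty m)} {t s : Tm m} {A B : Ty m} :
      HasType Γ t A → HasType Γ s B → HasType Γ (.pair t s) (.prod A B)
  | fst {m : ℕ} {Γ : List (Ty m)} {t : Tm m} {A B : Ty m} :
      HasType Γ t (.prod A B) → HasType Γ (.fst t) A
  | snd {m : ℕ} {Γ : List (Ty m)} {t : Tm m} {A B : Ty m} :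
      HasType Γ t (.prod A B) → HasType Γ (.snd t) B
  | lam {m : ℕ} {Γ : List (Ty m)} {t : Tm m} {A B : Ty m} :
      HasType (A :: Γ) t B → HasType Γ (.lam A t) (.arr A B)
  | app {m : ℕ} {Γ : List (Ty m)} {t s : Tm m} {A B : Ty m} :
      HasType Γ t (.arr A B) → HasType Γ s A → HasType Γ (.app t s) B
  | tlam {m : ℕ} {Γ : List (Ty m)} {t : Tm (m + 1)} {A : Ty (m + 1)} :
      HasType (Γ.map Ty.wk) t A → HasType Γ (.tlam t) (.all A)
  | tapp {m : ℕ} {Γ : List (Ty m)} {t : Tm m} {A : Ty (m + 1)} (B : Ty m) :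
      HasType Γ t (.all A) → HasType Γ (.tapp t B) (A.inst B)

/-- `βη`-equality `Δ ∣ Γ ⊢ t = s : A` of well-typed terms: the least typed congruence that
contains the `β`- and `η`-laws of all type formers. -/
inductive BEq : {m : ℕ} → List (Ty m) → Tm m → Tm m → Ty m → Prop
  | refl {m : ℕ} {Γ : List (Ty m)} {t : Tm m} {A : Ty m} : HasType Γ t A → BEq Γ t t A
  | symm {m : ℕ} {Γ : List (Ty m)} {t s : Tm m} {A : Ty m} : BEq Γ t s A → BEq Γ s t A
  | trans {m : ℕ} {Γ : List (Ty m)} {t s r : Tm m} {A : Ty m} :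
      BEq Γ t s A → BEq Γ s r A → BEq Γ t r A
  | pair {m : ℕ} {Γ : List (Ty m)} {t t' s s' : Tm m} {A B : Ty m} :
      BEq Γ t t' A → BEq Γ s s' B → BEq Γ (.pair t s) (.pair t' s') (.prod A B)
  | fst {m : ℕ} {Γ : List (Ty m)} {t t' : Tm m} {A B : Ty m} :
      BEq Γ t t' (.prod A B) → BEq Γ (.fst t) (.fst t') A
  | snd {m : ℕ} {Γ : List (Ty m)} {t t' : Tm m} {A B : Ty m} :
      BEq Γ t t' (.prod A B) → BEq Γ (.snd t) (.snd t') B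
  | lam {m : ℕ} {Γ : List (Ty m)} {t t' : Tm m} {A B : Ty m} :
      BEq (A :: Γ) t t' B → BEq Γ (.lam A t) (.lam A t') (.arr A B)
  | app {m : ℕ} {Γ : List (Ty m)} {t t' s s' : Tm m} {A B : Ty m} :
      BEq Γ t t' (.arr A B) → BEq Γ s s' A → BEq Γ (.app t s) (.app t' s') B
  | tlam {m : ℕ} {Γ : List (Ty m)} {t t' : Tm (m + 1)} {A : Ty (m + 1)} :
      BEq (Γ.map Ty.wk) t t' A → BEq Γ (.tlam t) (.tlam t') (.all A)
  | tapp {m : ℕ} {Γ : List (Ty m)} {t t' : Tm m} {A : Ty (m + 1)} (B : Ty m) :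
      BEq Γ t t' (.all A) → BEq Γ (.tapp t B) (.tapp t' B) (A.inst B)
  | unit_eta {m : ℕ} {Γ : List (Ty m)} {t : Tm m} : HasType Γ t .unit → BEq Γ t .star .unit
  | fst_beta {m : ℕ} {Γ : List (Ty m)} {t s : Tm m} {A B : Ty m} :
      HasType Γ t A → HasType Γ s B → BEq Γ (.fst (.pair t s)) t A
  | snd_beta {m : ℕ} {Γ : List (Ty m)} {t s : Tm m} {A B : Ty m} :
      HasType Γ t A → HasType Γ s B → BEq Γ (.snd (.pair t s)) s B
  | pair_eta {m : ℕ} {Γ : List (Ty m)} {t : Tm m} {A B : Ty m} :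
      HasType Γ t (.prod A B) → BEq Γ t (.pair (.fst t) (.snd t)) (.prod A B)
  | lam_beta {m : ℕ} {Γ : List (Ty m)} {t s : Tm m} {A B : Ty m} :
      HasType (A :: Γ) t B → HasType Γ s A → BEq Γ (.app (.lam A t) s) (t.inst s) B
  | lam_eta {m : ℕ} {Γ : List (Ty m)} {t : Tm m} {A B : Ty m} :
      HasType Γ t (.arr A B) → BEq Γ t (.lam A (.app t.wk (.var 0))) (.arr A B)
  | tlam_beta {m : ℕ} {Γ : List (Ty m)} {t : Tm (m + 1)} {A : Ty (m + 1)} (B : Ty m) :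
      HasType (Γ.map Ty.wk) t A → BEq Γ (.tapp (.tlam t) B) (t.tinst B) (A.inst B)
  | tlam_eta {m : ℕ} {Γ : List (Ty m)} {t : Tm m} {A : Ty (m + 1)} :
      HasType Γ t (.all A) → BEq Γ t (.tlam (.tapp t.twk (.var 0))) (.all A)

/-! ### Substitution lemmas -/

theorem upR_id {m : ℕ} : upR (id : Fin m → Fin m) = id := by
  funext i; refine Fin.cases rfl (fun _ => rfl) i

theorem upR_comp {l m n : ℕ} (ξ : Fin l → Fin m) (ζ : Fin m → Fin n) :
    upR ζ ∘ upR ξ = upR (ζ ∘ ξ) := by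
  funext i; refine Fin.cases rfl (fun _ => rfl) i

theorem Ty.ren_ren {l m n : ℕ} (ξ : Fin l → Fin m) (ζ : Fin m → Fin n) (A : Ty l) :
    (A.ren ξ).ren ζ = A.ren (ζ ∘ ξ) := by
  induction A generalizing m n with
  | all A ih => simp [Ty.ren, ih, upR_comp]
  | _ => simp_all [Ty.ren]

theorem upT_var {m : ℕ} : upT (Ty.var : Fin m → Ty m) = Ty.var := by
  funext i; refine Fin.cases rfl (fun _ => rfl) i

theorem Ty.subst_var {m : ℕ} (A : Ty m) : A.subst Ty.var = A := by
  induction A with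
  | all A ih => simp [Ty.subst, upT_var, ih]
  | _ => simp_all [Ty.subst]

theorem Ty.ren_eq {m n : ℕ} (ξ : Fin m → Fin n) (A : Ty m) :
    A.ren ξ = A.subst (fun i => .var (ξ i)) := by
  induction A generalizing n with
  | all A ih =>
    simp only [Ty.ren, Ty.subst, ih]
    congr 2; funext i; refine Fin.cases rfl (fun _ => rfl) i
  | _ => simp_all [Ty.ren, Ty.subst]

theorem Ty.subst_ren {l m n : ℕ} (ξ : Fin l → Fin m) (θ : Fin m → Ty n) (A : Ty l) :
    (A.ren ξ).subst θ = A.subst (θ ∘ ξ) := by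
  induction A generalizing m n with
  | all A ih =>
    simp only [Ty.ren, Ty.subst, ih]
    congr 2; funext i; refine Fin.cases rfl (fun _ => rfl) i
  | _ => simp_all [Ty.ren, Ty.subst]

theorem Ty.ren_wk {m n : ℕ} (ξ : Fin m → Fin n) (A : Ty m) :
    (A.ren ξ).wk = A.wk.ren (upR ξ) := by
  simp only [Ty.wk, Ty.ren_ren]; rfl

theorem Ty.ren_subst {l m n : ℕ} (θ : Fin l → Ty m) (ξ : Fin m → Fin n) (A : Ty l) :
    (A.subst θ).ren ξ = A.subst (fun i => (θ i).ren ξ) := by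
  induction A generalizing m n with
  | all A ih =>
    simp only [Ty.ren, Ty.subst, ih]
    congr 2; funext i
    refine Fin.cases rfl (fun i => ?_) i
    exact (Ty.ren_wk ξ (θ i)).symm
  | _ => simp_all [Ty.ren, Ty.subst]

theorem Ty.subst_wk {m n : ℕ} (θ : Fin m → Ty n) (A : Ty m) :
    (A.subst θ).wk = A.wk.subst (upT θ) := by
  simp only [Ty.wk, Ty.ren_subst, Ty.subst_ren]; rfl

theorem Ty.subst_subst {l m n : ℕ} (θ : Fin l → Ty m) (τ : Fin m → Ty n) (A : Ty l) :
    (A.subst θ).subst τ = A.subst (fun i => (θ i).subst τ) := by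
  induction A generalizing m n with
  | all A ih =>
    simp only [Ty.subst, ih]
    congr 2; funext i
    refine Fin.cases rfl (fun i => ?_) i
    exact (Ty.subst_wk τ (θ i)).symm
  | _ => simp_all [Ty.subst]

theorem Ty.wk_inst {m : ℕ} (A B : Ty m) : A.wk.inst B = A := by
  simp only [Ty.wk, Ty.inst, Ty.subst_ren]
  exact Ty.subst_var A

theorem Ty.inst_subst {m n : ℕ} (A : Ty (m + 1)) (B : Ty m) (θ : Fin m → Ty n) :
    (A.inst B).subst θ = (A.subst (upT θ)).inst (B.subst θ) := by
  simp only [Ty.inst, Ty.subst_subst]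
  congr 1; funext i
  refine Fin.cases rfl (fun i => ?_) i
  exact (Ty.wk_inst (θ i) (B.subst θ)).symm

theorem upV_comp (ρ π : ℕ → ℕ) : upV π ∘ upV ρ = upV (π ∘ ρ) := by
  funext i; cases i <;> rfl

theorem Tm.ren_ren {l m n : ℕ} (ξ : Fin l → Fin m) (ρ : ℕ → ℕ) (ζ : Fin m → Fin n) (π : ℕ → ℕ)
    (t : Tm l) : (t.ren ξ ρ).ren ζ π = t.ren (ζ ∘ ξ) (π ∘ ρ) := by
  induction t generalizing m n ρ π with
  | lam A t ih => simp [Tm.ren, ih, upV_comp, Ty.ren_ren]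
  | tlam t ih => simp [Tm.ren, ih, upR_comp]
  | _ => simp_all [Tm.ren, Ty.ren_ren]

theorem upS_var {m : ℕ} : upS (Tm.var : ℕ → Tm m) = Tm.var := by
  funext i; cases i <;> rfl

theorem Tm.subst_var {m : ℕ} (t : Tm m) : t.subst Ty.var Tm.var = t := by
  induction t with
  | lam A t ih => simp [Tm.subst, upS_var, ih, Ty.subst_var]
  | tlam t ih =>
    simp only [Tm.subst, upT_var]
    exact congrArg Tm.tlam ih
  | _ => simp_all [Tm.subst, Ty.subst_var]

theorem Tm.ren_eq {m n : ℕ} (ξ : Fin m → Fin n) (ρ : ℕ → ℕ) (t : Tm m) :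
    t.ren ξ ρ = t.subst (fun i => .var (ξ i)) (fun i => .var (ρ i)) := by
  induction t generalizing n ρ with
  | lam A t ih =>
    simp only [Tm.ren, Tm.subst, ih, Ty.ren_eq]
    congr 2; funext i; cases i <;> rfl
  | tlam t ih =>
    simp only [Tm.ren, Tm.subst, ih]
    congr 2; funext i; refine Fin.cases rfl (fun _ => rfl) i
  | _ => simp_all [Tm.ren, Tm.subst, Ty.ren_eq]

theorem Tm.subst_ren {l m n : ℕ} (ξ : Fin l → Fin m) (ρ : ℕ → ℕ) (θ : Fin m → Ty n)
    (σ : ℕ → Tm n) (t : Tm l) : (t.ren ξ ρ).subst θ σ = t.subst (θ ∘ ξ) (σ ∘ ρ) := by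
  induction t generalizing m n ρ with
  | lam A t ih =>
    simp only [Tm.ren, Tm.subst, ih, Ty.subst_ren]
    congr 2; funext i; cases i <;> rfl
  | tlam t ih =>
    simp only [Tm.ren, Tm.subst, ih]
    congr 2; funext i; refine Fin.cases rfl (fun _ => rfl) i
  | _ => simp_all [Tm.ren, Tm.subst, Ty.subst_ren]

theorem Tm.ren_subst {l m n : ℕ} (θ : Fin l → Ty m) (σ : ℕ → Tm m) (ξ : Fin m → Fin n)
    (ρ : ℕ → ℕ) (t : Tm l) :
    (t.subst θ σ).ren ξ ρ = t.subst (fun i => (θ i).ren ξ) (fun i => (σ i).ren ξ ρ) := by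
  induction t generalizing m n ρ with
  | lam A t ih =>
    simp only [Tm.ren, Tm.subst, ih, Ty.ren_subst]
    congr 2; funext i; cases i with
    | zero => rfl
    | succ i => simp only [upS, Tm.wk, Tm.ren_ren]; rfl
  | tlam t ih =>
    simp only [Tm.ren, Tm.subst, ih]
    congr 2
    · funext i; refine Fin.cases rfl (fun i => ?_) i
      exact (Ty.ren_wk ξ (θ i)).symm
    · funext i; simp only [Tm.twk, Tm.ren_ren]; rfl
  | _ => simp_all [Tm.ren, Tm.subst, Ty.ren_subst]

theorem Tm.subst_subst {l m n : ℕ} (θ : Fin l → Ty m) (σ : ℕ → Tm m) (τ : Fin m → Ty n)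
    (ς : ℕ → Tm n) (t : Tm l) :
    (t.subst θ σ).subst τ ς = t.subst (fun i => (θ i).subst τ) (fun i => (σ i).subst τ ς) := by
  induction t generalizing m n with
  | lam A t ih =>
    simp only [Tm.subst, ih, Ty.subst_subst]
    congr 2; funext i; cases i with
    | zero => rfl
    | succ i =>
      simp only [upS, Tm.wk, Tm.ren_subst, Tm.subst_ren]
      congr 1; funext j; simp only [Function.comp, id, Ty.ren_eq, Ty.subst_var]
  | tlam t ih =>
    simp only [Tm.subst, ih]
    congr 2
    · funext i; refine Fin.cases rfl (fun i => ?_) i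
      exact (Ty.subst_wk τ (θ i)).symm
    · funext i; simp only [Tm.twk, Tm.ren_subst, Tm.subst_ren]; rfl
  | _ => simp_all [Tm.subst, Ty.subst_subst]

/-! ### Typing and `βη`-equality are stable under substitution -/

theorem HasType.ren {m n : ℕ} {Γ : List (Ty m)} {t : Tm m} {A : Ty m} (h : HasType Γ t A)
    {Δ : List (Ty n)} {ξ : Fin m → Fin n} {ρ : ℕ → ℕ}
    (hρ : ∀ i B, Γ[i]? = some B → Δ[ρ i]? = some (B.ren ξ)) :
    HasType Δ (t.ren ξ ρ) (A.ren ξ) := by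
  induction h generalizing n ρ with
  | var h => exact .var (hρ _ _ h)
  | star => exact .star
  | pair _ _ ih₁ ih₂ => exact .pair (ih₁ hρ) (ih₂ hρ)
  | fst _ ih => exact .fst (ih hρ)
  | snd _ ih => exact .snd (ih hρ)
  | lam _ ih =>
    refine .lam (ih (fun i B h => ?_))
    cases i with
    | zero => simp_all [upV]
    | succ i => exact hρ i B h
  | app _ _ ih₁ ih₂ => exact .app (ih₁ hρ) (ih₂ hρ)
  | tlam _ ih =>
    refine .tlam (ih (fun i B h => ?_))
    simp only [List.getElem?_map, Option.map_eq_some_iff] at h ⊢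
    obtain ⟨B', h, rfl⟩ := h
    exact ⟨_, hρ i B' h, Ty.ren_wk ξ B'⟩
  | @tapp _ _ _ A B _ ih =>
    have := HasType.tapp (B.ren ξ) (ih hρ)
    have e : (A.inst B).ren ξ = (A.ren (upR ξ)).inst (B.ren ξ) := by
      simp only [Ty.inst, Ty.ren_subst, Ty.subst_ren]
      congr 1; funext i; refine Fin.cases rfl (fun _ => rfl) i
    exact e ▸ this

theorem Ty.ren_id {m : ℕ} (A : Ty m) : A.ren id = A := by
  rw [Ty.ren_eq]; exact Ty.subst_var A

theorem HasType.wk {m : ℕ} {Γ : List (Ty m)} {t : Tm m} {A : Ty m} (h : HasType Γ t A) (B : Ty m) :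
    HasType (B :: Γ) t.wk A := by
  have := h.ren (Δ := B :: Γ) (ξ := id) (ρ := (· + 1)) (fun i C hC => by simpa [Ty.ren_id] using hC)
  rwa [Ty.ren_id] at this

theorem HasType.twk {m : ℕ} {Γ : List (Ty m)} {t : Tm m} {A : Ty m} (h : HasType Γ t A) :
    HasType (Γ.map Ty.wk) t.twk A.wk :=
  h.ren (fun i C hC => by simp [hC, Ty.wk])

theorem HasType.upS {m n : ℕ} {Γ : List (Ty m)} {Δ : List (Ty n)} {θ : Fin m → Ty n}
    {σ : ℕ → Tm n} (hσ : ∀ i B, Γ[i]? = some B → HasType Δ (σ i) (B.subst θ)) (A : Ty m) :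
    ∀ i B, (A :: Γ)[i]? = some B → HasType (A.subst θ :: Δ) (upS σ i) (B.subst θ) := by
  intro i B h
  cases i with
  | zero => simp only [List.getElem?_cons_zero, Option.some.injEq] at h; subst h; exact .var rfl
  | succ i => exact (hσ i B h).wk _

theorem HasType.upT {m n : ℕ} {Γ : List (Ty m)} {Δ : List (Ty n)} {θ : Fin m → Ty n}
    {σ : ℕ → Tm n} (hσ : ∀ i B, Γ[i]? = some B → HasType Δ (σ i) (B.subst θ)) :
    ∀ i B, (Γ.map Ty.wk)[i]? = some B → HasType (Δ.map Ty.wk) (σ i).twk (B.subst (upT θ)) := by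
  intro i B h
  simp only [List.getElem?_map, Option.map_eq_some_iff] at h
  obtain ⟨B', h, rfl⟩ := h
  exact Ty.subst_wk θ B' ▸ (hσ i B' h).twk

theorem HasType.subst {m n : ℕ} {Γ : List (Ty m)} {t : Tm m} {A : Ty m} (h : HasType Γ t A)
    {Δ : List (Ty n)} {θ : Fin m → Ty n} {σ : ℕ → Tm n}
    (hσ : ∀ i B, Γ[i]? = some B → HasType Δ (σ i) (B.subst θ)) :
    HasType Δ (t.subst θ σ) (A.subst θ) := by
  induction h generalizing n with
  | var h => exact hσ _ _ h
  | star => exact .star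
  | pair _ _ ih₁ ih₂ => exact .pair (ih₁ hσ) (ih₂ hσ)
  | fst _ ih => exact .fst (ih hσ)
  | snd _ ih => exact .snd (ih hσ)
  | lam _ ih => exact .lam (ih (HasType.upS hσ _))
  | app _ _ ih₁ ih₂ => exact .app (ih₁ hσ) (ih₂ hσ)
  | tlam _ ih => exact .tlam (ih (HasType.upT hσ))
  | @tapp _ _ _ A B _ ih =>
    exact Ty.inst_subst A B θ ▸ HasType.tapp (B.subst θ) (ih hσ)

theorem Tm.inst_subst {m n : ℕ} (t s : Tm m) (θ : Fin m → Ty n) (σ : ℕ → Tm n) :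
    (t.inst s).subst θ σ = (t.subst θ (upS σ)).inst (s.subst θ σ) := by
  simp only [Tm.inst, Tm.subst_subst, Ty.subst_var]
  congr 1; funext i; cases i with
  | zero => rfl
  | succ i =>
    simp only [instS, upS, Tm.subst, Tm.wk, Tm.subst_ren]
    exact (Tm.subst_var (σ i)).symm

theorem Tm.tinst_subst {m n : ℕ} (t : Tm (m + 1)) (B : Ty m) (θ : Fin m → Ty n) (σ : ℕ → Tm n) :
    (t.tinst B).subst θ σ = (t.subst (upT θ) (fun i => (σ i).twk)).tinst (B.subst θ) := by
  simp only [Tm.tinst, Tm.subst_subst]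
  congr 1
  · funext i; refine Fin.cases rfl (fun i => ?_) i
    exact (Ty.wk_inst (θ i) (B.subst θ)).symm
  · funext i
    simp only [Tm.subst, Tm.twk, Tm.subst_ren]
    exact (Tm.subst_var (σ i)).symm

theorem Tm.subst_wk {m n : ℕ} (t : Tm m) (θ : Fin m → Ty n) (σ : ℕ → Tm n) :
    (t.subst θ σ).wk = t.wk.subst θ (upS σ) := by
  simp only [Tm.wk, Tm.ren_subst, Tm.subst_ren]
  congr 1; funext i; exact Ty.ren_id _

theorem Tm.subst_twk {m n : ℕ} (t : Tm m) (θ : Fin m → Ty n) (σ : ℕ → Tm n) :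
    (t.subst θ σ).twk = t.twk.subst (upT θ) (fun i => (σ i).twk) := by
  simp only [Tm.twk, Tm.ren_subst, Tm.subst_ren]
  rfl

theorem BEq.subst {m n : ℕ} {Γ : List (Ty m)} {t s : Tm m} {A : Ty m} (h : BEq Γ t s A)
    {Δ : List (Ty n)} {θ : Fin m → Ty n} {σ : ℕ → Tm n}
    (hσ : ∀ i B, Γ[i]? = some B → HasType Δ (σ i) (B.subst θ)) :
    BEq Δ (t.subst θ σ) (s.subst θ σ) (A.subst θ) := by
  induction h generalizing n with
  | refl h => exact .refl (h.subst hσ)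
  | symm _ ih => exact .symm (ih hσ)
  | trans _ _ ih₁ ih₂ => exact .trans (ih₁ hσ) (ih₂ hσ)
  | pair _ _ ih₁ ih₂ => exact .pair (ih₁ hσ) (ih₂ hσ)
  | fst _ ih => exact .fst (ih hσ)
  | snd _ ih => exact .snd (ih hσ)
  | lam _ ih => exact .lam (ih (HasType.upS hσ _))
  | app _ _ ih₁ ih₂ => exact .app (ih₁ hσ) (ih₂ hσ)
  | tlam _ ih => exact .tlam (ih (HasType.upT hσ))
  | @tapp _ _ _ _ A B _ ih => exact Ty.inst_subst A B θ ▸ BEq.tapp (B.subst θ) (ih hσ)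
  | unit_eta h => exact .unit_eta (h.subst hσ)
  | fst_beta h₁ h₂ => exact .fst_beta (h₁.subst hσ) (h₂.subst hσ)
  | snd_beta h₁ h₂ => exact .snd_beta (h₁.subst hσ) (h₂.subst hσ)
  | pair_eta h => exact .pair_eta (h.subst hσ)
  | lam_beta h₁ h₂ =>
    rw [Tm.inst_subst]
    exact .lam_beta (h₁.subst (HasType.upS hσ _)) (h₂.subst hσ)
  | lam_eta h =>
    have := BEq.lam_eta (h.subst hσ)
    rwa [Tm.subst_wk] at this
  | @tlam_beta _ _ _ A B h =>
    rw [Tm.tinst_subst, Ty.inst_subst]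
    exact .tlam_beta (B.subst θ) (h.subst (HasType.upT hσ))
  | tlam_eta h =>
    have := BEq.tlam_eta (h.subst hσ)
    rwa [Tm.subst_twk] at this

theorem BEq.ren {m n : ℕ} {Γ : List (Ty m)} {t s : Tm m} {A : Ty m} (h : BEq Γ t s A)
    {Δ : List (Ty n)} {ξ : Fin m → Fin n} {ρ : ℕ → ℕ}
    (hρ : ∀ i B, Γ[i]? = some B → Δ[ρ i]? = some (B.ren ξ)) :
    BEq Δ (t.ren ξ ρ) (s.ren ξ ρ) (A.ren ξ) := by
  simp only [Tm.ren_eq, Ty.ren_eq]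
  refine h.subst (fun i B hB => .var ?_)
  rw [← Ty.ren_eq]; exact hρ i B hB

theorem BEq.wk {m : ℕ} {Γ : List (Ty m)} {t s : Tm m} {A : Ty m} (h : BEq Γ t s A) (B : Ty m) :
    BEq (B :: Γ) t.wk s.wk A := by
  have := h.ren (Δ := B :: Γ) (ξ := id) (ρ := (· + 1)) (fun i C hC => by simpa [Ty.ren_id] using hC)
  rwa [Ty.ren_id] at this

theorem BEq.twk {m : ℕ} {Γ : List (Ty m)} {t s : Tm m} {A : Ty m} (h : BEq Γ t s A) :
    BEq (Γ.map Ty.wk) t.twk s.twk A.wk :=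
  h.ren (fun i C hC => by simp [hC, Ty.wk])

theorem HasType.substCongr {m n : ℕ} {Γ : List (Ty m)} {t : Tm m} {A : Ty m} (h : HasType Γ t A)
    {Δ : List (Ty n)} {θ : Fin m → Ty n} {σ τ : ℕ → Tm n}
    (hσ : ∀ i B, Γ[i]? = some B → BEq Δ (σ i) (τ i) (B.subst θ)) :
    BEq Δ (t.subst θ σ) (t.subst θ τ) (A.subst θ) := by
  induction h generalizing n with
  | var h => exact hσ _ _ h
  | star => exact .refl .star
  | pair _ _ ih₁ ih₂ => exact .pair (ih₁ hσ) (ih₂ hσ)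
  | fst _ ih => exact .fst (ih hσ)
  | snd _ ih => exact .snd (ih hσ)
  | @lam _ _ _ A _ _ ih =>
    refine .lam (ih (fun i B h => ?_))
    cases i with
    | zero => simp only [List.getElem?_cons_zero, Option.some.injEq] at h; subst h; exact .refl (.var rfl)
    | succ i => exact (hσ i B h).wk _
  | app _ _ ih₁ ih₂ => exact .app (ih₁ hσ) (ih₂ hσ)
  | tlam _ ih =>
    refine .tlam (ih (fun i B h => ?_))
    simp only [List.getElem?_map, Option.map_eq_some_iff] at h
    obtain ⟨B', h, rfl⟩ := h
    exact Ty.subst_wk θ B' ▸ (hσ i B' h).twk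
  | @tapp _ _ _ A B _ ih =>
    exact Ty.inst_subst A B θ ▸ BEq.tapp (B.subst θ) (ih hσ)

end SysF

namespace SysF

/-! ### The term model

The fibre of the term model over a context of `m` type variables: objects are the types `Ty m`, and
morphisms `A ⟶ B` are the terms `x : A ⊢ t : B` modulo `βη`-equality. -/

/-- Well-typed terms `Γ ⊢ t : A`. -/
abbrev TTm {m : ℕ} (Γ : List (Ty m)) (A : Ty m) : Type := {t : Tm m // HasType Γ t A}

/-- `βη`-equality as a setoid. -/
instance TTm.setoid {m : ℕ} (Γ : List (Ty m)) (A : Ty m) : Setoid (TTm Γ A) where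
  r t s := BEq Γ t.1 s.1 A
  iseqv := ⟨fun t => .refl t.2, fun h => .symm h, fun h₁ h₂ => .trans h₁ h₂⟩

/-- Morphisms of the term model. -/
def Hom {m : ℕ} (A B : Ty m) : Type := Quotient (TTm.setoid [A] B)

/-- The `βη`-class of a term in one variable. -/
def Hom.mk {m : ℕ} {A B : Ty m} (t : Tm m) (h : HasType [A] t B) : Hom A B :=
  Quotient.mk (TTm.setoid [A] B) ⟨t, h⟩

theorem HasType.subst₀ {m : ℕ} {Γ Δ : List (Ty m)} {t : Tm m} {B : Ty m} {σ : ℕ → Tm m}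
    (h : HasType Γ t B) (hσ : ∀ i C, Γ[i]? = some C → HasType Δ (σ i) C) :
    HasType Δ (t.subst Ty.var σ) B := by
  have := h.subst (θ := Ty.var) (Δ := Δ) (σ := σ) (fun i C hC => by
    rw [Ty.subst_var]; exact hσ i C hC)
  rwa [Ty.subst_var] at this

theorem BEq.subst₀ {m : ℕ} {Γ Δ : List (Ty m)} {t t' : Tm m} {B : Ty m} {σ σ' : ℕ → Tm m}
    (h : BEq Γ t t' B) (ht : HasType Γ t B)
    (hσ' : ∀ i C, Γ[i]? = some C → HasType Δ (σ' i) C)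
    (hσ : ∀ i C, Γ[i]? = some C → BEq Δ (σ i) (σ' i) C) :
    BEq Δ (t.subst Ty.var σ) (t'.subst Ty.var σ') B := by
  have h₁ := ht.substCongr (θ := Ty.var) (Δ := Δ) (σ := σ) (τ := σ') (fun i C hC => by
    rw [Ty.subst_var]; exact hσ i C hC)
  have h₂ := h.subst (θ := Ty.var) (Δ := Δ) (σ := σ') (fun i C hC => by
    rw [Ty.subst_var]; exact hσ' i C hC)
  rw [Ty.subst_var] at h₁ h₂
  exact h₁.trans h₂

theorem forall_single {m : ℕ} {A : Ty m} {P : Ty m → Prop} (h : P A) :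
    ∀ (i : ℕ) (C : Ty m), [A][i]? = some C → P C := by
  intro i C hC
  cases i with
  | zero => simp only [List.getElem?_cons_zero, Option.some.injEq] at hC; exact hC ▸ h
  | succ i => simp at hC

/-- Composition is substitution: `t ∘ s = t[s / x]`. -/
def Hom.comp {m : ℕ} {A B C : Ty m} : Hom A B → Hom B C → Hom A C :=
  Quotient.map₂ (fun s t => ⟨t.1.subst Ty.var (fun _ => s.1),
      t.2.subst₀ (forall_single (P := fun D => HasType [A] s.1 D) s.2)⟩)
    (fun _ s' hs t _ ht => BEq.subst₀ ht t.2 (forall_single (P := fun D => HasType [A] s'.1 D) s'.2)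
      (forall_single (P := fun D => BEq [A] _ s'.1 D) hs))

instance termModel {m : ℕ} : Category (Ty m) where
  Hom := Hom
  id _ := Hom.mk (.var 0) (.var rfl)
  comp := Hom.comp
  id_comp f := by
    obtain ⟨t, rfl⟩ := Quotient.exists_rep f
    refine Quotient.sound (s := TTm.setoid _ _) ?_
    show BEq _ _ _ _
    have := (BEq.refl t.2).subst₀ (σ := fun _ => .var 0) (σ' := Tm.var) (Δ := [_]) t.2
      (fun i C hC => .var hC) (fun i C hC => by
        cases i with
        | zero => exact .refl (.var hC)
        | succ i => simp at hC)
    rwa [Tm.subst_var] at this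
  comp_id f := by
    obtain ⟨t, rfl⟩ := Quotient.exists_rep f
    rfl
  assoc f g h := by
    obtain ⟨s, rfl⟩ := Quotient.exists_rep f
    obtain ⟨t, rfl⟩ := Quotient.exists_rep g
    obtain ⟨r, rfl⟩ := Quotient.exists_rep h
    refine congrArg (Quotient.mk _) (Subtype.ext ?_)
    exact (Tm.subst_subst Ty.var (fun _ => t.1) Ty.var (fun _ => s.1) r.1).symm

/-- The `βη`-class of a term in one variable, as a morphism of the term model. -/
def mk {m : ℕ} {A B : Ty m} (t : Tm m) (h : HasType [A] t B) : A ⟶ B := Hom.mk t h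

theorem mk_eq {m : ℕ} {A B : Ty m} {s t : Tm m} {hs : HasType [A] s B} {ht : HasType [A] t B}
    (h : BEq [A] s t B) : mk s hs = mk t ht := Quotient.sound h

theorem exists_mk {m : ℕ} {A B : Ty m} (f : A ⟶ B) : ∃ t h, f = mk t h := by
  obtain ⟨t, rfl⟩ := Quotient.exists_rep f
  exact ⟨t.1, t.2, rfl⟩

/-- Pairing. -/
def pairHom {m : ℕ} {A B C : Ty m} : (A ⟶ B) → (A ⟶ C) → (A ⟶ Ty.prod B C) :=
  Quotient.map₂ (sa := TTm.setoid [A] B) (sb := TTm.setoid [A] C) (sc := TTm.setoid [A] (.prod B C))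
    (fun s t => ⟨.pair s.1 t.1, .pair s.2 t.2⟩) (fun _ _ h₁ _ _ h₂ => BEq.pair h₁ h₂)

/-- The first projection. -/
def fstHom {m : ℕ} (A B : Ty m) : Ty.prod A B ⟶ A := mk (.fst (.var 0)) (.fst (.var rfl))

/-- The second projection. -/
def sndHom {m : ℕ} (A B : Ty m) : Ty.prod A B ⟶ B := mk (.snd (.var 0)) (.snd (.var rfl))

theorem pairHom_fst {m : ℕ} {A B C : Ty m} (f : A ⟶ B) (g : A ⟶ C) :
    pairHom f g ≫ fstHom B C = f := by
  obtain ⟨s, hs, rfl⟩ := exists_mk f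
  obtain ⟨t, ht, rfl⟩ := exists_mk g
  exact mk_eq (hs := .fst (.pair hs ht)) (.fst_beta hs ht)

theorem pairHom_snd {m : ℕ} {A B C : Ty m} (f : A ⟶ B) (g : A ⟶ C) :
    pairHom f g ≫ sndHom B C = g := by
  obtain ⟨s, hs, rfl⟩ := exists_mk f
  obtain ⟨t, ht, rfl⟩ := exists_mk g
  exact mk_eq (hs := .snd (.pair hs ht)) (.snd_beta hs ht)

theorem pairHom_eta {m : ℕ} {A B C : Ty m} (f : A ⟶ Ty.prod B C) :
    pairHom (f ≫ fstHom B C) (f ≫ sndHom B C) = f := by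
  obtain ⟨t, ht, rfl⟩ := exists_mk f
  exact mk_eq (hs := .pair (.fst ht) (.snd ht)) (BEq.pair_eta ht).symm

/-- Finite products in the term model are given by the unit and product types. -/
instance cartesian {m : ℕ} : CartesianMonoidalCategory (Ty m) :=
  .ofChosenFiniteProducts
    { cone := Limits.asEmptyCone Ty.unit
      isLimit := Limits.IsTerminal.ofUniqueHom (fun _ => mk .star .star) (fun A f => by
        obtain ⟨t, ht, rfl⟩ := exists_mk f
        exact mk_eq (.unit_eta ht)) }
    (fun A B =>
      { cone := Limits.BinaryFan.mk (fstHom A B) (sndHom A B)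
        isLimit := Limits.BinaryFan.IsLimit.mk _ (fun f g => pairHom f g)
          (fun f g => pairHom_fst f g) (fun f g => pairHom_snd f g)
          (fun f g h h₁ h₂ => by subst h₁ h₂; exact (pairHom_eta h).symm) })

/-- The product `((1 × Aₙ) × ⋯) × A₁` of the types of a context. -/
def ctxTy {m : ℕ} : List (Ty m) → Ty m
  | [] => .unit
  | A :: Γ => .prod (ctxTy Γ) A

/-- The projection of a tuple `t : ctxTy Γ` to the variable `i`. -/
def ctxProj {m : ℕ} : ℕ → Tm m → Tm m
  | 0, t => .snd t
  | i + 1, t => ctxProj i (.fst t)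

theorem hasType_ctxProj {m : ℕ} {Δ : List (Ty m)} : (Γ : List (Ty m)) → (i : ℕ) → (A : Ty m) →
    Γ[i]? = some A → {t : Tm m} → HasType Δ t (ctxTy Γ) → HasType Δ (ctxProj i t) A
  | [], _, _, h, _, _ => by simp at h
  | B :: Γ, 0, A, h, t, ht => by
      simp only [List.getElem?_cons_zero, Option.some.injEq] at h; subst h; exact .snd ht
  | B :: Γ, i + 1, A, h, t, ht => hasType_ctxProj Γ i A h (.fst ht)

/-- The morphism of the term model given by a term `Γ ⊢ t : A` in several variables: the
`βη`-class of the term `x : A₁ × ⋯ × Aₙ ⊢ t[π₁ x / x₁, …, πₙ x / xₙ] : A`. -/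
def cls {m : ℕ} {Γ : List (Ty m)} {A : Ty m} (t : Tm m) (h : HasType Γ t A) : ctxTy Γ ⟶ A :=
  mk (t.subst Ty.var (fun i => ctxProj i (.var 0)))
    (h.subst₀ (fun i C hC => hasType_ctxProj Γ i C hC (.var rfl)))

end SysF

namespace LamEff

/-! ### Types and terms of the effect handler calculus -/

/-- A signature over `X`: a finite partial function from operation symbols to pairs of elements
of `X`, given by its (finite) domain, its argument types and its result types. -/
structure Sig (Op : Type u) (X : Type v) where
  dom : Finset Op
  arg : {o // o ∈ dom} → X
  res : {o // o ∈ dom} → X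

/-- The action of a function on signatures. -/
def Sig.map {Op : Type u} {X : Type v} {Y : Type w} (f : X → Y) (S : Sig Op X) : Sig Op Y :=
  ⟨S.dom, fun o => f (S.arg o), fun o => f (S.res o)⟩

/-- The operations of a signature, listed in an arbitrary but fixed order that depends only on
the domain. -/
noncomputable def Sig.ops {Op : Type u} {X : Type v} (S : Sig Op X) : List {o // o ∈ S.dom} :=
  S.dom.attach.toList

theorem Sig.mem_ops {Op : Type u} {X : Type v} (S : Sig Op X) (o : {o // o ∈ S.dom}) :
    o ∈ S.ops := by
  simp [Sig.ops]

/-- Value types. `fn A B dom arg res` is the function type `A → B ! Σ` where `Σ` is the signature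
`⟨dom, arg, res⟩`, see `VTy.arr`; `prod n A` is the product of `A 0, …, A (n - 1)`. -/
inductive VTy (Op : Type u) : Type u
  | fn (A B : VTy Op) (dom : Finset Op) (arg res : {o // o ∈ dom} → VTy Op) : VTy Op
  | prod (n : ℕ) (A : Fin n → VTy Op) : VTy Op

/-- Computation types `A ! Σ`. -/
structure CTy (Op : Type u) where
  ret : VTy Op
  sig : Sig Op (VTy Op)

/-- The function type `A → C`. -/
abbrev VTy.arr {Op : Type u} (A : VTy Op) (C : CTy Op) : VTy Op :=
  .fn A C.ret C.sig.dom C.sig.arg C.sig.res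

/-- Contexts, the innermost variable first. -/
abbrev Ctx (Op : Type u) : Type u := List (VTy Op)

/-- Variables `(x : A) ∈ Γ` as typed de Bruijn indices. -/
inductive Var {Op : Type u} : Ctx Op → VTy Op → Type u
  | zero {Γ : Ctx Op} {A : VTy Op} : Var (A :: Γ) A
  | succ {Γ : Ctx Op} {A B : VTy Op} (x : Var Γ A) : Var (B :: Γ) A

/- Terms are intrinsically typed: an element of `Val Γ A` (of `Comp Γ C`) is a value term
(a computation term) together with a derivation of `Γ ⊢ V : A` (of `Γ ⊢ M : C`). -/
mutual
/-- Well-typed value terms `Γ ⊢ V : A`. -/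
inductive Val {Op : Type u} : Ctx Op → VTy Op → Type u
  | var {Γ : Ctx Op} {A : VTy Op} (x : Var Γ A) : Val Γ A
  | lam {Γ : Ctx Op} {A : VTy Op} {C : CTy Op} (M : Comp (A :: Γ) C) : Val Γ (A.arr C)
  | tuple {Γ : Ctx Op} {n : ℕ} {A : Fin n → VTy Op} (V : ∀ i, Val Γ (A i)) : Val Γ (.prod n A)
  | proj {Γ : Ctx Op} {n : ℕ} {A : Fin n → VTy Op} (V : Val Γ (.prod n A)) (i : Fin n) :
      Val Γ (A i)
/-- Well-typed computation terms `Γ ⊢ M : C`. -/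
inductive Comp {Op : Type u} : Ctx Op → CTy Op → Type u
  /-- application `V W` -/
  | app {Γ : Ctx Op} {A : VTy Op} {C : CTy Op} (V : Val Γ (A.arr C)) (W : Val Γ A) : Comp Γ C
  /-- `return V` -/
  | ret {Γ : Ctx Op} {A : VTy Op} {S : Sig Op (VTy Op)} (V : Val Γ A) : Comp Γ ⟨A, S⟩
  /-- `let x = M in N` -/
  | letIn {Γ : Ctx Op} {A B : VTy Op} {S : Sig Op (VTy Op)}
      (M : Comp Γ ⟨A, S⟩) (N : Comp (A :: Γ) ⟨B, S⟩) : Comp Γ ⟨B, S⟩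
  /-- `op(V)` -/
  | op {Γ : Ctx Op} {S : Sig Op (VTy Op)} (o : {o // o ∈ S.dom}) (V : Val Γ (S.arg o)) :
      Comp Γ ⟨S.res o, S⟩
  /-- `with H handle M to x. N`, where `H` has one clause `op(x, k) ↦ H op` for each operation
  `op` in the signature of `M`; in a clause `k` is the variable `0` and `x` the variable `1` -/
  | handle {Γ : Ctx Op} {A : VTy Op} {S : Sig Op (VTy Op)} {C : CTy Op}
      (M : Comp Γ ⟨A, S⟩)
      (H : ∀ o : {o // o ∈ S.dom}, Comp ((S.res o).arr C :: S.arg o :: Γ) C)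
      (N : Comp (A :: Γ) C) : Comp Γ C
end

/-- Well-typed handlers `Γ ⊢ H : Σ ⇒ C`: finite sets of clauses `op(x, k) ↦ M_op`, one for each
operation `op` in `Σ`, where `Γ, x : A_op, k : B_op → C ⊢ M_op : C`. -/
abbrev Handler {Op : Type u} (Γ : Ctx Op) (S : Sig Op (VTy Op)) (C : CTy Op) : Type u :=
  ∀ o : {o // o ∈ S.dom}, Comp ((S.res o).arr C :: S.arg o :: Γ) C

/-! ### Renaming and substitution -/

/-- Renamings. -/
def Ren {Op : Type u} (Γ Δ : Ctx Op) : Type u := ∀ A : VTy Op, Var Γ A → Var Δ A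

/-- Lifting of a renaming under a binder. -/
def Ren.lift {Op : Type u} {Γ Δ : Ctx Op} (ρ : Ren Γ Δ) {B : VTy Op} : Ren (B :: Γ) (B :: Δ)
  | _, .zero => .zero
  | _, .succ x => .succ (ρ _ x)

mutual
/-- Renaming in value terms. -/
def Val.ren {Op : Type u} : {Γ Δ : Ctx Op} → {A : VTy Op} → Val Γ A → Ren Γ Δ → Val Δ A
  | _, _, _, .var x, ρ => .var (ρ _ x)
  | _, _, _, .lam M, ρ => .lam (M.ren ρ.lift)
  | _, _, _, .tuple V, ρ => .tuple (fun i => (V i).ren ρ)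
  | _, _, _, .proj (A := _) V i, ρ => .proj (V.ren ρ) i
/-- Renaming in computation terms. -/
def Comp.ren {Op : Type u} : {Γ Δ : Ctx Op} → {C : CTy Op} → Comp Γ C → Ren Γ Δ → Comp Δ C
  | _, _, _, .app V W, ρ => .app (V.ren ρ) (W.ren ρ)
  | _, _, _, .ret V, ρ => .ret (V.ren ρ)
  | _, _, _, .letIn M N, ρ => .letIn (M.ren ρ) (N.ren ρ.lift)
  | _, _, _, .op o V, ρ => .op o (V.ren ρ)
  | _, _, _, .handle M H N, ρ =>
      .handle (M.ren ρ) (fun o => (H o).ren ρ.lift.lift) (N.ren ρ.lift)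
end

/-- The weakening renaming. -/
def Ren.wk {Op : Type u} {Γ : Ctx Op} {B : VTy Op} : Ren Γ (B :: Γ) := fun _ x => .succ x

/-- Substitutions of value terms for variables. -/
def Subst {Op : Type u} (Γ Δ : Ctx Op) : Type u := ∀ A : VTy Op, Var Γ A → Val Δ A

/-- Lifting of a substitution under a binder. -/
def Subst.lift {Op : Type u} {Γ Δ : Ctx Op} (σ : Subst Γ Δ) {B : VTy Op} :
    Subst (B :: Γ) (B :: Δ)
  | _, .zero => .var .zero
  | _, .succ x => (σ _ x).ren Ren.wk

mutual
/-- Substitution in value terms. -/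
def Val.subst {Op : Type u} : {Γ Δ : Ctx Op} → {A : VTy Op} → Val Γ A → Subst Γ Δ → Val Δ A
  | _, _, _, .var x, σ => σ _ x
  | _, _, _, .lam M, σ => .lam (M.subst σ.lift)
  | _, _, _, .tuple V, σ => .tuple (fun i => (V i).subst σ)
  | _, _, _, .proj (A := _) V i, σ => .proj (V.subst σ) i
/-- Substitution in computation terms. -/
def Comp.subst {Op : Type u} : {Γ Δ : Ctx Op} → {C : CTy Op} → Comp Γ C → Subst Γ Δ → Comp Δ C
  | _, _, _, .app V W, σ => .app (V.subst σ) (W.subst σ)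
  | _, _, _, .ret V, σ => .ret (V.subst σ)
  | _, _, _, .letIn M N, σ => .letIn (M.subst σ) (N.subst σ.lift)
  | _, _, _, .op o V, σ => .op o (V.subst σ)
  | _, _, _, .handle M H N, σ =>
      .handle (M.subst σ) (fun o => (H o).subst σ.lift.lift) (N.subst σ.lift)
end

/-- The substitution `[V / x]` for the innermost variable `x`. -/
def Subst.one {Op : Type u} {Γ : Ctx Op} {A : VTy Op} (V : Val Γ A) : Subst (A :: Γ) Γ
  | _, .zero => V
  | _, .succ x => .var x

/-- The substitution `[V / x, W / k]` for the two innermost variables `x`, `k`. -/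
def Subst.two {Op : Type u} {Γ : Ctx Op} {A B : VTy Op} (V : Val Γ A) (W : Val Γ B) :
    Subst (B :: A :: Γ) Γ
  | _, .zero => W
  | _, .succ .zero => V
  | _, .succ (.succ x) => .var x

/-! ### Equational theory -/

mutual
/-- Derivable equations `Γ ⊢ V = W : A`. -/
inductive VEq {Op : Type u} : {Γ : Ctx Op} → {A : VTy Op} → Val Γ A → Val Γ A → Prop
  | refl {Γ : Ctx Op} {A : VTy Op} (V : Val Γ A) : VEq V V
  | symm {Γ : Ctx Op} {A : VTy Op} {V W : Val Γ A} : VEq V W → VEq W V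
  | trans {Γ : Ctx Op} {A : VTy Op} {U V W : Val Γ A} : VEq U V → VEq V W → VEq U W
  | lam {Γ : Ctx Op} {A : VTy Op} {C : CTy Op} {M N : Comp (A :: Γ) C} :
      CEq M N → VEq (.lam M) (.lam N)
  | tuple {Γ : Ctx Op} {n : ℕ} {A : Fin n → VTy Op} {V W : ∀ i, Val Γ (A i)} :
      (∀ i, VEq (V i) (W i)) → VEq (.tuple V) (.tuple W)
  | proj {Γ : Ctx Op} {n : ℕ} {A : Fin n → VTy Op} {V W : Val Γ (.prod n A)} (i : Fin n) :
      VEq V W → VEq (.proj V i) (.proj W i)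
  | lam_eta {Γ : Ctx Op} {A : VTy Op} {C : CTy Op} (V : Val Γ (A.arr C)) :
      VEq V (.lam (.app (V.ren Ren.wk) (.var .zero)))
  | prod_beta {Γ : Ctx Op} {n : ℕ} {A : Fin n → VTy Op} (V : ∀ i, Val Γ (A i)) (i : Fin n) :
      VEq (.proj (.tuple V) i) (V i)
  | prod_eta {Γ : Ctx Op} {n : ℕ} {A : Fin n → VTy Op} (V : Val Γ (.prod n A)) :
      VEq V (.tuple (fun i => .proj V i))
/-- Derivable equations `Γ ⊢ M = N : C`. -/
inductive CEq {Op : Type u} : {Γ : Ctx Op} → {C : CTy Op} → Comp Γ C → Comp Γ C → Prop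
  | refl {Γ : Ctx Op} {C : CTy Op} (M : Comp Γ C) : CEq M M
  | symm {Γ : Ctx Op} {C : CTy Op} {M N : Comp Γ C} : CEq M N → CEq N M
  | trans {Γ : Ctx Op} {C : CTy Op} {L M N : Comp Γ C} : CEq L M → CEq M N → CEq L N
  | app {Γ : Ctx Op} {A : VTy Op} {C : CTy Op} {V V' : Val Γ (A.arr C)} {W W' : Val Γ A} :
      VEq V V' → VEq W W' → CEq (.app V W) (.app V' W')
  | ret {Γ : Ctx Op} {A : VTy Op} {S : Sig Op (VTy Op)} {V W : Val Γ A} :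
      VEq V W → CEq (.ret (S := S) V) (.ret W)
  | letIn {Γ : Ctx Op} {A B : VTy Op} {S : Sig Op (VTy Op)} {M M' : Comp Γ ⟨A, S⟩}
      {N N' : Comp (A :: Γ) ⟨B, S⟩} : CEq M M' → CEq N N' → CEq (.letIn M N) (.letIn M' N')
  | op {Γ : Ctx Op} {S : Sig Op (VTy Op)} (o : {o // o ∈ S.dom}) {V W : Val Γ (S.arg o)} :
      VEq V W → CEq (.op o V) (.op o W)
  | handle {Γ : Ctx Op} {A : VTy Op} {S : Sig Op (VTy Op)} {C : CTy Op}
      {M M' : Comp Γ ⟨A, S⟩} {H H' : Handler Γ S C} {N N' : Comp (A :: Γ) C} :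
      CEq M M' → (∀ o, CEq (H o) (H' o)) → CEq N N' → CEq (.handle M H N) (.handle M' H' N')
  | lam_beta {Γ : Ctx Op} {A : VTy Op} {C : CTy Op} (M : Comp (A :: Γ) C) (V : Val Γ A) :
      CEq (.app (.lam M) V) (M.subst (Subst.one V))
  | ret_let {Γ : Ctx Op} {A B : VTy Op} {S : Sig Op (VTy Op)} (V : Val Γ A)
      (M : Comp (A :: Γ) ⟨B, S⟩) : CEq (.letIn (.ret V) M) (M.subst (Subst.one V))
  | let_ret {Γ : Ctx Op} {A : VTy Op} {S : Sig Op (VTy Op)} (M : Comp Γ ⟨A, S⟩) :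
      CEq (.letIn M (.ret (.var .zero))) M
  | let_let {Γ : Ctx Op} {A₁ A₂ A₃ : VTy Op} {S : Sig Op (VTy Op)} (M : Comp Γ ⟨A₁, S⟩)
      (N : Comp (A₁ :: Γ) ⟨A₂, S⟩) (L : Comp (A₂ :: Γ) ⟨A₃, S⟩) :
      CEq (.letIn (.letIn M N) L) (.letIn M (.letIn N (L.ren Ren.wk.lift)))
  | handle_ret {Γ : Ctx Op} {A : VTy Op} {S : Sig Op (VTy Op)} {C : CTy Op} (V : Val Γ A)
      (H : Handler Γ S C) (M : Comp (A :: Γ) C) :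
      CEq (.handle (.ret V) H M) (M.subst (Subst.one V))
  | handle_let {Γ : Ctx Op} {A B : VTy Op} {S : Sig Op (VTy Op)} {C : CTy Op}
      (L : Comp Γ ⟨A, S⟩) (M : Comp (A :: Γ) ⟨B, S⟩) (H : Handler Γ S C) (N : Comp (B :: Γ) C) :
      CEq (.handle (.letIn L M) H N)
        (.handle L H (.handle M (fun o => (H o).ren Ren.wk.lift.lift) (N.ren Ren.wk.lift)))
  | handle_op {Γ : Ctx Op} {S : Sig Op (VTy Op)} {C : CTy Op} (o : {o // o ∈ S.dom})
      (V : Val Γ (S.arg o)) (H : Handler Γ S C) (M : Comp (S.res o :: Γ) C) :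
      CEq (.handle (.op o V) H M) ((H o).subst (Subst.two V (.lam M)))
end

/-- Derivable equations `Γ ⊢ H = H' : Σ ⇒ C`: the congruence rule for handlers, which is already
reflexive, symmetric and transitive. -/
def HEqv {Op : Type u} {Γ : Ctx Op} {S : Sig Op (VTy Op)} {C : CTy Op} (H H' : Handler Γ S C) :
    Prop :=
  ∀ o, CEq (H o) (H' o)

/-! ### Operational semantics -/

/-- Evaluation contexts `𝒞 ::= [] | let x = 𝒞 in N | with H handle 𝒞 to x. M`; an element of
`ECtx Γ D C` has a hole of type `D` and is of type `C`. -/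
inductive ECtx {Op : Type u} (Γ : Ctx Op) (D : CTy Op) : CTy Op → Type u
  | hole : ECtx Γ D D
  | letIn {A B : VTy Op} {S : Sig Op (VTy Op)} (E : ECtx Γ D ⟨A, S⟩)
      (N : Comp (A :: Γ) ⟨B, S⟩) : ECtx Γ D ⟨B, S⟩
  | handle {A : VTy Op} {S : Sig Op (VTy Op)} {C : CTy Op} (E : ECtx Γ D ⟨A, S⟩)
      (H : Handler Γ S C) (M : Comp (A :: Γ) C) : ECtx Γ D C

/-- `𝒞[M]`. -/
def ECtx.plug {Op : Type u} {Γ : Ctx Op} {D : CTy Op} :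
    {C : CTy Op} → ECtx Γ D C → Comp Γ D → Comp Γ C
  | _, .hole, M => M
  | _, .letIn E N, M => .letIn (E.plug M) N
  | _, .handle E H N, M => .handle (E.plug M) H N

/-- Renaming in evaluation contexts. -/
def ECtx.ren {Op : Type u} {Γ Δ : Ctx Op} {D : CTy Op} :
    {C : CTy Op} → ECtx Γ D C → Ren Γ Δ → ECtx Δ D C
  | _, .hole, _ => .hole
  | _, .letIn E N, ρ => .letIn (E.ren ρ) (N.ren ρ.lift)
  | _, .handle E H M, ρ => .handle (E.ren ρ) (fun o => (H o).ren ρ.lift.lift) (M.ren ρ.lift)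

/-- `𝒞` does not contain handle-with (on the path to the hole). -/
def ECtx.HandleFree {Op : Type u} {Γ : Ctx Op} {D : CTy Op} : {C : CTy Op} → ECtx Γ D C → Prop
  | _, .hole => True
  | _, .letIn E _ => E.HandleFree
  | _, .handle _ _ _ => False

/-- The reduction relation `M ⇝ N` on closed computation terms. (In the last rule a handle-free
context has the same signature as its hole, so that both are typed with the signature of `H`.) -/
inductive Red {Op : Type u} : {C : CTy Op} → Comp [] C → Comp [] C → Prop
  | ctx {C D : CTy Op} (E : ECtx [] D C) {M N : Comp [] D} : Red M N → Red (E.plug M) (E.plug N)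
  | ret_let {A B : VTy Op} {S : Sig Op (VTy Op)} (V : Val [] A) (M : Comp [A] ⟨B, S⟩) :
      Red (.letIn (.ret V) M) (M.subst (Subst.one V))
  | lam_beta {A : VTy Op} {C : CTy Op} (M : Comp [A] C) (V : Val [] A) :
      Red (.app (.lam M) V) (M.subst (Subst.one V))
  | handle_ret {A : VTy Op} {S : Sig Op (VTy Op)} {C : CTy Op} (V : Val [] A)
      (H : Handler [] S C) (M : Comp [A] C) :
      Red (.handle (.ret V) H M) (M.subst (Subst.one V))
  | handle_op {A : VTy Op} {S : Sig Op (VTy Op)} {C : CTy Op} (o : {o // o ∈ S.dom})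
      (E : ECtx [] ⟨S.res o, S⟩ ⟨A, S⟩) (hE : E.HandleFree) (V : Val [] (S.arg o))
      (H : Handler [] S C) (M : Comp [A] C) :
      Red (.handle (E.plug (.op o V)) H M)
        ((H o).subst (Subst.two V
          (.lam (.handle ((E.ren Ren.wk).plug (.ret (.var .zero)))
            (fun o' => (H o').ren Ren.wk.lift.lift) (M.ren Ren.wk.lift)))))

/-! ### Models -/

section Products

variable {C : Type v} [Category.{w} C] [CartesianMonoidalCategory C] {ι : Type u}

/-- The product `A i₁ × (A i₂ × ⋯ × 1)` of a family over a list of indices. -/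
def listProd (A : ι → C) (l : List ι) : C := l.foldr (fun i P => A i ⊗ P) (𝟙_ C)

/-- Tupling into `listProd`. -/
def listTuple {X : C} {A : ι → C} (f : ∀ i, X ⟶ A i) : (l : List ι) → (X ⟶ listProd A l)
  | [] => toUnit X
  | i :: l => lift (f i) (listTuple f l)

/-- The projections of `listProd`. -/
def listProj [DecidableEq ι] (A : ι → C) : (l : List ι) → (i : ι) → i ∈ l → (listProd A l ⟶ A i)
  | [], _, h => absurd h List.not_mem_nil
  | j :: l, i, h =>
      if e : i = j then fst (A j) (listProd A l) ≫ eqToHom (congrArg A e.symm)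
      else snd (A j) (listProd A l) ≫ listProj A l i ((List.mem_cons.mp h).resolve_left e)

end Products

/-- The data of a strong Kleisli triple on a cartesian category. -/
structure KleisliData (C : Type v) [Category.{w} C] [CartesianMonoidalCategory C] where
  obj : C → C
  unit (X : C) : X ⟶ obj X
  ext {X Y Z : C} (f : X ⊗ Y ⟶ obj Z) : X ⊗ obj Y ⟶ obj Z

namespace KleisliData

variable {C : Type v} [Category.{w} C] [CartesianMonoidalCategory C] (T : KleisliData C)

/-- The laws of a strong Kleisli triple. -/
structure IsStrongKleisliTriple : Prop where
  ext_unit (X : C) : T.ext ((λ_ X).hom ≫ T.unit X) = (λ_ (T.obj X)).hom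
  unit_ext {X Y Z : C} (f : X ⊗ Y ⟶ T.obj Z) : X ◁ T.unit Y ≫ T.ext f = f
  ext_ext {W X Y Z V : C} (f : X ⊗ Y ⟶ T.obj Z) (g : W ⊗ Z ⟶ T.obj V) :
    (α_ W X (T.obj Y)).hom ≫ W ◁ T.ext f ≫ T.ext g =
      T.ext ((α_ W X Y).hom ≫ W ◁ f ≫ T.ext g)

/-- The action on morphisms of the strong monad of a strong Kleisli triple. -/
def map {X Y : C} (f : X ⟶ Y) : T.obj X ⟶ T.obj Y :=
  (λ_ (T.obj X)).inv ≫ T.ext ((λ_ X).hom ≫ f ≫ T.unit Y)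

/-- The multiplication. -/
def mu (X : C) : T.obj (T.obj X) ⟶ T.obj X :=
  (λ_ (T.obj (T.obj X))).inv ≫ T.ext (λ_ (T.obj X)).hom

/-- The strength. -/
def str (X Y : C) : X ⊗ T.obj Y ⟶ T.obj (X ⊗ Y) := T.ext (T.unit (X ⊗ Y))

end KleisliData

/-- A family of strong Kleisli triples indexed by semantic signatures, with Kleisli exponentials
`exp S Y Z = (Y ⇒ Z)` given by currying and evaluation (data only). -/
structure ClosedData (Op : Type u) (C : Type v) [Category.{w} C]
    [CartesianMonoidalCategory C] where
  T : Sig Op C → KleisliData C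
  exp : Sig Op C → C → C → C
  curry (S : Sig Op C) {X Y Z : C} (f : X ⊗ Y ⟶ (T S).obj Z) : X ⟶ exp S Y Z
  ev (S : Sig Op C) (Y Z : C) : exp S Y Z ⊗ Y ⟶ (T S).obj Z

/-- The object `ℋ_S[X]` of `S`-algebra structures on `X` in the Kleisli category of `T_{S'}`: the
product over `(op : A ⇀ B) ∈ S` of the Kleisli exponentials `A × (B ⇒ X) ⇒ X`. -/
noncomputable def ClosedData.bundle {Op : Type u} {C : Type v} [Category.{w} C]
    [CartesianMonoidalCategory C] (K : ClosedData Op C) (S S' : Sig Op C) (X : C) : C :=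
  listProd (fun o => K.exp S' (S.arg o ⊗ K.exp S' (S.res o) X) X) S.ops

/-- The data of a model of the effect handler calculus. -/
structure ModelData (Op : Type u) (C : Type v) [Category.{w} C] [CartesianMonoidalCategory C]
    extends ClosedData Op C where
  opr (S : Sig Op C) (o : {o // o ∈ S.dom}) : S.arg o ⟶ (T S).obj (S.res o)
  handle (S S' : Sig Op C) (X : C) :
    toClosedData.bundle S S' X ⊗ (T S).obj ((T S').obj X) ⟶ (T S').obj X

namespace ModelData

variable {Op : Type u} [DecidableEq Op] {C : Type v} [Category.{w} C]
  [CartesianMonoidalCategory C] (K : ModelData Op C)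

/-- The projection `π_op : ℋ_S[X] ⟶ (A_op × (B_op ⇒ X) ⇒ X)`. -/
noncomputable def clause (S S' : Sig Op C) (X : C) (o : {o // o ∈ S.dom}) :
    K.bundle S S' X ⟶ K.exp S' (S.arg o ⊗ K.exp S' (S.res o) X) X :=
  listProj (fun o => K.exp S' (S.arg o ⊗ K.exp S' (S.res o) X) X) S.ops o (S.mem_ops o)

/-- The morphism `A_op × (B_op ⇒ X) ⟶ T_S T_{S'} X` induced by the interpretation of `op`. -/
def mixedOp (S S' : Sig Op C) (X : C) (o : {o // o ∈ S.dom}) :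
    S.arg o ⊗ K.exp S' (S.res o) X ⟶ (K.T S).obj ((K.T S').obj X) :=
  K.opr S o ▷ K.exp S' (S.res o) X ≫ lift (snd _ _) (fst _ _) ≫
    (K.T S).str (K.exp S' (S.res o) X) (S.res o) ≫ (K.T S).map (K.ev S' (S.res o) X)

/-- The laws of a model of the effect handler calculus. -/
structure IsModel : Prop where
  strong (S : Sig Op C) : (K.T S).IsStrongKleisliTriple
  curry_ev (S : Sig Op C) {X Y Z : C} (f : X ⊗ Y ⟶ (K.T S).obj Z) :
    K.curry S f ▷ Y ≫ K.ev S Y Z = f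
  curry_uncurry (S : Sig Op C) {X Y Z : C} (g : X ⟶ K.exp S Y Z) :
    K.curry S (g ▷ Y ≫ K.ev S Y Z) = g
  handle_unit (S S' : Sig Op C) (X : C) :
    K.bundle S S' X ◁ (K.T S).unit ((K.T S').obj X) ≫ K.handle S S' X = snd _ _
  handle_mult (S S' : Sig Op C) (X : C) :
    K.bundle S S' X ◁ (K.T S).mu ((K.T S').obj X) ≫ K.handle S S' X =
      lift (fst _ _) ((K.T S).str (K.bundle S S' X) ((K.T S).obj ((K.T S').obj X))) ≫
        K.bundle S S' X ◁ (K.T S).map (K.handle S S' X) ≫ K.handle S S' X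
  handle_op (S S' : Sig Op C) (X : C) (o : {o // o ∈ S.dom}) :
    K.bundle S S' X ◁ K.mixedOp S S' X o ≫ K.handle S S' X =
      K.clause S S' X o ▷ (S.arg o ⊗ K.exp S' (S.res o) X) ≫
        K.ev S' (S.arg o ⊗ K.exp S' (S.res o) X) X

/-! ### Interpretation in a model -/

/-- `⟦A⟧`. -/
def ty : VTy Op → C
  | .fn A B dom arg res => K.exp ⟨dom, fun o => ty (arg o), fun o => ty (res o)⟩ (ty A) (ty B)
  | .prod n A => listProd (fun i => ty (A i)) (List.finRange n)

/-- `⟦Σ⟧`. -/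
def sig (S : Sig Op (VTy Op)) : Sig Op C := S.map K.ty

/-- `T_{⟦Σ⟧} ⟦A⟧`, the object in which computations of type `A ! Σ` are interpreted. -/
def cty (D : CTy Op) : C := (K.T (K.sig D.sig)).obj (K.ty D.ret)

/-- `⟦Γ⟧`. -/
def ctx : Ctx Op → C
  | [] => 𝟙_ C
  | A :: Γ => ctx Γ ⊗ K.ty A

/-- The interpretation of variables. -/
def var : {Γ : Ctx Op} → {A : VTy Op} → Var Γ A → (K.ctx Γ ⟶ K.ty A)
  | _, _, .zero => snd _ _
  | _, _, .succ x => fst _ _ ≫ var x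

mutual
/-- The interpretation `⟦Γ ⊢ V : A⟧ : ⟦Γ⟧ ⟶ ⟦A⟧` of value terms. -/
noncomputable def val : {Γ : Ctx Op} → {A : VTy Op} → Val Γ A → (K.ctx Γ ⟶ K.ty A)
  | _, _, .var x => K.var x
  | _, _, .lam (A := A) (C := D) M =>
      K.curry (K.sig D.sig) (Y := K.ty A) (Z := K.ty D.ret) (comp M)
  | _, _, .tuple (n := n) V => listTuple (fun i => val (V i)) (List.finRange n)
  | _, _, .proj (n := n) (A := A) V i =>
      val V ≫ listProj (fun i => K.ty (A i)) (List.finRange n) i (List.mem_finRange i)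
/-- The interpretation `⟦Γ ⊢ M : A ! Σ⟧ : ⟦Γ⟧ ⟶ T_{⟦Σ⟧} ⟦A⟧` of computation terms. In the last
clause, the first component of the outer pairing is the interpretation of the handler, see
`ModelData.handler`. -/
noncomputable def comp : {Γ : Ctx Op} → {D : CTy Op} → Comp Γ D → (K.ctx Γ ⟶ K.cty D)
  | _, _, .app (A := A) (C := D) V W =>
      lift (val V) (val W) ≫ K.ev (K.sig D.sig) (K.ty A) (K.ty D.ret)
  | _, _, .ret (A := A) (S := S) V => val V ≫ (K.T (K.sig S)).unit (K.ty A)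
  | _, _, .letIn (Γ := Γ) (S := S) M N => lift (𝟙 (K.ctx Γ)) (comp M) ≫ (K.T (K.sig S)).ext (comp N)
  | _, _, .op (S := S) o V => val V ≫ K.opr (K.sig S) o
  | _, _, .handle (Γ := Γ) (A := A) (S := S) (C := D) M H N =>
      lift
        (listTuple (fun o : {o // o ∈ S.dom} =>
          K.curry (K.sig D.sig) ((α_ (K.ctx Γ) (K.ty (S.arg o)) (K.ty ((S.res o).arr D))).inv ≫
            comp (H o))) (K.sig S).ops)
        (lift (𝟙 (K.ctx Γ)) (comp M) ≫ (K.T (K.sig S)).str (K.ctx Γ) (K.ty A) ≫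
          (K.T (K.sig S)).map (comp N)) ≫
      K.handle (K.sig S) (K.sig D.sig) (K.ty D.ret)
end

/-- The interpretation `⟦Γ ⊢ H : Σ ⇒ C⟧ : ⟦Γ⟧ ⟶ ℋ_{⟦Σ⟧}[⟦C⟧]` of handlers. -/
noncomputable def handler {Γ : Ctx Op} {S : Sig Op (VTy Op)} {D : CTy Op} (H : Handler Γ S D) :
    K.ctx Γ ⟶ K.bundle (K.sig S) (K.sig D.sig) (K.ty D.ret) :=
  listTuple (fun o : {o // o ∈ S.dom} =>
    K.curry (K.sig D.sig) ((α_ (K.ctx Γ) (K.ty (S.arg o)) (K.ty ((S.res o).arr D))).inv ≫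
      K.comp (H o))) (K.sig S).ops

end ModelData

end LamEff

/-! ### The typed CPS transformation -/

namespace SysF

open LamEff

/-- The product type `A i₁ × (A i₂ × ⋯ × 1)` of a family over a list of indices. -/
def Ty.listProd {m : ℕ} {ι : Type u} (A : ι → Ty m) (l : List ι) : Ty m :=
  l.foldr (fun i P => .prod (A i) P) .unit

/-- The tuple `⟨t i₁, ⟨t i₂, …⟩⟩` of a family over a list of indices. -/
def Tm.listTuple {m : ℕ} {ι : Type u} (t : ι → Tm m) (l : List ι) : Tm m :=
  l.foldr (fun i r => .pair (t i) r) .star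

/-- The projection at the index `i` out of `Ty.listProd A l`. -/
def Tm.listProj {m : ℕ} {ι : Type u} [DecidableEq ι] : List ι → ι → Tm m → Tm m
  | [], _, t => t
  | j :: l, i, t => if i = j then .fst t else Tm.listProj l i (.snd t)

/-- The type `ℋ_S[β] = ∏_{(op : A ⇀ B) ∈ S} (A × (B → β) → β)`. -/
noncomputable def hTy {m : ℕ} {Op : Type u} (S : Sig Op (Ty m)) (β : Ty m) : Ty m :=
  Ty.listProd (fun o => .arr (.prod (S.arg o) (.arr (S.res o) β)) β) S.ops

/-- The type `D_S X = ∀ β. (X → β) → ℋ_S[β] → β`. -/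
noncomputable def dTy {m : ℕ} {Op : Type u} (S : Sig Op (Ty m)) (X : Ty m) : Ty m :=
  .all (.arr (.arr X.wk (.var 0)) (.arr (hTy (S.map Ty.wk) (.var 0)) (.var 0)))

/-- The term `Λ β. λ k : X → β. λ h : ℋ_S[β]. t`; in `t`, `h` is the variable `0`, `k` is the
variable `1`, and the free variables of the whole term are shifted by `2`. -/
noncomputable def dLam {m : ℕ} {Op : Type u} (S : Sig Op (Ty m)) (X : Ty m) (t : Tm (m + 1)) :
    Tm m :=
  .tlam (.lam (.arr X.wk (.var 0)) (.lam (hTy (S.map Ty.wk) (.var 0)) t))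

/-- Weakening of a term under `Λ β. λ k. λ h.` -/
def Tm.wk2 {m : ℕ} (t : Tm m) : Tm (m + 1) := t.ren Fin.succ (· + 2)

/-- `Λ β. λ k. λ h. k t` -/
noncomputable def dRet {m : ℕ} {Op : Type u} (S : Sig Op (Ty m)) (X : Ty m) (t : Tm m) : Tm m :=
  dLam S X (.app (.var 1) t.wk2)

/-- `Λ β. λ k. λ h. t β (λ x : X. s β k h) h`, where `s` is given in the context extended by
`k`, `h` and `x`. -/
noncomputable def dBind {m : ℕ} {Op : Type u} (S : Sig Op (Ty m)) (X Y : Ty m) (t : Tm m)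
    (s : Tm (m + 1)) : Tm m :=
  dLam S Y (.app (.app (.tapp t.wk2 (.var 0))
    (.lam X.wk (.app (.app (.tapp s (.var 0)) (.var 2)) (.var 1)))) (.var 0))

/-- `Λ β. λ k. λ h. π_op h ⟨t, k⟩` -/
noncomputable def dOp {m : ℕ} {Op : Type u} [DecidableEq Op] (S : Sig Op (Ty m))
    (o : {o // o ∈ S.dom}) (t : Tm m) : Tm m :=
  dLam S (S.res o) (.app (Tm.listProj S.ops o (.var 0)) (.pair t.wk2 (.var 1)))

theorem Ty.listProd_subst {m n : ℕ} {ι : Type u} (A : ι → Ty m) (l : List ι) (θ : Fin m → Ty n) :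
    (Ty.listProd A l).subst θ = Ty.listProd (fun i => (A i).subst θ) l := by
  induction l with
  | nil => rfl
  | cons i l ih => exact congrArg _ ih

theorem hTy_subst {m n : ℕ} {Op : Type u} (S : Sig Op (Ty m)) (β : Ty m) (θ : Fin m → Ty n) :
    (hTy S β).subst θ = hTy (S.map (fun A => A.subst θ)) (β.subst θ) := by
  rw [hTy, Ty.listProd_subst]; rfl

theorem hTy_wk_inst {m : ℕ} {Op : Type u} (S : Sig Op (Ty m)) (B : Ty m) :
    (hTy (S.map Ty.wk) (.var 0)).inst B = hTy S B := by
  rw [Ty.inst, hTy_subst]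
  have : (S.map Ty.wk).map (fun A => A.subst (instT B)) = S := by
    simp only [Sig.map]
    exact congrArg₂ (Sig.mk S.dom) (funext fun o => Ty.wk_inst _ B) (funext fun o => Ty.wk_inst _ B)
  rw [this]; rfl

theorem HasType.listTuple {m : ℕ} {Γ : List (Ty m)} {ι : Type u} {t : ι → Tm m} {A : ι → Ty m}
    (h : ∀ i, HasType Γ (t i) (A i)) (l : List ι) :
    HasType Γ (Tm.listTuple t l) (Ty.listProd A l) := by
  induction l with
  | nil => exact .star
  | cons i l ih => exact .pair (h i) ih

theorem HasType.listProj {m : ℕ} {Γ : List (Ty m)} {ι : Type u} [DecidableEq ι] {A : ι → Ty m}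
    {i : ι} {l : List ι} (hi : i ∈ l) {t : Tm m} (h : HasType Γ t (Ty.listProd A l)) :
    HasType Γ (Tm.listProj l i t) (A i) := by
  induction l generalizing t with
  | nil => simp at hi
  | cons j l ih =>
    rw [Tm.listProj]
    split
    · next e => subst e; exact .fst h
    · next e => exact ih ((List.mem_cons.mp hi).resolve_left e) (.snd h)

theorem HasType.dLam {m : ℕ} {Op : Type u} {S : Sig Op (Ty m)} {X : Ty m} {t : Tm (m + 1)}
    {Γ : List (Ty m)}
    (h : HasType (hTy (S.map Ty.wk) (.var 0) :: .arr X.wk (.var 0) :: Γ.map Ty.wk) t (.var 0)) :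
    HasType Γ (SysF.dLam S X t) (dTy S X) := .tlam (.lam (.lam h))

theorem BEq.dLam {m : ℕ} {Op : Type u} {S : Sig Op (Ty m)} {X : Ty m} {t t' : Tm (m + 1)}
    {Γ : List (Ty m)}
    (h : BEq (hTy (S.map Ty.wk) (.var 0) :: .arr X.wk (.var 0) :: Γ.map Ty.wk) t t' (.var 0)) :
    BEq Γ (SysF.dLam S X t) (SysF.dLam S X t') (dTy S X) := .tlam (.lam (.lam h))

theorem HasType.wk2 {m : ℕ} {Γ : List (Ty m)} {t : Tm m} {A : Ty m} (h : HasType Γ t A)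
    (B C : Ty (m + 1)) : HasType (B :: C :: Γ.map Ty.wk) t.wk2 A.wk :=
  h.ren (fun i D hD => by simp [hD, Ty.wk])

theorem dTy_body_inst {m : ℕ} {Op : Type u} (S : Sig Op (Ty m)) (X B : Ty m) :
    (Ty.arr (.arr X.wk (.var 0)) (.arr (hTy (S.map Ty.wk) (.var 0)) (.var 0))).inst B =
      .arr (.arr X B) (.arr (hTy S B) B) := by
  rw [← hTy_wk_inst S B]
  conv_rhs => rw [← Ty.wk_inst X B]
  rfl

theorem HasType.tapp_dTy {m : ℕ} {Op : Type u} {S : Sig Op (Ty m)} {X : Ty m} {t : Tm m}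
    {Γ : List (Ty m)} (h : HasType Γ t (dTy S X)) (B : Ty m) :
    HasType Γ (.tapp t B) (.arr (.arr X B) (.arr (hTy S B) B)) :=
  dTy_body_inst S X B ▸ HasType.tapp B h

theorem BEq.tapp_dTy {m : ℕ} {Op : Type u} {S : Sig Op (Ty m)} {X : Ty m} {t t' : Tm m}
    {Γ : List (Ty m)} (h : BEq Γ t t' (dTy S X)) (B : Ty m) :
    BEq Γ (.tapp t B) (.tapp t' B) (.arr (.arr X B) (.arr (hTy S B) B)) :=
  dTy_body_inst S X B ▸ BEq.tapp B h

theorem dTy_wk {m : ℕ} {Op : Type u} (S : Sig Op (Ty m)) (X : Ty m) :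
    (dTy S X).wk = dTy (S.map Ty.wk) X.wk := by
  have e : ∀ A : Ty m, A.wk.wk = A.wk.ren (upR Fin.succ) := fun A => Ty.ren_wk _ A
  have e' : (hTy (S.map Ty.wk) (.var 0)).ren (upR Fin.succ) =
      hTy ((S.map Ty.wk).map Ty.wk) (.var 0) := by
    rw [Ty.ren_eq, hTy_subst]
    simp only [Sig.map, ← Ty.ren_eq, ← e]
    rfl
  show Ty.all (.arr (.arr (X.wk.ren (upR Fin.succ)) (.var 0))
    (.arr ((hTy (S.map Ty.wk) (.var 0)).ren (upR Fin.succ)) (.var 0))) = _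
  rw [e', ← e]; rfl

theorem HasType.dRet {m : ℕ} {Op : Type u} (S : Sig Op (Ty m)) {X : Ty m} {t : Tm m}
    {Γ : List (Ty m)} (h : HasType Γ t X) : HasType Γ (SysF.dRet S X t) (dTy S X) :=
  .dLam (.app (.var rfl) (h.wk2 _ _))

theorem HasType.dBind {m : ℕ} {Op : Type u} {S : Sig Op (Ty m)} {X Y : Ty m} {t : Tm m}
    {s : Tm (m + 1)} {Γ : List (Ty m)} (ht : HasType Γ t (dTy S X))
    (hs : HasType (X.wk :: hTy (S.map Ty.wk) (.var 0) :: .arr Y.wk (.var 0) :: Γ.map Ty.wk) s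
      (dTy S Y).wk) :
    HasType Γ (SysF.dBind S X Y t s) (dTy S Y) := by
  refine .dLam (.app (.app (HasType.tapp_dTy (S := S.map Ty.wk) (X := X.wk) ?_ _)
    (.lam (.app (.app (HasType.tapp_dTy (S := S.map Ty.wk) (X := Y.wk) ?_ _)
      (.var rfl)) (.var rfl)))) (.var rfl))
  · rw [← dTy_wk]; exact ht.wk2 _ _
  · rw [← dTy_wk]; exact hs

theorem HasType.dOp {m : ℕ} {Op : Type u} [DecidableEq Op] {S : Sig Op (Ty m)}
    (o : {o // o ∈ S.dom}) {t : Tm m} {Γ : List (Ty m)} (h : HasType Γ t (S.arg o)) :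
    HasType Γ (SysF.dOp S o t) (dTy S (S.res o)) := by
  refine .dLam (.app (A := .prod (S.arg o).wk (.arr (S.res o).wk (.var 0))) ?_
    (.pair (h.wk2 _ _) (.var rfl)))
  exact HasType.listProj (ι := {o // o ∈ S.dom})
    (A := fun o => .arr (.prod (S.arg o).wk (.arr (S.res o).wk (.var 0))) (.var 0))
    (S.mem_ops o) (.var rfl)

end SysF

namespace LamEff

open SysF

/-- The CPS transformation of value types. -/
noncomputable def VTy.cps {Op : Type u} : VTy Op → Ty 0
  | .fn A B dom arg res =>
      .arr A.cps (dTy ⟨dom, fun o => (arg o).cps, fun o => (res o).cps⟩ B.cps)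
  | .prod n A => Ty.listProd (fun i => (A i).cps) (List.finRange n)

/-- The CPS transformation of signatures. -/
noncomputable def Sig.cps {Op : Type u} (S : Sig Op (VTy Op)) : Sig Op (Ty 0) := S.map VTy.cps

/-- The CPS transformation of computation types:
`A ! Σ` is sent to `∀ β. (A.cps → β) → ℋ_Σ[β] → β`. -/
noncomputable def CTy.cps {Op : Type u} (C : CTy Op) : Ty 0 := dTy C.sig.cps C.ret.cps

/-- The CPS transformation of contexts. -/
noncomputable def Ctx.cps {Op : Type u} (Γ : Ctx Op) : List (Ty 0) := Γ.map VTy.cps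

/-- The de Bruijn index of a variable. -/
def Var.idx {Op : Type u} : {Γ : Ctx Op} → {A : VTy Op} → Var Γ A → ℕ
  | _, _, .zero => 0
  | _, _, .succ x => x.idx + 1

/-- The substitution `[π₁ z / x, π₂ z / k]` turning a term with innermost variables `x`, `k` into
one with innermost variable `z`. -/
def unpair : ℕ → Tm 0
  | 0 => .snd (.var 0)
  | 1 => .fst (.var 0)
  | i + 2 => .var (i + 1)

mutual
/-- The CPS transformation of value terms. -/
noncomputable def Val.cps {Op : Type u} [DecidableEq Op] :
    {Γ : Ctx Op} → {A : VTy Op} → Val Γ A → Tm 0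
  | _, _, .var x => .var x.idx
  | _, _, .lam (A := A) M => .lam A.cps M.cps
  | _, _, .tuple (n := n) V => Tm.listTuple (fun i => (V i).cps) (List.finRange n)
  | _, _, .proj (n := n) (A := _) V i => Tm.listProj (List.finRange n) i V.cps
/-- The CPS transformation of computation terms. -/
noncomputable def Comp.cps {Op : Type u} [DecidableEq Op] :
    {Γ : Ctx Op} → {C : CTy Op} → Comp Γ C → Tm 0
  | _, _, .app V W => .app V.cps W.cps
  | _, _, .ret (A := A) (S := S) V => dRet S.cps A.cps V.cps
  | _, _, .letIn (A := A) (B := B) (S := S) M N =>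
      dBind S.cps A.cps B.cps M.cps (N.cps.ren Fin.succ (upV (· + 2)))
  | _, _, .op (S := S) o V => dOp S.cps o V.cps
  | _, _, .handle (A := A) (S := S) (C := C) M H N =>
      .app (.app (.tapp M.cps C.cps) (.lam A.cps N.cps))
        (Tm.listTuple (fun o : {o // o ∈ S.dom} =>
          .lam (.prod (S.arg o).cps (.arr (S.res o).cps C.cps))
            ((H o).cps.subst Ty.var unpair)) S.cps.ops)
end

/-- The CPS transformation of handlers: the tuple of the terms `λ ⟨x, k⟩. M_op`. -/
noncomputable def Handler.cps {Op : Type u} [DecidableEq Op] {Γ : Ctx Op} {S : Sig Op (VTy Op)}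
    {C : CTy Op} (H : Handler Γ S C) : Tm 0 :=
  Tm.listTuple (fun o : {o // o ∈ S.dom} =>
    .lam (.prod (S.arg o).cps (.arr (S.res o).cps C.cps)) ((H o).cps.subst Ty.var unpair))
    S.cps.ops

theorem Var.idx_get {Op : Type u} {Γ : Ctx Op} {A : VTy Op} (x : Var Γ A) :
    (Ctx.cps Γ)[x.idx]? = some A.cps := by
  induction x with
  | zero => rfl
  | succ x ih => exact ih

theorem hasType_clause {Γ : List (Ty 0)} {A B C : Ty 0} {t : Tm 0}
    (h : HasType (.arr B C :: A :: Γ) t C) :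
    HasType Γ (.lam (.prod A (.arr B C)) (t.subst Ty.var unpair)) (.arr (.prod A (.arr B C)) C) := by
  refine .lam (h.subst₀ (fun i D hD => ?_))
  match i with
  | 0 => simp only [List.getElem?_cons_zero, Option.some.injEq] at hD; subst hD
         exact .snd (.var rfl)
  | 1 => simp only [List.getElem?_cons_succ, List.getElem?_cons_zero, Option.some.injEq] at hD
         subst hD; exact .fst (.var rfl)
  | i + 2 => exact .var hD

mutual
/-- The CPS transform of `Γ ⊢ V : A` is of type `A.cps` in context `Γ.cps`. -/
theorem Val.cps_hasType {Op : Type u} [DecidableEq Op] : {Γ : Ctx Op} → {A : VTy Op} →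
    (V : Val Γ A) → HasType (Ctx.cps Γ) V.cps A.cps
  | _, _, .var x => .var x.idx_get
  | _, _, .lam M => .lam M.cps_hasType
  | _, _, .tuple V => .listTuple (fun i => (V i).cps_hasType) _
  | _, _, .proj (A := A) V i =>
      HasType.listProj (A := fun i => (A i).cps) (List.mem_finRange i) V.cps_hasType
/-- The CPS transform of `Γ ⊢ M : C` is of type `C.cps` in context `Γ.cps`. -/
theorem Comp.cps_hasType {Op : Type u} [DecidableEq Op] : {Γ : Ctx Op} → {C : CTy Op} →
    (M : Comp Γ C) → HasType (Ctx.cps Γ) M.cps C.cps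
  | _, _, .app V W => .app V.cps_hasType W.cps_hasType
  | _, _, .ret V => .dRet _ V.cps_hasType
  | _, _, .letIn M N => .dBind M.cps_hasType (N.cps_hasType.ren (fun i D hD => by
      match i with
      | 0 => simp_all [upV, Ctx.cps, Ty.wk]
      | i + 1 =>
        simp only [upV, Ctx.cps, List.getElem?_cons_succ, List.map_cons, List.getElem?_map,
          Option.map_eq_some_iff] at hD ⊢
        obtain ⟨B, hB, rfl⟩ := hD
        exact ⟨_, ⟨B, hB, rfl⟩, rfl⟩))
  | _, _, .op (S := S) o V => HasType.dOp (S := S.cps) o V.cps_hasType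
  | _, _, .handle (S := S) (C := C) M H N =>
      .app (.app (HasType.tapp_dTy M.cps_hasType C.cps) (.lam N.cps_hasType))
        (HasType.listTuple (fun o => hasType_clause (H o).cps_hasType) _)
end

/-- The CPS transform of `Γ ⊢ H : Σ ⇒ C` is of type `ℋ_Σ[C.cps]` in context `Γ.cps`. -/
theorem Handler.cps_hasType {Op : Type u} [DecidableEq Op] {Γ : Ctx Op} {S : Sig Op (VTy Op)}
    {C : CTy Op} (H : Handler Γ S C) : HasType (Ctx.cps Γ) (Handler.cps H) (hTy S.cps C.cps) :=
  HasType.listTuple (fun o => hasType_clause (H o).cps_hasType) _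

/-! ### The CPS model -/

/-- The body of the strong Kleisli extension: `t[⟨x₁, x₂⟩]` in a context with innermost variable
`x₂` where `x₁` is the first component of the variable `3`. -/
def extBody (t : Tm 0) : Tm 1 := t.twk.subst Ty.var (fun _ => .pair (.fst (.var 3)) (.var 0))

theorem hasType_extBody {A B C : Ty 0} {t : Tm 0} {X Y : Ty 1} {P : Ty 0}
    (h : HasType [.prod A B] t C) :
    HasType [B.wk, X, Y, (Ty.prod A P).wk] (extBody t) C.wk :=
  h.twk.subst₀ (forall_single (P := fun D => HasType [B.wk, X, Y, (Ty.prod A P).wk] _ D)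
    (.pair (.fst (B := P.wk) (.var rfl)) (.var rfl)))

theorem beq_extBody {A B C : Ty 0} {t t' : Tm 0} {X Y : Ty 1} {P : Ty 0}
    (h : BEq [.prod A B] t t' C) :
    BEq [B.wk, X, Y, (Ty.prod A P).wk] (extBody t) (extBody t') C.wk := by
  have := h.twk.subst (θ := Ty.var) (Δ := [B.wk, X, Y, (Ty.prod A P).wk])
    (σ := fun _ => .pair (.fst (.var 3)) (.var 0)) (by
      simp only [Ty.subst_var]
      exact forall_single (P := fun D => HasType [B.wk, X, Y, (Ty.prod A P).wk] _ D)
        (.pair (.fst (B := P.wk) (.var rfl)) (.var rfl)))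
  rwa [Ty.subst_var] at this

theorem beq_dBind {Op : Type u} {S : Sig Op (Ty 0)} {X Y : Ty 0} {t : Tm 0}
    {s s' : Tm 1} {Γ : List (Ty 0)} (ht : HasType Γ t (dTy S X))
    (hs : BEq (X.wk :: hTy (S.map Ty.wk) (.var 0) :: .arr Y.wk (.var 0) :: Γ.map Ty.wk) s s'
      (dTy S Y).wk) :
    BEq Γ (dBind S X Y t s) (dBind S X Y t s') (dTy S Y) := by
  refine .dLam (.app (.app (.refl (HasType.tapp_dTy (S := S.map Ty.wk) (X := X.wk) ?_ _))
    (.lam (.app (.app (BEq.tapp_dTy (S := S.map Ty.wk) (X := Y.wk) ?_ _)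
      (.refl (.var rfl))) (.refl (.var rfl))))) (.refl (.var rfl)))
  · rw [← dTy_wk]; exact ht.wk2 _ _
  · rw [← dTy_wk]; exact hs

/-- `t[⟨x, y⟩]` where `x` is the variable `1` and `y` the variable `0`. -/
def curBody (t : Tm 0) : Tm 0 := t.subst Ty.var (fun _ => .pair (.var 1) (.var 0))

/-- The strong monad `D_S` as a strong Kleisli triple on the category of closed System F types. -/
noncomputable def dKleisli {Op : Type u} (S : Sig Op (Ty 0)) : KleisliData (Ty 0) where
  obj X := dTy S X
  unit X := mk (dRet S X (.var 0)) (.dRet S (.var rfl))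
  ext {X Y Z} := Quotient.map (sa := TTm.setoid [.prod X Y] (dTy S Z))
    (sb := TTm.setoid [.prod X (dTy S Y)] (dTy S Z))
    (fun t => ⟨dBind S Y Z (.snd (.var 0)) (extBody t.1),
      .dBind (.snd (.var rfl)) (hasType_extBody t.2)⟩)
    (fun _ _ h => beq_dBind (.snd (.var rfl)) (beq_extBody h))

/-- The CPS model on the category of closed System F types. -/
noncomputable def cpsModel (Op : Type u) [DecidableEq Op] : ModelData Op (Ty 0) where
  T := dKleisli
  exp S Y Z := .arr Y (dTy S Z)
  curry S {X Y Z} := Quotient.map (sa := TTm.setoid [.prod X Y] (dTy S Z))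
    (sb := TTm.setoid [X] (.arr Y (dTy S Z)))
    (fun t => ⟨.lam Y (curBody t.1), .lam (t.2.subst₀
      (forall_single (P := fun D => HasType [Y, X] _ D) (.pair (.var rfl) (.var rfl))))⟩)
    (fun t _ h => .lam (BEq.subst₀ h t.2
      (forall_single (P := fun D => HasType [Y, X] _ D) (.pair (.var rfl) (.var rfl)))
      (forall_single (P := fun D => BEq [Y, X] _ _ D) (.refl (.pair (.var rfl) (.var rfl))))))
  ev S Y Z := mk (A := .prod (.arr Y (dTy S Z)) Y) (.app (.fst (.var 0)) (.snd (.var 0)))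
    (.app (.fst (.var rfl)) (.snd (.var rfl)))
  opr S o := mk (dOp S o (.var 0)) (.dOp o (.var rfl))
  handle S S' X := mk (A := .prod (hTy S (dTy S' X)) (dTy S (dTy S' X))) (B := dTy S' X)
    (.app (.app (.tapp (.snd (.var 0)) (dTy S' X)) (.lam (dTy S' X) (.var 0))) (.fst (.var 0)))
    (.app (.app (HasType.tapp_dTy (.snd (.var rfl)) _) (.lam (.var rfl))) (.fst (.var rfl)))

/-- In the CPS model, value types are interpreted as their CPS transforms. -/
theorem cpsModel_ty {Op : Type u} [DecidableEq Op] :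
    (A : VTy Op) → (cpsModel Op).ty A = A.cps
  | .fn A B dom arg res => by
      have h₁ : (fun o => (cpsModel Op).ty (arg o)) = fun o => (arg o).cps :=
        funext fun o => cpsModel_ty (arg o)
      have h₂ : (fun o => (cpsModel Op).ty (res o)) = fun o => (res o).cps :=
        funext fun o => cpsModel_ty (res o)
      show Ty.arr ((cpsModel Op).ty A) (dTy ⟨dom, fun o => (cpsModel Op).ty (arg o),
        fun o => (cpsModel Op).ty (res o)⟩ ((cpsModel Op).ty B)) = _
      rw [h₁, h₂, cpsModel_ty A, cpsModel_ty B]; rfl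
  | .prod n A => by
      have h : (fun i => (cpsModel Op).ty (A i)) = fun i => (A i).cps :=
        funext fun i => cpsModel_ty (A i)
      show Ty.listProd (fun i => (cpsModel Op).ty (A i)) (List.finRange n) = _
      rw [h]; rfl

theorem cpsModel_sig {Op : Type u} [DecidableEq Op] (S : Sig Op (VTy Op)) :
    (cpsModel Op).sig S = S.cps :=
  congrArg (fun f => S.map f) (funext cpsModel_ty)

theorem cpsModel_cty {Op : Type u} [DecidableEq Op] (C : CTy Op) :
    (cpsModel Op).cty C = C.cps := by
  show dTy ((cpsModel Op).sig C.sig) ((cpsModel Op).ty C.ret) = dTy C.sig.cps C.ret.cps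
  rw [cpsModel_sig, cpsModel_ty]

theorem cpsModel_bundle {Op : Type u} [DecidableEq Op] (S : Sig Op (VTy Op)) (C : CTy Op) :
    (cpsModel Op).bundle ((cpsModel Op).sig S) ((cpsModel Op).sig C.sig) ((cpsModel Op).ty C.ret) =
      hTy S.cps C.cps := by
  show hTy ((cpsModel Op).sig S) (dTy ((cpsModel Op).sig C.sig) ((cpsModel Op).ty C.ret)) =
    hTy S.cps (dTy C.sig.cps C.ret.cps)
  rw [cpsModel_sig, cpsModel_sig, cpsModel_ty]

theorem cpsModel_ctx {Op : Type u} [DecidableEq Op] :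
    (Γ : Ctx Op) → (cpsModel Op).ctx Γ = ctxTy (Ctx.cps Γ)
  | [] => rfl
  | A :: Γ => by
      show Ty.prod ((cpsModel Op).ctx Γ) ((cpsModel Op).ty A) =
        Ty.prod (ctxTy (Ctx.cps Γ)) A.cps
      rw [cpsModel_ctx Γ, cpsModel_ty A]

end LamEff

open LamEff

-- The whole theorem is a `βη`-calculation; no parametricity of System F is used. A term `t` of type
-- `D_S X` can be run at a type `B`, a continuation `k` and a handler tuple `h`. By `η` such terms
-- are determined by their runs at generic arguments (`BEq.dTy_ext`), and by `β` runs compute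
-- (`dRet_run`, `dOp_run`, `lett_run`): a return feeds its value to `k`, an operation calls its
-- component of `h` with `k`, and `let x = t in n` runs `t` with the same `h` and the continuation
-- that runs `n`. The monad laws `lett_dRet_left`, `lett_dRet_right` and `lett_assoc` follow by
-- comparing runs.
--
-- To move between morphisms and terms, `App Γ f s t` says that the morphism `f` sends the term `s`
-- to `t` up to `βη`. Composition, pairing, the coherence maps and all structure maps of the CPS
-- model have rules for `App`, and a morphism is determined by its value on one sufficiently generic
-- term (`App.hom_ext`, with surjective pairing for morphisms out of products). In these terms
-- Kleisli extension is `lett` (`app_ext`) and handling is running with the identity continuation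
-- (`app_handle`). The strong monad laws then become the three laws for `lett`, and the handling
-- laws become computation rules. The interpretation is determined by induction on terms: it sends
-- the tuple of the variables of the context to the CPS transform (`app_val`, `app_comp`,
-- `app_handler`). In the case of handle-with, strength, functorial action and identity continuation
-- collapse to a single run with continuation `λx.N` (`dRun_lett_lett_id`). `App.eq_cls` turns this
-- into an equality of morphisms.
--
-- The corollary is proved directly on terms rather than through the model. The CPS transformation
-- commutes strictly with substitution (`Comp.cps_subst`), so each axiom of the calculus becomes a
-- `βη`-law, a monad law or a rule for runs (`CEq.cps_beq`). Reduction is contained in derivable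
-- equality because a handle-free context `𝒞` satisfies `𝒞[M] = let x = M in 𝒞[return x]`
-- (`ECtx.HandleFree.plug_eq`).

namespace SysF

/-! ### Substitution calculus -/

/-- The substitution `s, σ 0, σ 1, …`. -/
def scons {m : ℕ} (s : Tm m) (σ : ℕ → Tm m) : ℕ → Tm m
  | 0 => s
  | i + 1 => σ i

theorem instS_eq {m : ℕ} (s : Tm m) : instS s = scons s Tm.var := by
  funext i; cases i <;> rfl

theorem Tm.inst_eq {m : ℕ} (t s : Tm m) : t.inst s = t.subst Ty.var (scons s Tm.var) := by
  rw [Tm.inst, instS_eq]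

theorem Tm.subst_id {m : ℕ} (t : Tm m) {θ : Fin m → Ty m} {σ : ℕ → Tm m} (hθ : θ = Ty.var)
    (hσ : σ = Tm.var) : t.subst θ σ = t := by
  rw [hθ, hσ, Tm.subst_var]

theorem Tm.wk_subst {m n : ℕ} (t : Tm m) (θ : Fin m → Ty n) (σ : ℕ → Tm n) :
    t.wk.subst θ σ = t.subst θ (fun i => σ (i + 1)) := Tm.subst_ren _ _ _ _ _

theorem Tm.wk2_subst {m n : ℕ} (t : Tm m) (θ : Fin (m + 1) → Ty n) (σ : ℕ → Tm n) :
    t.wk2.subst θ σ = t.subst (θ ∘ Fin.succ) (fun i => σ (i + 2)) := Tm.subst_ren _ _ _ _ _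

theorem Tm.wk2_instT {m : ℕ} (t : Tm m) (B : Ty m) (k h : Tm m) :
    t.wk2.subst (instT B) (scons h (scons k Tm.var)) = t := by
  rw [Tm.wk2_subst]; exact Tm.subst_id t rfl rfl

theorem Tm.subst_wk2 {m n : ℕ} (t : Tm m) (θ : Fin m → Ty n) (σ : ℕ → Tm n) :
    (t.subst θ σ).wk2 = t.wk2.subst (upT θ) (upS (upS fun i => (σ i).twk)) := by
  simp only [Tm.wk2, Tm.ren_subst, Tm.subst_ren]
  congr 1; funext i
  simp [upS, Tm.wk, Tm.twk, Tm.ren_ren, Function.comp_def]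

theorem Tm.wk2_eq {m : ℕ} (t : Tm m) :
    t.wk2 = t.subst (fun i => .var i.succ) (fun i => .var (i + 2)) := Tm.ren_eq _ _ _

theorem Tm.wk_eq {m : ℕ} (t : Tm m) : t.wk = t.subst Ty.var (fun i => .var (i + 1)) :=
  Tm.ren_eq _ _ _

theorem sig_map_subst_var {m : ℕ} {Op : Type u} (S : Sig Op (Ty m)) :
    S.map (fun A => A.subst Ty.var) = S := by
  simp only [Sig.map, Ty.subst_var]

theorem sig_map_ren {m : ℕ} {Op : Type u} (S : Sig Op (Ty m)) :
    S.map (fun A => A.subst fun i => .var i.succ) = S.map Ty.wk := by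
  simp only [Sig.map, Ty.wk, Ty.ren_eq]

theorem hasType_scons {m : ℕ} {Γ Δ : List (Ty m)} {s : Tm m} {A : Ty m} {σ : ℕ → Tm m}
    (hs : HasType Δ s A) (hσ : ∀ i C, Γ[i]? = some C → HasType Δ (σ i) C) :
    ∀ i C, (A :: Γ)[i]? = some C → HasType Δ (scons s σ i) C := by
  intro i C hC
  cases i with
  | zero => simp only [List.getElem?_cons_zero, Option.some.injEq] at hC; subst hC; exact hs
  | succ i => exact hσ i C hC

/-! ### Finite products -/

theorem Tm.listTuple_subst {m n : ℕ} {ι : Type u} (t : ι → Tm m) (l : List ι) (θ : Fin m → Ty n)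
    (σ : ℕ → Tm n) :
    (Tm.listTuple t l).subst θ σ = Tm.listTuple (fun i => (t i).subst θ σ) l := by
  induction l with
  | nil => rfl
  | cons i l ih => exact congrArg _ ih

theorem Tm.listProj_subst {m n : ℕ} {ι : Type u} [DecidableEq ι] (l : List ι) (i : ι) (t : Tm m)
    (θ : Fin m → Ty n) (σ : ℕ → Tm n) :
    (Tm.listProj l i t).subst θ σ = Tm.listProj l i (t.subst θ σ) := by
  induction l generalizing t with
  | nil => rfl
  | cons j l ih =>
    simp only [Tm.listProj]
    split
    · rfl
    · rw [ih]; rfl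

theorem BEq.listTuple {m : ℕ} {Γ : List (Ty m)} {ι : Type u} {t t' : ι → Tm m} {A : ι → Ty m}
    {l : List ι} (h : ∀ i ∈ l, BEq Γ (t i) (t' i) (A i)) :
    BEq Γ (Tm.listTuple t l) (Tm.listTuple t' l) (Ty.listProd A l) := by
  induction l with
  | nil => exact .refl .star
  | cons i l ih =>
    exact .pair (h i (by simp)) (ih fun j hj => h j (by simp [hj]))

theorem BEq.listProj {m : ℕ} {Γ : List (Ty m)} {ι : Type u} [DecidableEq ι] {A : ι → Ty m}
    {i : ι} {l : List ι} (hi : i ∈ l) {t t' : Tm m} (h : BEq Γ t t' (Ty.listProd A l)) :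
    BEq Γ (Tm.listProj l i t) (Tm.listProj l i t') (A i) := by
  induction l generalizing t t' with
  | nil => simp at hi
  | cons j l ih =>
    simp only [Tm.listProj]
    split
    · next e => subst e; exact .fst h
    · next e => exact ih ((List.mem_cons.mp hi).resolve_left e) (.snd h)

theorem BEq.listProj_listTuple {m : ℕ} {Γ : List (Ty m)} {ι : Type u} [DecidableEq ι]
    {t : ι → Tm m} {A : ι → Ty m} (h : ∀ i, HasType Γ (t i) (A i)) {l : List ι} {i : ι}
    (hi : i ∈ l) : BEq Γ (Tm.listProj l i (Tm.listTuple t l)) (t i) (A i) := by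
  induction l with
  | nil => simp at hi
  | cons j l ih =>
    simp only [Tm.listProj]
    split
    · next e => subst e; exact .fst_beta (h _) (.listTuple h l)
    · next e =>
      have hl := (List.mem_cons.mp hi).resolve_left e
      exact (BEq.listProj hl (.snd_beta (h j) (.listTuple h l))).trans (ih hl)

/-- Iterated surjective pairing. A projection selects the first occurrence of its index, so
distinctness of the entries is what guarantees that the projections for the tail skip the head. -/
theorem BEq.listTuple_listProj {m : ℕ} {Γ : List (Ty m)} {ι : Type u} [DecidableEq ι]
    {A : ι → Ty m} {l : List ι} (hl : l.Nodup) {t : Tm m} (h : HasType Γ t (Ty.listProd A l)) :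
    BEq Γ t (Tm.listTuple (fun i => Tm.listProj l i t) l) (Ty.listProd A l) := by
  induction l generalizing t with
  | nil => exact .unit_eta h
  | cons j l ih =>
    rw [List.nodup_cons] at hl
    refine (BEq.pair_eta h).trans (.pair ?_ ((ih hl.2 (.snd h)).trans (BEq.listTuple fun i hi => ?_)))
    · simp only [Tm.listProj, if_true]; exact .refl (.fst h)
    · have e : i ≠ j := fun e => hl.1 (e ▸ hi)
      simp only [Tm.listProj, if_neg e]
      exact .refl (.listProj hi (.snd h))

/-! ### The types `D_S X` -/

/-- The application `t B k h` of a term `t` of type `D_S X`. -/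
def dRun {m : ℕ} (t : Tm m) (B : Ty m) (k h : Tm m) : Tm m := .app (.app (.tapp t B) k) h

theorem HasType.dRun {m : ℕ} {Op : Type u} {S : Sig Op (Ty m)} {X B : Ty m} {t k h : Tm m}
    {Γ : List (Ty m)} (ht : HasType Γ t (dTy S X)) (hk : HasType Γ k (.arr X B))
    (hh : HasType Γ h (hTy S B)) : HasType Γ (SysF.dRun t B k h) B :=
  .app (.app (ht.tapp_dTy B) hk) hh

theorem BEq.dRun {m : ℕ} {Op : Type u} {S : Sig Op (Ty m)} {X B : Ty m} {t t' k k' h h' : Tm m}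
    {Γ : List (Ty m)} (ht : BEq Γ t t' (dTy S X)) (hk : BEq Γ k k' (.arr X B))
    (hh : BEq Γ h h' (hTy S B)) : BEq Γ (SysF.dRun t B k h) (SysF.dRun t' B k' h') B :=
  .app (.app (ht.tapp_dTy B) hk) hh

theorem dRun_subst {m n : ℕ} (t : Tm m) (B : Ty m) (k h : Tm m) (θ : Fin m → Ty n)
    (σ : ℕ → Tm n) : (dRun t B k h).subst θ σ =
      dRun (t.subst θ σ) (B.subst θ) (k.subst θ σ) (h.subst θ σ) := rfl

theorem dLam_subst {m n : ℕ} {Op : Type u} (S : Sig Op (Ty m)) (X : Ty m) (t : Tm (m + 1))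
    (θ : Fin m → Ty n) (σ : ℕ → Tm n) :
    (dLam S X t).subst θ σ = dLam (S.map fun A => A.subst θ) (X.subst θ)
      (t.subst (upT θ) (upS (upS fun i => (σ i).twk))) := by
  have e : (hTy (S.map Ty.wk) (.var 0)).subst (upT θ) =
      hTy ((S.map fun A => A.subst θ).map Ty.wk) (.var 0) := by
    rw [hTy_subst]
    simp only [Sig.map, Ty.subst_wk]
    rfl
  show Tm.tlam (.lam (.arr (X.wk.subst (upT θ)) (.var 0))
    (.lam ((hTy (S.map Ty.wk) (.var 0)).subst (upT θ)) _)) = _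
  rw [e, ← Ty.subst_wk]; rfl

/-- Three `β`-steps, for `β`, `k` and `h`, whose substitutions merge into one simultaneous
substitution. All computation rules for runs are instances. -/
theorem dLam_beta {m : ℕ} {Op : Type u} {S : Sig Op (Ty m)} {X B : Ty m} {t : Tm (m + 1)}
    {k h : Tm m} {Γ : List (Ty m)}
    (ht : HasType (hTy (S.map Ty.wk) (.var 0) :: .arr X.wk (.var 0) :: Γ.map Ty.wk) t (.var 0))
    (hk : HasType Γ k (.arr X B)) (hh : HasType Γ h (hTy S B)) :
    BEq Γ (dRun (dLam S X t) B k h) (t.subst (instT B) (scons h (scons k Tm.var))) B := by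
  -- The body after the type application: instantiating the bound type variable cancels the
  -- weakenings in the context.
  have ht' : HasType (hTy S B :: .arr X B :: Γ) (t.subst (instT B) Tm.var) B := by
    refine ht.subst (θ := instT B) (σ := Tm.var) fun i C hC => .var ?_
    match i with
    | 0 =>
      simp only [List.getElem?_cons_zero, Option.some.injEq] at hC ⊢
      rw [← hC]; exact (hTy_wk_inst S B).symm
    | 1 =>
      simp only [List.getElem?_cons_succ, List.getElem?_cons_zero, Option.some.injEq] at hC ⊢
      rw [← hC]; exact congrArg (Ty.arr · B) (Ty.wk_inst X B).symm
    | i + 2 =>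
      simp only [List.getElem?_cons_succ, List.getElem?_map, Option.map_eq_some_iff] at hC ⊢
      obtain ⟨D, hD, rfl⟩ := hC
      rw [hD]; exact congrArg some (Ty.wk_inst D B).symm
  have e : (Tm.lam (.arr X.wk (.var 0)) (.lam (hTy (S.map Ty.wk) (.var 0)) t)).tinst B =
      .lam (.arr X B) (.lam (hTy S B) (t.subst (instT B) Tm.var)) := by
    show Tm.lam (.arr (X.wk.inst B) B) (.lam ((hTy (S.map Ty.wk) (.var 0)).inst B)
      (t.subst (instT B) (upS (upS Tm.var)))) = _
    rw [Ty.wk_inst, hTy_wk_inst, upS_var, upS_var]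
  have h₁ := BEq.tlam_beta B (HasType.lam (HasType.lam ht))
  rw [e, dTy_body_inst] at h₁
  have hS : ∀ i C, (SysF.hTy S B :: Ty.arr X B :: Γ)[i]? = some C →
      HasType (SysF.hTy S B :: Γ) (upS (instS k) i) C := by
    rw [instS_eq]
    intro i C hC
    match i with
    | 0 => exact .var hC
    | 1 =>
      simp only [List.getElem?_cons_succ, List.getElem?_cons_zero, Option.some.injEq] at hC
      subst hC; exact hk.wk _
    | i + 2 => exact .var hC
  have h₂ := BEq.lam_beta (HasType.lam ht') hk
  have e₂ : (Tm.lam (hTy S B) (t.subst (instT B) Tm.var)).inst k =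
      .lam (hTy S B) ((t.subst (instT B) Tm.var).subst Ty.var (upS (instS k))) := by
    show Tm.lam ((hTy S B).subst Ty.var) _ = _
    rw [Ty.subst_var]
  rw [e₂] at h₂
  have h₃ := BEq.lam_beta (ht'.subst₀ hS) hh
  -- The only entry that needs an argument is index `1`: there `k` was weakened to pass under the
  -- binder of `h`, and instantiating `h` undoes this.
  have e₃ : ((t.subst (instT B) Tm.var).subst Ty.var (upS (instS k))).inst h =
      t.subst (instT B) (scons h (scons k Tm.var)) := by
    simp only [Tm.inst, Tm.subst_subst, Ty.subst_var]
    congr 1; funext i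
    match i with
    | 0 => rfl
    | 1 => simp only [Tm.subst, upS, instS, Tm.wk_subst]; exact Tm.subst_id _ rfl rfl
    | i + 2 => rfl
  rw [e₃] at h₃
  exact ((BEq.app ((BEq.app h₁ (.refl hk)).trans h₂) (.refl hh))).trans h₃

/-- One `η`-expansion for each of the three abstractions in `D_S X`. -/
theorem dTy_eta {m : ℕ} {Op : Type u} {S : Sig Op (Ty m)} {X : Ty m} {t : Tm m}
    {Γ : List (Ty m)} (h : HasType Γ t (dTy S X)) :
    BEq Γ t (dLam S X (dRun t.wk2 (.var 0) (.var 1) (.var 0))) (dTy S X) := by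
  have h₀ := h.twk
  rw [dTy_wk] at h₀
  have h₁ := h₀.tapp_dTy (.var 0)
  have h₂ := BEq.lam_eta h₁
  have h₃ := BEq.lam_eta (HasType.app (h₁.wk (.arr X.wk (.var 0))) (.var (i := 0) rfl))
  have e : t.twk.wk.wk = t.wk2 := by
    simp only [Tm.twk, Tm.wk, Tm.wk2, Tm.ren_ren]; rfl
  refine (BEq.tlam_eta h).trans (.tlam (h₂.trans (.lam (h₃.trans ?_))))
  rw [dRun, ← e]
  refine .refl (.lam (.app (.app ((((h₁.wk _).wk _))) (.var rfl)) (.var rfl)))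

/-- Extensionality: by `dTy_eta`, a computation is determined by its run at a fresh type,
continuation and handler. This reduces the monad laws to equations between runs. -/
theorem BEq.dTy_ext {m : ℕ} {Op : Type u} {S : Sig Op (Ty m)} {X : Ty m} {t t' : Tm m}
    {Γ : List (Ty m)} (ht : HasType Γ t (dTy S X)) (ht' : HasType Γ t' (dTy S X))
    (h : BEq (hTy (S.map Ty.wk) (.var 0) :: .arr X.wk (.var 0) :: Γ.map Ty.wk)
      (SysF.dRun t.wk2 (.var 0) (.var 1) (.var 0)) (SysF.dRun t'.wk2 (.var 0) (.var 1) (.var 0))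
      (.var 0)) : BEq Γ t t' (dTy S X) :=
  (dTy_eta ht).trans ((BEq.dLam h).trans (dTy_eta ht').symm)

/-! ### The operators of the monads `D_S` -/

/-- `Λ β. λ k. λ h. t β (λ x : X. n β k h) h` -/
noncomputable def lett {m : ℕ} {Op : Type u} (S : Sig Op (Ty m)) (X Y : Ty m) (t n : Tm m) :
    Tm m := dBind S X Y t (n.ren Fin.succ (upV (· + 2)))

theorem hasType_lett_body {m : ℕ} {Op : Type u} {S : Sig Op (Ty m)} {X Y : Ty m} {n : Tm m}
    {Γ : List (Ty m)} (hn : HasType (X :: Γ) n (dTy S Y)) (A B : Ty (m + 1)) :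
    HasType (X.wk :: A :: B :: Γ.map Ty.wk) (n.ren Fin.succ (upV (· + 2))) (dTy S Y).wk :=
  hn.ren fun i D hD => by
    match i with
    | 0 => simp_all [upV, Ty.wk]
    | i + 1 =>
      simp only [List.getElem?_cons_succ] at hD
      simp [upV, hD, Ty.wk]

theorem HasType.lett {m : ℕ} {Op : Type u} {S : Sig Op (Ty m)} {X Y : Ty m} {t n : Tm m}
    {Γ : List (Ty m)} (ht : HasType Γ t (dTy S X)) (hn : HasType (X :: Γ) n (dTy S Y)) :
    HasType Γ (SysF.lett S X Y t n) (dTy S Y) :=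
  .dBind ht (hasType_lett_body hn _ _)

theorem BEq.wk2 {m : ℕ} {Γ : List (Ty m)} {t t' : Tm m} {A : Ty m} (h : BEq Γ t t' A)
    (B C : Ty (m + 1)) : BEq (B :: C :: Γ.map Ty.wk) t.wk2 t'.wk2 A.wk :=
  h.ren (fun i D hD => by simp [hD, Ty.wk])

theorem BEq.lett {m : ℕ} {Op : Type u} {S : Sig Op (Ty m)} {X Y : Ty m} {t t' n n' : Tm m}
    {Γ : List (Ty m)} (ht : BEq Γ t t' (dTy S X)) (hn : BEq (X :: Γ) n n' (dTy S Y)) :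
    BEq Γ (SysF.lett S X Y t n) (SysF.lett S X Y t' n') (dTy S Y) := by
  refine .dLam (.dRun (S := S.map Ty.wk) (X := X.wk) ?_
    (.lam (.dRun (S := S.map Ty.wk) (X := Y.wk) ?_ (.refl (.var rfl)) (.refl (.var rfl))))
    (.refl (.var rfl)))
  · rw [← dTy_wk]; exact ht.wk2 _ _
  · rw [← dTy_wk]
    refine hn.ren fun i D hD => ?_
    match i with
    | 0 => simp_all [upV, Ty.wk]
    | i + 1 =>
      simp only [List.getElem?_cons_succ] at hD
      simp [upV, hD, Ty.wk]

theorem BEq.dRet {m : ℕ} {Op : Type u} (S : Sig Op (Ty m)) {X : Ty m} {t t' : Tm m}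
    {Γ : List (Ty m)} (h : BEq Γ t t' X) :
    BEq Γ (SysF.dRet S X t) (SysF.dRet S X t') (dTy S X) :=
  .dLam (.app (.refl (.var rfl)) (h.wk2 _ _))

theorem BEq.dOp {m : ℕ} {Op : Type u} [DecidableEq Op] {S : Sig Op (Ty m)}
    (o : {o // o ∈ S.dom}) {t t' : Tm m} {Γ : List (Ty m)} (h : BEq Γ t t' (S.arg o)) :
    BEq Γ (SysF.dOp S o t) (SysF.dOp S o t') (dTy S (S.res o)) := by
  refine .dLam (.app (A := .prod (S.arg o).wk (.arr (S.res o).wk (.var 0))) ?_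
    (.pair (h.wk2 _ _) (.refl (.var rfl))))
  exact .refl (HasType.listProj (ι := {o // o ∈ S.dom})
    (A := fun o => .arr (.prod (S.arg o).wk (.arr (S.res o).wk (.var 0))) (.var 0))
    (S.mem_ops o) (.var rfl))

theorem dRet_subst {m n : ℕ} {Op : Type u} (S : Sig Op (Ty m)) (X : Ty m) (t : Tm m)
    (θ : Fin m → Ty n) (σ : ℕ → Tm n) :
    (dRet S X t).subst θ σ = dRet (S.map fun A => A.subst θ) (X.subst θ) (t.subst θ σ) := by
  rw [dRet, dLam_subst, dRet, Tm.subst_wk2]; rfl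

theorem dOp_subst {m n : ℕ} {Op : Type u} [DecidableEq Op] (S : Sig Op (Ty m))
    (o : {o // o ∈ S.dom}) (t : Tm m) (θ : Fin m → Ty n) (σ : ℕ → Tm n) :
    (dOp S o t).subst θ σ =
      dOp (m := n) (S := S.map fun A => A.subst θ) (o : {o // o ∈ S.dom}) (t.subst θ σ) := by
  unfold dOp
  rw [dLam_subst, Tm.subst_wk2]
  simp only [Tm.subst, Tm.listProj_subst]; rfl

theorem dOp_subst₀ {m : ℕ} {Op : Type u} [DecidableEq Op] (S : Sig Op (Ty m))
    (o : {o // o ∈ S.dom}) (t : Tm m) (σ : ℕ → Tm m) :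
    (dOp S o t).subst Ty.var σ = dOp S o (t.subst Ty.var σ) := by
  -- The function is rewritten to `id` instead of rewriting the signature, since the type of `o`
  -- depends on the signature; `S.map id` is definitionally `S`.
  have e : (fun A : Ty m => A.subst Ty.var) = id := funext Ty.subst_var
  rw [dOp_subst, e]; rfl

theorem dRet_subst₀ {m : ℕ} {Op : Type u} (S : Sig Op (Ty m)) (X : Ty m) (t : Tm m)
    (σ : ℕ → Tm m) : (dRet S X t).subst Ty.var σ = dRet S X (t.subst Ty.var σ) := by
  rw [dRet_subst, sig_map_subst_var, Ty.subst_var]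

theorem lett_subst {m n : ℕ} {Op : Type u} (S : Sig Op (Ty m)) (X Y : Ty m) (t r : Tm m)
    (θ : Fin m → Ty n) (σ : ℕ → Tm n) :
    (lett S X Y t r).subst θ σ = lett (S.map fun A => A.subst θ) (X.subst θ) (Y.subst θ)
      (t.subst θ σ) (r.subst θ (upS σ)) := by
  have e : (r.ren Fin.succ (upV (· + 2))).subst (upT θ)
      (upS (upS (upS fun i => (σ i).twk))) =
      (r.subst θ (upS σ)).ren Fin.succ (upV (· + 2)) := by
    simp only [Tm.ren_subst, Tm.subst_ren]
    congr 1; funext i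
    cases i with
    | zero => rfl
    | succ i => simp [upS, upV, Tm.wk, Tm.twk, Tm.ren_ren, Function.comp_def]
  rw [lett, dBind, dLam_subst, lett, dBind, ← e, Tm.subst_wk2, Ty.subst_wk]; rfl

theorem lett_subst₀ {m : ℕ} {Op : Type u} (S : Sig Op (Ty m)) (X Y : Ty m) (t r : Tm m)
    (σ : ℕ → Tm m) : (lett S X Y t r).subst Ty.var σ =
      lett S X Y (t.subst Ty.var σ) (r.subst Ty.var (upS σ)) := by
  rw [lett_subst, sig_map_subst_var, Ty.subst_var, Ty.subst_var]

theorem lett_wk2 {m : ℕ} {Op : Type u} (S : Sig Op (Ty m)) (X Y : Ty m) (t r : Tm m) :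
    (lett S X Y t r).wk2 = lett (S.map Ty.wk) X.wk Y.wk t.wk2 (r.ren Fin.succ (upV (· + 2))) := by
  rw [Tm.wk2_eq, lett_subst, sig_map_ren, ← Ty.ren_eq, ← Ty.ren_eq, ← Tm.wk2_eq, Tm.ren_eq]
  congr 2; funext i; cases i <;> rfl

theorem dRet_wk2 {m : ℕ} {Op : Type u} (S : Sig Op (Ty m)) (X : Ty m) (t : Tm m) :
    (dRet S X t).wk2 = dRet (S.map Ty.wk) X.wk t.wk2 := by
  rw [Tm.wk2_eq, dRet_subst, sig_map_ren, ← Ty.ren_eq, ← Tm.wk2_eq]; rfl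

theorem dRet_run {m : ℕ} {Op : Type u} {S : Sig Op (Ty m)} {X B : Ty m} {t k h : Tm m}
    {Γ : List (Ty m)} (ht : HasType Γ t X) (hk : HasType Γ k (.arr X B))
    (hh : HasType Γ h (hTy S B)) : BEq Γ (dRun (dRet S X t) B k h) (.app k t) B := by
  have := dLam_beta (t := .app (.var 1) t.wk2) (.app (.var rfl) (ht.wk2 _ _)) hk hh
  have e : (Tm.app (.var 1) t.wk2).subst (instT B) (scons h (scons k Tm.var)) = .app k t := by
    rw [Tm.subst, Tm.wk2_instT]; rfl
  rwa [e] at this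

theorem dOp_run {m : ℕ} {Op : Type u} [DecidableEq Op] {S : Sig Op (Ty m)}
    (o : {o // o ∈ S.dom}) {B : Ty m} {t k h : Tm m} {Γ : List (Ty m)}
    (ht : HasType Γ t (S.arg o)) (hk : HasType Γ k (.arr (S.res o) B))
    (hh : HasType Γ h (hTy S B)) :
    BEq Γ (dRun (dOp S o t) B k h) (.app (Tm.listProj S.ops o h) (.pair t k)) B := by
  have := dLam_beta (S := S) (X := S.res o) (B := B) (k := k) (h := h) (Γ := Γ)
    (t := .app (Tm.listProj S.ops o (.var 0)) (.pair t.wk2 (.var 1)))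
    (.app (A := .prod (S.arg o).wk (.arr (S.res o).wk (.var 0)))
      (HasType.listProj (ι := {o // o ∈ S.dom})
        (A := fun o => .arr (.prod (S.arg o).wk (.arr (S.res o).wk (.var 0))) (.var 0))
        (S.mem_ops o) (.var rfl)) (.pair (ht.wk2 _ _) (.var rfl))) hk hh
  simp only [Tm.subst, Tm.wk2_instT, Tm.listProj_subst] at this
  exact this

/-- The handler `h` is passed unchanged to both parts, while the second part moves into the
continuation of the first. Both associativity of `let` and the equation for handling a `let` rest on
this rule. -/
theorem lett_run {m : ℕ} {Op : Type u} {S : Sig Op (Ty m)} {X Y B : Ty m} {t n k h : Tm m}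
    {Γ : List (Ty m)} (ht : HasType Γ t (dTy S X)) (hn : HasType (X :: Γ) n (dTy S Y))
    (hk : HasType Γ k (.arr Y B)) (hh : HasType Γ h (hTy S B)) :
    BEq Γ (dRun (lett S X Y t n) B k h) (dRun t B (.lam X (dRun n B k.wk h.wk)) h) B := by
  have := dLam_beta (S := S) (X := Y) (B := B) (k := k) (h := h) (Γ := Γ)
    (t := dRun t.wk2 (.var 0) (.lam X.wk (dRun (n.ren Fin.succ (upV (· + 2))) (.var 0)
      (.var 2) (.var 1))) (.var 0))
    (.dRun (S := S.map Ty.wk) (X := X.wk) (dTy_wk S X ▸ ht.wk2 _ _)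
      (.lam (.dRun (S := S.map Ty.wk) (X := Y.wk) (dTy_wk S Y ▸ hasType_lett_body hn _ _)
        (.var rfl) (.var rfl))) (.var rfl)) hk hh
  have e : (n.ren Fin.succ (upV (· + 2))).subst (instT B)
      (upS (scons h (scons k Tm.var))) = n := by
    rw [Tm.subst_ren]
    refine Tm.subst_id n rfl (funext fun i => ?_)
    cases i <;> rfl
  simp only [dRun_subst, Tm.subst, Tm.wk2_instT, e] at this
  rw [show X.wk.subst (instT B) = X from Ty.wk_inst X B] at this
  exact this

/-! ### The monad laws -/

theorem lett_dRet_left {m : ℕ} {Op : Type u} {S : Sig Op (Ty m)} {X Y : Ty m} {t n : Tm m}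
    {Γ : List (Ty m)} (ht : HasType Γ t X) (hn : HasType (X :: Γ) n (dTy S Y)) :
    BEq Γ (lett S X Y (dRet S X t) n) (n.inst t) (dTy S Y) := by
  have hn' : HasType Γ (n.inst t) (dTy S Y) := by
    rw [Tm.inst_eq]; exact hn.subst₀ (hasType_scons ht fun i C hC => .var hC)
  refine .dTy_ext (.lett (.dRet S ht) hn) hn' ?_
  rw [lett_wk2, dRet_wk2]
  have hw := hasType_lett_body hn (hTy (S.map Ty.wk) (.var 0)) (.arr Y.wk (.var 0))
  rw [dTy_wk] at hw
  have ht' := ht.wk2 (hTy (S.map Ty.wk) (.var 0)) (.arr Y.wk (.var 0))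
  have hl : HasType (X.wk :: hTy (S.map Ty.wk) (.var 0) :: .arr Y.wk (.var 0) :: Γ.map Ty.wk)
    (dRun (n.ren Fin.succ (upV (· + 2))) (.var 0) (.var 2) (.var 1)) (.var 0) :=
    .dRun hw (.var rfl) (.var rfl)
  refine (lett_run (.dRet _ ht') hw (.var rfl) (.var rfl)).trans
    ((dRet_run ht' (.lam hl) (.var rfl)).trans ((BEq.lam_beta hl ht').trans ?_))
  -- Substituting for the bound variable shifts `k` and `h` from indices `2`, `1` back to `1`, `0`,
  -- so that the generic run of `n.inst t` appears.
  have e : (dRun (n.ren Fin.succ (upV (· + 2))) (.var 0) (.var 2) (.var 1)).inst t.wk2 =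
      dRun (n.inst t).wk2 (.var 0) (.var 1) (.var 0) := by
    rw [Tm.inst_eq, dRun_subst, Tm.inst_eq, Tm.subst_ren]
    simp only [Tm.wk2, Tm.ren_subst]
    congr 2; funext i; cases i <;> rfl
  rw [e]
  exact .refl (.dRun (S := S.map Ty.wk) (X := Y.wk) (dTy_wk S Y ▸ hn'.wk2 _ _) (.var rfl)
    (.var rfl))

theorem lett_dRet_right {m : ℕ} {Op : Type u} {S : Sig Op (Ty m)} {X : Ty m} {t : Tm m}
    {Γ : List (Ty m)} (ht : HasType Γ t (dTy S X)) :
    BEq Γ (lett S X X t (dRet S X (.var 0))) t (dTy S X) := by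
  refine .dTy_ext (.lett ht (.dRet S (.var rfl))) ht ?_
  have e : (dRet S X (.var 0)).ren Fin.succ (upV (· + 2)) =
      dRet (S.map Ty.wk) X.wk (.var 0) := by
    rw [Tm.ren_eq, dRet_subst, sig_map_ren, ← Ty.ren_eq]; rfl
  have ht' := ht.wk2 (hTy (S.map Ty.wk) (.var 0)) (.arr X.wk (.var 0))
  rw [dTy_wk] at ht'
  rw [lett_wk2, e]
  refine (lett_run ht' (.dRet _ (.var rfl)) (.var rfl) (.var rfl)).trans
    (.dRun (.refl ht') ?_ (.refl (.var rfl)))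
  -- The continuation has become `λ x. k x`, which `η` contracts to `k`.
  exact (BEq.lam (dRet_run (.var rfl) (.var rfl) (.var rfl))).trans
    (BEq.lam_eta (t := .var 1) (.var rfl)).symm

theorem lett_assoc {m : ℕ} {Op : Type u} {S : Sig Op (Ty m)} {X Y Z : Ty m} {t n r : Tm m}
    {Γ : List (Ty m)} (ht : HasType Γ t (dTy S X)) (hn : HasType (X :: Γ) n (dTy S Y))
    (hr : HasType (Y :: Γ) r (dTy S Z)) :
    BEq Γ (lett S Y Z (lett S X Y t n) r) (lett S X Z t (lett S Y Z n (r.ren id (upV (· + 1)))))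
      (dTy S Z) := by
  have hup {m : ℕ} {Γ : List (Ty m)} {X Y W : Ty m} {r : Tm m} (hr : HasType (Y :: Γ) r W) :
      HasType (Y :: X :: Γ) (r.ren id (upV (· + 1))) W := by
    have := hr.ren (Δ := Y :: X :: Γ) (ξ := id) (ρ := upV (· + 1)) fun i D hD => by
      rw [Ty.ren_id]; cases i <;> exact hD
    rwa [Ty.ren_id] at this
  -- Both sides run to `t B (λx. n B (λy. r B k h) h) h`. This is stated for arbitrary arguments and
  -- any number of type variables, because extensionality applies it to the weakened terms over one
  -- more type variable.
  have run {m : ℕ} {S : Sig Op (Ty m)} {X Y Z B : Ty m} {t n r k h : Tm m}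
      {Γ : List (Ty m)} (ht : HasType Γ t (dTy S X)) (hn : HasType (X :: Γ) n (dTy S Y))
      (hr : HasType (Y :: Γ) r (dTy S Z)) (hk : HasType Γ k (.arr Z B))
      (hh : HasType Γ h (hTy S B)) :
      BEq Γ (dRun (lett S Y Z (lett S X Y t n) r) B k h)
        (dRun (lett S X Z t (lett S Y Z n (r.ren id (upV (· + 1))))) B k h) B := by
    have hl : HasType Γ (.lam Y (dRun r B k.wk h.wk)) (.arr Y B) :=
      .lam (.dRun hr (hk.wk _) (hh.wk _))
    refine (lett_run (.lett ht hn) hr hk hh).trans ((lett_run ht hn hl hh).trans ?_)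
    refine .symm ((lett_run ht (.lett hn (hup hr)) hk hh).trans ?_)
    refine .dRun (.refl ht) (.lam ((lett_run hn (hup hr) (hk.wk _) (hh.wk _)).trans ?_)) (.refl hh)
    have e : (Tm.lam Y (dRun r B k.wk h.wk)).wk =
        .lam Y (dRun (r.ren id (upV (· + 1))) B k.wk.wk h.wk.wk) := by
      show Tm.lam (Y.ren id) (dRun (r.ren id (upV (· + 1))) (B.ren id)
        (k.wk.ren id (upV (· + 1))) (h.wk.ren id (upV (· + 1)))) = _
      simp only [Ty.ren_id, Tm.wk, Tm.ren_ren]; rfl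
    rw [e]
    exact .refl (.dRun hn (e ▸ hl.wk _) (hh.wk _))
  refine .dTy_ext (.lett (.lett ht hn) hr) (.lett ht (.lett hn (hup hr))) ?_
  have hw {Y : Ty m} {X : Ty m} {n : Tm m} (hn : HasType (X :: Γ) n (dTy S Y)) :=
    dTy_wk S Y ▸ hasType_lett_body hn (hTy (S.map Ty.wk) (.var 0)) (.arr Z.wk (.var 0))
  have ht' := ht.wk2 (hTy (S.map Ty.wk) (.var 0)) (.arr Z.wk (.var 0))
  rw [dTy_wk] at ht'
  have := run ht' (hw hn) (hw hr) (B := .var 0) (k := .var 1) (h := .var 0) (.var rfl) (.var rfl)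
  rw [lett_wk2, lett_wk2, lett_wk2]
  have e : (lett S Y Z n (r.ren id (upV (· + 1)))).ren Fin.succ (upV (· + 2)) =
      lett (S.map Ty.wk) Y.wk Z.wk (n.ren Fin.succ (upV (· + 2)))
        ((r.ren Fin.succ (upV (· + 2))).ren id (upV (· + 1))) := by
    rw [Tm.ren_eq, lett_subst, sig_map_ren, ← Ty.ren_eq, ← Ty.ren_eq, ← Tm.ren_eq]
    congr 1
    simp only [Tm.subst_ren, Tm.ren_ren]
    rw [Tm.ren_eq]
    congr 1; funext i; cases i <;> rfl
  rw [e]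
  exact this

end SysF

-- Typing of `βη`-equal terms and locality of substitution

namespace SysF

/-- Weakening below the bound variable and then instantiating that variable by the new one changes
nothing. This types the `η`-expansion of a polymorphic term. -/
theorem Ty.wk_ren_inst {m : ℕ} (A : Ty (m + 1)) : (A.ren (upR Fin.succ)).inst (.var 0) = A := by
  rw [Ty.inst, Ty.subst_ren]
  have : instT (.var 0) ∘ upR Fin.succ = (Ty.var : Fin (m + 1) → Ty (m + 1)) := by
    funext i; refine Fin.cases rfl (fun _ => rfl) i
  rw [this, Ty.subst_var]

/-- Since every axiom carries typing premises, typing can be recovered from an equation; `App`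
therefore need not record the typing of its result. -/
theorem BEq.hasType {m : ℕ} {Γ : List (Ty m)} {t s : Tm m} {A : Ty m} (h : BEq Γ t s A) :
    HasType Γ t A ∧ HasType Γ s A := by
  induction h with
  | refl h => exact ⟨h, h⟩
  | symm _ ih => exact ⟨ih.2, ih.1⟩
  | trans _ _ ih₁ ih₂ => exact ⟨ih₁.1, ih₂.2⟩
  | pair _ _ ih₁ ih₂ => exact ⟨.pair ih₁.1 ih₂.1, .pair ih₁.2 ih₂.2⟩
  | fst _ ih => exact ⟨.fst ih.1, .fst ih.2⟩
  | snd _ ih => exact ⟨.snd ih.1, .snd ih.2⟩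
  | lam _ ih => exact ⟨.lam ih.1, .lam ih.2⟩
  | app _ _ ih₁ ih₂ => exact ⟨.app ih₁.1 ih₂.1, .app ih₁.2 ih₂.2⟩
  | tlam _ ih => exact ⟨.tlam ih.1, .tlam ih.2⟩
  | tapp B _ ih => exact ⟨.tapp B ih.1, .tapp B ih.2⟩
  | unit_eta h => exact ⟨h, .star⟩
  | fst_beta h₁ h₂ => exact ⟨.fst (.pair h₁ h₂), h₁⟩
  | snd_beta h₁ h₂ => exact ⟨.snd (.pair h₁ h₂), h₂⟩
  | pair_eta h => exact ⟨h, .pair (.fst h) (.snd h)⟩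
  | lam_beta h₁ h₂ =>
    refine ⟨.app (.lam h₁) h₂, ?_⟩
    rw [Tm.inst_eq]
    exact h₁.subst₀ (hasType_scons h₂ fun i C hC => .var hC)
  | lam_eta h => exact ⟨h, .lam (.app (h.wk _) (.var rfl))⟩
  | tlam_beta B h =>
    refine ⟨.tapp B (.tlam h), h.subst fun i C hC => .var ?_⟩
    simp only [List.getElem?_map, Option.map_eq_some_iff] at hC
    obtain ⟨D, hD, rfl⟩ := hC
    rw [hD]; exact congrArg some (Ty.wk_inst D B).symm
  | @tlam_eta _ _ _ A h =>
    refine ⟨h, .tlam ?_⟩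
    have := HasType.tapp (A := A.ren (upR Fin.succ)) (.var 0) h.twk
    rwa [Ty.wk_ren_inst] at this

/-- Substitutions that agree on the variables of the context act equally on well-typed terms. -/
theorem HasType.subst_congr {m n : ℕ} {Γ : List (Ty m)} {t : Tm m} {A : Ty m} (h : HasType Γ t A)
    {θ : Fin m → Ty n} {σ τ : ℕ → Tm n} (hσ : ∀ i < Γ.length, σ i = τ i) :
    t.subst θ σ = t.subst θ τ := by
  induction h generalizing n with
  | var h => exact hσ _ (List.getElem?_eq_some_iff.mp h).1
  | star => rfl
  | pair _ _ ih₁ ih₂ => exact congrArg₂ Tm.pair (ih₁ hσ) (ih₂ hσ)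
  | fst _ ih => exact congrArg Tm.fst (ih hσ)
  | snd _ ih => exact congrArg Tm.snd (ih hσ)
  | lam _ ih =>
    refine congrArg (Tm.lam _) (ih fun i hi => ?_)
    cases i with
    | zero => rfl
    | succ i => exact congrArg Tm.wk (hσ i (by simpa using hi))
  | app _ _ ih₁ ih₂ => exact congrArg₂ Tm.app (ih₁ hσ) (ih₂ hσ)
  | tlam _ ih =>
    exact congrArg Tm.tlam (ih fun i hi => congrArg Tm.twk (hσ i (by simpa using hi)))
  | tapp B _ ih => exact congrArg (Tm.tapp · _) (ih hσ)

/-- Composition in the term model substitutes by a constant family. On terms with one variable only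
the entry at `0` counts, so the constant family at that variable acts as the identity. -/
theorem HasType.subst_single {m : ℕ} {t : Tm m} {A B : Ty m} (h : HasType [A] t B) :
    t.subst Ty.var (fun _ => .var 0) = t := by
  refine (h.subst_congr (τ := Tm.var) fun i hi => ?_).trans (Tm.subst_var t)
  rw [List.length_singleton, Nat.lt_one_iff] at hi
  rw [hi]

/-! ### Morphisms of the term model as functions on terms -/

/-- `t[s / x]` for a term `t` with a single variable `x`. -/
def Tm.ap {m : ℕ} (t s : Tm m) : Tm m := t.subst Ty.var (fun _ => s)

theorem Tm.ap_subst {m : ℕ} (t s : Tm m) (σ : ℕ → Tm m) :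
    (t.ap s).subst Ty.var σ = t.ap (s.subst Ty.var σ) := Tm.subst_subst _ _ _ _ _

theorem HasType.ap {m : ℕ} {Γ : List (Ty m)} {t s : Tm m} {A B : Ty m} (ht : HasType [A] t B)
    (hs : HasType Γ s A) : HasType Γ (t.ap s) B :=
  ht.subst₀ (forall_single (P := fun D => HasType Γ s D) hs)

theorem BEq.ap {m : ℕ} {Γ : List (Ty m)} {t t' s s' : Tm m} {A B : Ty m} (ht : BEq [A] t t' B)
    (hs : BEq Γ s s' A) : BEq Γ (t.ap s) (t'.ap s') B :=
  ht.subst₀ ht.hasType.1 (forall_single (P := fun D => HasType Γ s' D) hs.hasType.2)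
    (forall_single (P := fun D => BEq Γ s s' D) hs)

/-- The morphism `f` of the term model sends the term `s` to the term `t`, up to `βη`-equality. -/
def App {m : ℕ} (Γ : List (Ty m)) {A B : Ty m} (f : A ⟶ B) (s t : Tm m) : Prop :=
  HasType Γ s A ∧ ∃ (r : Tm m) (h : HasType [A] r B), f = mk r h ∧ BEq Γ (r.ap s) t B

namespace App

variable {m : ℕ} {Γ Δ : List (Ty m)} {A B C D : Ty m} {s t u : Tm m}

theorem of_mk {r : Tm m} (h : HasType [A] r B) (hs : HasType Γ s A) (e : BEq Γ (r.ap s) t B) :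
    App Γ (mk r h) s t := ⟨hs, r, h, rfl, e⟩

theorem left {f : A ⟶ B} (h : App Γ f s t) : HasType Γ s A := h.1

theorem right {f : A ⟶ B} (h : App Γ f s t) : HasType Γ t B := by
  obtain ⟨_, r, _, _, e⟩ := h; exact e.hasType.2

theorem conv {f : A ⟶ B} (h : App Γ f s t) (e : BEq Γ t u B) : App Γ f s u := by
  obtain ⟨hs, r, hr, rfl, e'⟩ := h
  exact ⟨hs, r, hr, rfl, e'.trans e⟩

theorem conv_left {f : A ⟶ B} (h : App Γ f s t) (e : BEq Γ s u A) : App Γ f u t := by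
  obtain ⟨hs, r, hr, rfl, e'⟩ := h
  exact ⟨e.hasType.2, r, hr, rfl, ((BEq.refl hr).ap e.symm).trans e'⟩

/-- A representative of `f` has no variable other than its argument, so substitution in the ambient
context acts only on the argument and the result. -/
theorem subst {f : A ⟶ B} (h : App Γ f s t) {σ : ℕ → Tm m}
    (hσ : ∀ i C, Γ[i]? = some C → HasType Δ (σ i) C) :
    App Δ f (s.subst Ty.var σ) (t.subst Ty.var σ) := by
  obtain ⟨hs, r, hr, rfl, e⟩ := h
  refine ⟨hs.subst₀ hσ, r, hr, rfl, ?_⟩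
  rw [← Tm.ap_subst]
  exact e.subst₀ e.hasType.1 hσ fun i C hC => .refl (hσ i C hC)

theorem exists_app (f : A ⟶ B) (hs : HasType Γ s A) : ∃ t, App Γ f s t := by
  obtain ⟨r, hr, rfl⟩ := exists_mk f
  exact ⟨_, hs, r, hr, rfl, .refl (hr.ap hs)⟩

/-- Two morphisms are equal if they agree on a term `s` of which the variable of type `A` is a
substitution instance. -/
theorem hom_ext {f g : A ⟶ B} (hf : App Γ f s t) (hg : App Γ g s u) (e : BEq Γ t u B)
    (σ : ℕ → Tm m) (hσ : ∀ i C, Γ[i]? = some C → HasType [A] (σ i) C)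
    (hs : BEq [A] (s.subst Ty.var σ) (.var 0) A) : f = g := by
  have hf' := ((hf.conv e).subst hσ).conv_left hs
  have hg' := (hg.subst hσ).conv_left hs
  obtain ⟨_, r, hr, rfl, e⟩ := hf'
  obtain ⟨_, r', hr', rfl, e'⟩ := hg'
  have := e.trans e'.symm
  rw [Tm.ap, Tm.ap, hr.subst_single, hr'.subst_single] at this
  exact mk_eq this

theorem id (hs : HasType Γ s A) : App Γ (𝟙 A) s s := of_mk (.var rfl) hs (.refl hs)

theorem comp {f : A ⟶ B} {g : B ⟶ C} (hf : App Γ f s t) (hg : App Γ g t u) :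
    App Γ (f ≫ g) s u := by
  obtain ⟨hs, r, hr, rfl, e⟩ := hf
  obtain ⟨ht, r', hr', rfl, e'⟩ := hg
  refine of_mk (r := r'.ap r) (hr'.ap hr) hs ?_
  rw [Tm.ap, Tm.ap_subst]
  exact ((BEq.refl hr').ap e).trans e'

theorem lift {f : A ⟶ B} {g : A ⟶ C} (hf : App Γ f s t) (hg : App Γ g s u) :
    App Γ (CartesianMonoidalCategory.lift f g) s (.pair t u) := by
  obtain ⟨hs, r, hr, rfl, e⟩ := hf
  obtain ⟨_, r', hr', rfl, e'⟩ := hg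
  exact of_mk (r := .pair r r') (.pair hr hr') hs (.pair e e')

theorem fst_of (hs : HasType Γ s (.prod A B)) :
    App Γ (CartesianMonoidalCategory.fst A B) s (.fst s) :=
  of_mk (r := .fst (.var 0)) (.fst (.var rfl)) hs (.refl (.fst hs))

theorem snd_of (hs : HasType Γ s (.prod A B)) :
    App Γ (CartesianMonoidalCategory.snd A B) s (.snd s) :=
  of_mk (r := .snd (.var 0)) (.snd (.var rfl)) hs (.refl (.snd hs))

theorem fst (hs : HasType Γ s A) (ht : HasType Γ t B) :
    App Γ (CartesianMonoidalCategory.fst A B) (.pair s t) s :=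
  (fst_of (.pair hs ht)).conv (.fst_beta hs ht)

theorem snd (hs : HasType Γ s A) (ht : HasType Γ t B) :
    App Γ (CartesianMonoidalCategory.snd A B) (.pair s t) t :=
  (snd_of (.pair hs ht)).conv (.snd_beta hs ht)

theorem toUnit (hs : HasType Γ s A) : App Γ (CartesianMonoidalCategory.toUnit A) s .star :=
  of_mk (r := .star) .star hs (.refl .star)

theorem whiskerLeft {f : A ⟶ B} (hs : HasType Γ s C) (h : App Γ f t u) :
    App Γ (C ◁ f) (.pair s t) (.pair s u) := by
  have e : C ◁ f = CartesianMonoidalCategory.lift (CartesianMonoidalCategory.fst C A)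
    (CartesianMonoidalCategory.snd C A ≫ f) := by ext <;> simp
  rw [e]
  exact lift (fst hs h.left) ((snd hs h.left).comp h)

theorem whiskerRight {f : A ⟶ B} (h : App Γ f s u) (ht : HasType Γ t C) :
    App Γ (f ▷ C) (.pair s t) (.pair u t) := by
  have e : f ▷ C = CartesianMonoidalCategory.lift (CartesianMonoidalCategory.fst A C ≫ f)
    (CartesianMonoidalCategory.snd A C) := by ext <;> simp
  rw [e]
  exact lift ((fst h.left ht).comp h) (snd h.left ht)

theorem leftUnitor_hom (hs : HasType Γ s .unit) (ht : HasType Γ t A) :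
    App Γ (λ_ A).hom (.pair s t) t := by
  rw [CartesianMonoidalCategory.leftUnitor_hom]; exact snd hs ht

theorem leftUnitor_inv (hs : HasType Γ s A) : App Γ (λ_ A).inv s (.pair .star s) := by
  have e : (λ_ A).inv = CartesianMonoidalCategory.lift (CartesianMonoidalCategory.toUnit A) (𝟙 A) := by
    ext; simp
  rw [e]; exact lift (toUnit hs) (id hs)

theorem associator_hom (hs : HasType Γ s A) (ht : HasType Γ t B) (hu : HasType Γ u C) :
    App Γ (α_ A B C).hom (.pair (.pair s t) u) (.pair s (.pair t u)) := by
  have e : (α_ A B C).hom = CartesianMonoidalCategory.lift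
      (CartesianMonoidalCategory.fst (A ⊗ B) C ≫ CartesianMonoidalCategory.fst A B)
      (CartesianMonoidalCategory.lift
        (CartesianMonoidalCategory.fst (A ⊗ B) C ≫ CartesianMonoidalCategory.snd A B)
        (CartesianMonoidalCategory.snd (A ⊗ B) C)) := by ext <;> simp
  rw [e]
  exact lift ((fst (.pair hs ht) hu).comp (fst hs ht))
    (lift ((fst (.pair hs ht) hu).comp (snd hs ht)) (snd (.pair hs ht) hu))

theorem associator_inv (hs : HasType Γ s A) (ht : HasType Γ t B) (hu : HasType Γ u C) :
    App Γ (α_ A B C).inv (.pair s (.pair t u)) (.pair (.pair s t) u) := by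
  have e : (α_ A B C).inv = CartesianMonoidalCategory.lift
      (CartesianMonoidalCategory.lift (CartesianMonoidalCategory.fst A (B ⊗ C))
        (CartesianMonoidalCategory.snd A (B ⊗ C) ≫ CartesianMonoidalCategory.fst B C))
        (CartesianMonoidalCategory.snd A (B ⊗ C) ≫ CartesianMonoidalCategory.snd B C) := by
    ext <;> simp
  rw [e]
  exact lift (lift (fst hs (.pair ht hu)) ((snd hs (.pair ht hu)).comp (fst ht hu)))
    ((snd hs (.pair ht hu)).comp (snd ht hu))

theorem listTuple {ι : Type u} {A : Ty m} {B : ι → Ty m} {f : ∀ i, A ⟶ B i} {t : ι → Tm m}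
    (hs : HasType Γ s A) (h : ∀ i, App Γ (f i) s (t i)) (l : List ι) :
    App Γ (LamEff.listTuple f l) s (Tm.listTuple t l) := by
  induction l with
  | nil => exact toUnit hs
  | cons i l ih => exact lift (h i) ih

theorem listProj {ι : Type u} [DecidableEq ι] {A : ι → Ty m} {l : List ι} {i : ι} (hi : i ∈ l)
    {s : Tm m} (hs : HasType Γ s (Ty.listProd A l)) :
    App Γ (LamEff.listProj A l i hi) s (Tm.listProj l i s) := by
  induction l generalizing s with
  | nil => simp at hi
  | cons j l ih =>
    rw [LamEff.listProj, Tm.listProj]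
    split
    · next e =>
      subst e
      -- Once the two indices are identified, the transport in the projection is an identity.
      exact comp (B := A i) (fst_of (A := A i) (B := Ty.listProd A l) hs) (id (.fst hs))
    · next e => exact (snd_of hs).comp (ih _ (.snd hs))

end App

end SysF

-- The structure maps of the CPS model as operations on terms

namespace LamEff

open SysF

variable {Op : Type u} {Γ : List (Ty 0)} {X Y Z : Ty 0} {s t n : Tm 0}

theorem app_unit (S : Sig Op (Ty 0)) (hs : HasType Γ s X) :
    App Γ ((dKleisli S).unit X) s (dRet S X s) := by
  refine App.of_mk (r := dRet S X (.var 0)) (.dRet S (.var rfl)) hs ?_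
  rw [Tm.ap, dRet_subst₀]
  exact .refl (.dRet S hs)

/-- The bridge from Kleisli extension to the syntactic `let`: it suffices to know the value `n` of
`f` on `s` paired with a fresh variable. All monadic structure maps other than the unit are computed
from this rule. -/
theorem app_ext {S : Sig Op (Ty 0)} {f : X ⊗ Y ⟶ (dKleisli S).obj Z} (hs : HasType Γ s X)
    (ht : HasType Γ t (dTy S Y)) (hf : App (Y :: Γ) f (.pair s.wk (.var 0)) n) :
    App Γ ((dKleisli S).ext f) (.pair s t) (lett S Y Z t n) := by
  obtain ⟨_, r, hr, rfl, e⟩ := hf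
  -- The shift by `2` past `k` and `h` sends the argument, index `1`, to index `3`. Hence the
  -- extension is literally a `lett`, and the substitution rule for `lett` applies.
  have hb : extBody r = (r.ap (.pair (.fst (.var 1)) (.var 0))).ren Fin.succ (upV (· + 2)) := by
    rw [extBody, Tm.twk, Tm.subst_ren, Tm.ap, Tm.ren_subst]; rfl
  refine App.of_mk (r := dBind S Y Z (.snd (.var 0)) (extBody r))
    (.dBind (.snd (.var rfl)) (hasType_extBody hr)) (.pair hs ht) ?_
  rw [hb]
  show SysF.BEq Γ ((lett S Y Z _ _).subst _ _) _ _
  rw [lett_subst₀, Tm.ap_subst]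
  exact .lett (.snd_beta hs ht) ((SysF.BEq.ap (.refl hr)
    (.pair (.fst_beta (hs.wk Y) (ht.wk Y)) (.refl (.var rfl)))).trans e)

variable [DecidableEq Op]

theorem app_curry {S : Sig Op (Ty 0)} {f : X ⊗ Y ⟶ dTy S Z} (hs : HasType Γ s X)
    (hf : App (Y :: Γ) f (.pair s.wk (.var 0)) n) :
    App Γ ((cpsModel Op).curry S (X := X) (Y := Y) (Z := Z) f) s (.lam Y n) := by
  obtain ⟨_, r, hr, rfl, e⟩ := hf
  refine App.of_mk (r := .lam Y (curBody r)) (.lam (hr.ap (.pair (.var rfl) (.var rfl)))) hs ?_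
  show SysF.BEq Γ (.lam (Y.subst _) ((r.ap _).subst _ _)) _ _
  rw [Ty.subst_var, Tm.ap_subst]
  exact .lam e

theorem app_ev {S : Sig Op (Ty 0)} (hs : HasType Γ s (.arr Y (dTy S Z))) (ht : HasType Γ t Y) :
    App Γ ((cpsModel Op).ev S Y Z) (.pair s t) (.app s t) :=
  App.of_mk (r := .app (.fst (.var 0)) (.snd (.var 0)))
    (.app (.fst (.var rfl)) (.snd (.var rfl))) (.pair hs ht)
    (.app (.fst_beta hs ht) (.snd_beta hs ht))

theorem app_opr {S : Sig Op (Ty 0)} (o : {o // o ∈ S.dom}) (hs : HasType Γ s (S.arg o)) :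
    App Γ ((cpsModel Op).opr S o) s (dOp S o s) := by
  refine App.of_mk (r := dOp S o (.var 0)) (.dOp o (.var rfl)) hs ?_
  rw [Tm.ap, dOp_subst₀]
  exact .refl (.dOp o hs)

theorem app_handle {S S' : Sig Op (Ty 0)} (hs : HasType Γ s (hTy S (dTy S' X)))
    (ht : HasType Γ t (dTy S (dTy S' X))) :
    App Γ ((cpsModel Op).handle S S' X) (.pair s t)
      (dRun t (dTy S' X) (.lam (dTy S' X) (.var 0)) s) := by
  refine App.of_mk (r := dRun (.snd (.var 0)) (dTy S' X) (.lam (dTy S' X) (.var 0)) (.fst (.var 0)))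
    (.dRun (.snd (.var rfl)) (.lam (.var rfl)) (.fst (.var rfl))) (.pair hs ht) ?_
  rw [Tm.ap, dRun_subst, Ty.subst_var]
  refine .dRun (.snd_beta hs ht) ?_ (.fst_beta hs ht)
  show SysF.BEq Γ (.lam ((dTy S' X).subst _) (.var 0)) _ _
  rw [Ty.subst_var]
  exact .refl (.lam (.var rfl))

end LamEff

-- Running mapped computations, and extensionality for morphisms out of products

namespace SysF

theorem lam_wk {m : ℕ} (A : Ty m) (t : Tm m) :
    (Tm.lam A t).wk = .lam A (t.ren id (upV (· + 1))) := by
  show Tm.lam (A.ren id) _ = _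
  rw [Ty.ren_id]

theorem dRun_ren_id {m : ℕ} (t : Tm m) (B : Ty m) (k h : Tm m) (ρ : ℕ → ℕ) :
    (dRun t B k h).ren id ρ = dRun (t.ren id ρ) B (k.ren id ρ) (h.ren id ρ) := by
  show dRun _ (B.ren id) _ _ = _
  rw [Ty.ren_id]

/-- Mapping a computation along `n` only precomposes the continuation with `n`. -/
theorem dRun_lett_dRet {m : ℕ} {Op : Type u} {S : Sig Op (Ty m)} {X Y B : Ty m} {t n k h : Tm m}
    {Γ : List (Ty m)} (ht : HasType Γ t (dTy S X)) (hn : HasType (X :: Γ) n Y)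
    (hk : HasType Γ k (.arr Y B)) (hh : HasType Γ h (hTy S B)) :
    BEq Γ (dRun (lett S X Y t (dRet S Y n)) B k h) (dRun t B (.lam X (.app k.wk n)) h) B :=
  (lett_run ht (.dRet S hn) hk hh).trans
    (.dRun (.refl ht) (.lam (dRet_run hn (hk.wk X) (hh.wk X))) (.refl hh))

theorem beq_id_app {m : ℕ} {X : Ty m} {t : Tm m} {Γ : List (Ty m)} (ht : HasType Γ t X) :
    BEq Γ (.app (.lam X (.var 0)) t) t X := .lam_beta (t := .var 0) (.var rfl) ht

/-- Under the identity continuation used by the model's handling map, the mapped function itself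
becomes the continuation. -/
theorem dRun_lett_dRet_id {m : ℕ} {Op : Type u} {S : Sig Op (Ty m)} {X B : Ty m} {t n h : Tm m}
    {Γ : List (Ty m)} (ht : HasType Γ t (dTy S X)) (hn : HasType (X :: Γ) n B)
    (hh : HasType Γ h (hTy S B)) :
    BEq Γ (dRun (lett S X B t (dRet S B n)) B (.lam B (.var 0)) h) (dRun t B (.lam X n) h) B := by
  refine (dRun_lett_dRet ht hn (.lam (.var rfl)) hh).trans
    (.dRun (.refl ht) (.lam ?_) (.refl hh))
  rw [lam_wk]
  exact beq_id_app hn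

/-- Running a computation that is mapped along `p` and then along `n`, where `n` depends on no
variable but its argument. -/
theorem dRun_lett_lett_id {m : ℕ} {Op : Type u} {S : Sig Op (Ty m)} {X P B : Ty m}
    {t p n h : Tm m} {Γ : List (Ty m)} (ht : HasType Γ t (dTy S X)) (hp : HasType (X :: Γ) p P)
    (hn : HasType (P :: Γ) n B) (hn' : HasType (P :: X :: Γ) n B)
    (e : n.ren id (upV (· + 1)) = n) (hh : HasType Γ h (hTy S B)) :
    BEq Γ (dRun (lett S P B (lett S X P t (dRet S P p)) (dRet S B n)) B (.lam B (.var 0)) h)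
      (dRun t B (.lam X (n.inst p)) h) B := by
  refine (dRun_lett_dRet_id (.lett ht (.dRet S hp)) hn hh).trans
    ((dRun_lett_dRet ht hp (.lam hn) hh).trans (.dRun (.refl ht) (.lam ?_) (.refl hh)))
  -- The function `λn` has to be weakened to stand under the binder of `p`; `e` says that this
  -- leaves `n` unchanged, so one `β`-step remains.
  rw [lam_wk, e]
  exact .lam_beta hn' hp

namespace App

variable {m : ℕ} {Γ : List (Ty m)} {A B C D : Ty m} {s t u : Tm m}

theorem ren {f : A ⟶ B} {Δ : List (Ty m)} (h : App Γ f s t) {ρ : ℕ → ℕ}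
    (hρ : ∀ i C, Γ[i]? = some C → Δ[ρ i]? = some C) :
    App Δ f (s.ren _root_.id ρ) (t.ren _root_.id ρ) := by
  rw [Tm.ren_eq, Tm.ren_eq]
  exact h.subst fun i C hC => .var (hρ i C hC)

theorem wk {f : A ⟶ B} (h : App Γ f s t) : App (C :: Γ) f s.wk t.wk :=
  h.ren fun _ _ hC => hC

theorem hom_ext₁ {f g : A ⟶ B} (hf : App [A] f (.var 0) t) (hg : App [A] g (.var 0) u)
    (e : BEq [A] t u B) : f = g :=
  hom_ext hf hg e Tm.var (fun _ _ hC => .var hC) (.refl (.var rfl))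

/-- By surjective pairing a variable `z` of product type is the instance of the generic pair `⟨x,
y⟩` at the two projections of `z`, so values on the generic pair decide equality. The two ternary
versions iterate this for either bracketing. -/
theorem hom_ext₂ {f g : A ⊗ B ⟶ C} (hf : App [B, A] f (.pair (.var 1) (.var 0)) t)
    (hg : App [B, A] g (.pair (.var 1) (.var 0)) u) (e : BEq [B, A] t u C) : f = g :=
  hom_ext hf hg e (scons (.snd (.var 0)) (fun _ => .fst (.var 0)))
    (hasType_scons (.snd (A := A) (.var rfl))
      (forall_single (P := fun D => HasType _ _ D) (.fst (B := B) (.var rfl))))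
    (BEq.pair_eta (t := .var 0) (.var rfl)).symm

theorem hom_ext_left₃ {f g : (A ⊗ B) ⊗ C ⟶ D}
    (hf : App [C, B, A] f (.pair (.pair (.var 2) (.var 1)) (.var 0)) t)
    (hg : App [C, B, A] g (.pair (.pair (.var 2) (.var 1)) (.var 0)) u)
    (e : BEq [C, B, A] t u D) : f = g := by
  have h : HasType [Ty.prod (.prod A B) C] (.fst (.var 0)) (.prod A B) := .fst (.var rfl)
  refine hom_ext hf hg e (scons (.snd (.var 0)) (scons (.snd (.fst (.var 0)))
      (fun _ => .fst (.fst (.var 0)))))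
    (hasType_scons (.snd (A := .prod A B) (.var rfl)) (hasType_scons (.snd h)
      (forall_single (P := fun D => HasType _ _ D) (.fst h)))) ?_
  exact (BEq.pair (BEq.pair_eta h).symm (.refl (.snd (.var rfl)))).trans
    (BEq.pair_eta (t := .var 0) (.var rfl)).symm

theorem hom_ext_right₃ {f g : A ⊗ (B ⊗ C) ⟶ D}
    (hf : App [C, B, A] f (.pair (.var 2) (.pair (.var 1) (.var 0))) t)
    (hg : App [C, B, A] g (.pair (.var 2) (.pair (.var 1) (.var 0))) u)
    (e : BEq [C, B, A] t u D) : f = g := by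
  have h : HasType [Ty.prod A (.prod B C)] (.snd (.var 0)) (.prod B C) := .snd (.var rfl)
  refine hom_ext hf hg e (scons (.snd (.snd (.var 0))) (scons (.fst (.snd (.var 0)))
      (fun _ => .fst (.var 0))))
    (hasType_scons (.snd h) (hasType_scons (.fst h)
      (forall_single (P := fun D => HasType _ _ D) (.fst (B := .prod B C) (.var rfl))))) ?_
  exact (BEq.pair (.refl (.fst (.var rfl))) (BEq.pair_eta h).symm).trans
    (BEq.pair_eta (t := .var 0) (.var rfl)).symm

theorem inst {f : A ⟶ B} (h : App (C :: Γ) f s t) (hu : HasType Γ u C) :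
    App Γ f (s.inst u) (t.inst u) := by
  rw [Tm.inst_eq, Tm.inst_eq]
  exact h.subst (hasType_scons hu fun i D hD => .var hD)

end App

end SysF

-- The laws of the CPS model

namespace LamEff

open SysF

variable {Op : Type u} {Γ : List (Ty 0)} {X Y Z : Ty 0} {s t n : Tm 0}

theorem app_map {S : Sig Op (Ty 0)} {f : X ⟶ Y} (hs : HasType Γ s (dTy S X))
    (hf : App (X :: Γ) f (.var 0) n) :
    App Γ ((dKleisli S).map f) s (lett S X Y s (dRet S Y n)) :=
  .comp (.leftUnitor_inv hs) (app_ext (X := .unit) .star hs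
    (.comp (.leftUnitor_hom .star (.var rfl)) (.comp hf (app_unit S hf.right))))

theorem app_mu {S : Sig Op (Ty 0)} (hs : HasType Γ s (dTy S (dTy S X))) :
    App Γ ((dKleisli S).mu X) s (lett S (dTy S X) X s (.var 0)) :=
  .comp (.leftUnitor_inv hs) (app_ext (X := .unit) .star hs (.leftUnitor_hom .star (.var rfl)))

theorem app_str {S : Sig Op (Ty 0)} (hs : HasType Γ s X) (ht : HasType Γ t (dTy S Y)) :
    App Γ ((dKleisli S).str X Y) (.pair s t)
      (lett S Y (.prod X Y) t (dRet S (.prod X Y) (.pair s.wk (.var 0)))) :=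
  app_ext hs ht (app_unit S (.pair (hs.wk Y) (.var rfl)))

/-- Evaluated on generic tuples, the three laws are the right unit, left unit and associativity laws
for `lett`. -/
theorem dKleisli_isStrongKleisliTriple (S : Sig Op (Ty 0)) :
    (dKleisli S).IsStrongKleisliTriple where
  ext_unit X := by
    refine App.hom_ext (Γ := [dTy S X]) (s := .pair .star (.var 0))
      (app_ext (X := .unit) .star (.var rfl)
        (.comp (.leftUnitor_hom .star (.var rfl)) (app_unit S (.var rfl))))
      (.leftUnitor_hom .star (.var rfl)) (lett_dRet_right (.var rfl)) (fun _ => .snd (.var 0))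
      (forall_single (P := fun D => HasType _ _ D) (.snd (A := .unit) (.var rfl))) ?_
    have h : HasType [Ty.prod .unit (dTy S X)] (.fst (.var 0)) .unit := .fst (.var rfl)
    exact (SysF.BEq.pair (SysF.BEq.unit_eta h).symm (.refl (.snd (.var rfl)))).trans
      (SysF.BEq.pair_eta (t := .var 0) (.var rfl)).symm
  unit_ext {X Y Z} f := by
    -- The argument `y` of the generic pair stays in the context next to the variable bound by the
    -- extension; instantiating the latter by `y` gives the value of `f` on the generic pair.
    obtain ⟨n, hn⟩ := App.exists_app (Γ := [Y, Y, X]) (s := .pair (.var 2) (.var 0)) f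
      (.pair (.var rfl) (.var rfl))
    exact App.hom_ext₂ (.comp (.whiskerLeft (.var rfl) (app_unit S (.var rfl)))
      (app_ext (.var rfl) (.dRet S (.var rfl)) hn)) (hn.inst (.var rfl))
      (lett_dRet_left (.var rfl) hn.right)
  ext_ext {W X Y Z V} f g := by
    obtain ⟨n, hn⟩ := App.exists_app (Γ := [Y, dTy S Y, X, W])
      (s := .pair (.var 2) (.var 0)) f (.pair (.var rfl) (.var rfl))
    obtain ⟨r, hr⟩ := App.exists_app (Γ := [Z, dTy S Y, X, W])
      (s := .pair (.var 3) (.var 0)) g (.pair (.var rfl) (.var rfl))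
    -- On the right-hand side `g` is used under the additional binder for the result of the inner
    -- computation; this weakening is the one that appears in `lett_assoc`.
    have hr' := hr.ren (Δ := [Z, Y, dTy S Y, X, W]) (ρ := upV (· + 1))
      (fun i C hC => by cases i <;> exact hC)
    have hl : HasType [dTy S Y, X, W] (lett S Y Z (.var 0) n) (dTy S Z) :=
      .lett (.var rfl) hn.right
    refine App.hom_ext_left₃
      (.comp (.associator_hom (.var rfl) (.var rfl) (.var rfl))
        (.comp (.whiskerLeft (.var rfl) (app_ext (.var rfl) (.var rfl) hn))
          (app_ext (.var rfl) hl hr)))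
      (app_ext (X := .prod W X) (.pair (.var rfl) (.var rfl)) (.var rfl)
        (.comp (.associator_hom (.var rfl) (.var rfl) (.var rfl))
          (.comp (.whiskerLeft (.var rfl) hn) (app_ext (.var rfl) hn.right hr'))))
      (lett_assoc (.var rfl) hn.right hr.right)

variable [DecidableEq Op]

theorem cpsModel_isModel : (cpsModel Op).IsModel where
  strong S := dKleisli_isStrongKleisliTriple S
  curry_ev S {X Y Z} f := by
    obtain ⟨n, hn⟩ := App.exists_app (Γ := [Y, Y, X]) (s := .pair (.var 2) (.var 0)) f
      (.pair (.var rfl) (.var rfl))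
    exact App.hom_ext₂ (.comp (.whiskerRight (app_curry (.var rfl) hn) (.var rfl))
      (app_ev (.lam hn.right) (.var rfl))) (hn.inst (.var rfl)) (.lam_beta hn.right (.var rfl))
  curry_uncurry S {X Y Z} g := by
    obtain ⟨n, hn⟩ := App.exists_app (Γ := [X]) (s := .var 0) g (.var rfl)
    exact App.hom_ext₁ (app_curry (.var rfl) (.comp (.whiskerRight hn.wk (.var rfl))
      (app_ev hn.wk.right (.var rfl)))) hn (SysF.BEq.lam_eta hn.right).symm
  handle_unit S S' X := by
    refine App.hom_ext₂ (.comp (.whiskerLeft (.var rfl) (app_unit S (.var rfl)))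
      (app_handle (.var rfl) (.dRet S (.var rfl)))) (.snd (.var rfl) (.var rfl)) ?_
    exact (dRet_run (.var rfl) (.lam (.var rfl)) (.var rfl)).trans (beq_id_app (.var rfl))
  handle_mult S S' X := by
    let D := dTy S' X
    let P := Ty.prod (hTy S D) (dTy S D)
    -- To map along the handling map, its value on a single variable of product type is needed; `η`
    -- replaces the variable by the pair of its projections. The resulting term mentions no other
    -- variable, as `dRun_lett_lett_id` requires.
    have hE {Γ : List (Ty 0)} : App (P :: Γ) ((cpsModel Op).handle S S' X) (.var 0)
        (dRun (.snd (.var 0)) D (.lam D (.var 0)) (.fst (.var 0))) :=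
      (app_handle (.fst (.var rfl)) (.snd (.var rfl))).conv_left
        (SysF.BEq.pair_eta (A := hTy S D) (B := dTy S D) (.var rfl)).symm
    have hst := app_str (S := S) (Γ := [dTy S (dTy S D), hTy S D]) (s := .var 1) (t := .var 0)
      (X := hTy S D) (Y := dTy S D) (.var rfl) (.var rfl)
    have hv : HasType [dTy S (dTy S D), hTy S D] (.var 1) (hTy S D) := .var rfl
    refine App.hom_ext₂ (.comp (.whiskerLeft hv (app_mu (.var rfl)))
      (app_handle hv (.lett (.var rfl) (.var rfl))))
      (.comp (.lift (.fst hv (.var rfl)) hst)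
        (.comp (.whiskerLeft hv (app_map hst.right hE))
          (app_handle hv (.lett hst.right (.dRet S hE.right))))) ?_
    -- With `u` the computation and `h` the handler, both sides become `u D (λv. v D (λy.y) h) h`:
    -- the left by running the multiplication, the right by collapsing strength, mapping and
    -- identity continuation.
    refine (lett_run (.var rfl) (.var rfl) (.lam (.var rfl)) hv).trans (.symm ?_)
    refine (dRun_lett_lett_id (.var rfl) (.pair (.var rfl) (.var rfl)) hE.right hE.right
      (by rw [dRun_ren_id]; simp [Tm.ren, Ty.ren_id, upV]) hv).trans
      (.dRun (.refl (.var rfl)) (.lam ?_) (.refl hv))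
    rw [Tm.inst_eq, dRun_subst, Ty.subst_var, lam_wk]
    simp only [Tm.subst, Ty.subst_var]
    exact .dRun (.snd_beta (.var rfl) (.var rfl)) (.refl (.lam (.var rfl)))
      (.fst_beta (.var rfl) (.var rfl))
  handle_op S S' X o := by
    let D := dTy S' X
    let E := Ty.arr (S.res o) D
    let P := Ty.prod E (S.res o)
    have hE {Γ : List (Ty 0)} : App (P :: Γ) ((cpsModel Op).ev S' (S.res o) X) (.var 0)
        (.app (.fst (.var 0)) (.snd (.var 0))) :=
      (app_ev (.fst (.var rfl)) (.snd (.var rfl))).conv_left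
        (SysF.BEq.pair_eta (A := E) (B := S.res o) (.var rfl)).symm
    have h₀ : HasType [E, S.arg o, hTy S D] (.var 0) E := .var rfl
    have h₁ : HasType [E, S.arg o, hTy S D] (.var 1) (S.arg o) := .var rfl
    have h₂ : HasType [E, S.arg o, hTy S D] (.var 2) (hTy S D) := .var rfl
    have ho := HasType.dOp o h₁
    have hst := app_str (S := S) h₀ ho
    have hc := App.listProj (S.mem_ops o) h₂
    refine App.hom_ext_right₃ (.comp (.whiskerLeft h₂ (.comp (.whiskerRight (app_opr o h₁) h₀)
      (.comp (.lift (.snd ho h₀) (.fst ho h₀)) (.comp hst (app_map hst.right hE)))))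
      (app_handle h₂ (.lett hst.right (.dRet S hE.right))))
      (.comp (.whiskerRight hc (.pair h₁ h₀)) (app_ev hc.right (.pair h₁ h₀))) ?_
    refine (dRun_lett_lett_id ho (.pair (.var rfl) (.var rfl)) hE.right hE.right rfl h₂).trans
      (.trans (.dRun (.refl ho) ?_ (.refl h₂)) (dOp_run o h₁ h₀ h₂))
    -- Strength and evaluation produce the continuation `λb. κ b` from the given `κ`, and `η`
    -- returns `κ`, the continuation that the handler clause receives.
    exact .trans (.lam (.app (.fst_beta (.var rfl) (.var rfl)) (.snd_beta (.var rfl) (.var rfl))))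
      (SysF.BEq.lam_eta h₀).symm

end LamEff

namespace LamEff

open SysF

variable {Op : Type u}

/-! ### Reduction implies derivable equality -/

theorem ECtx.plug_congr {Γ : Ctx Op} {D : CTy Op} : {C : CTy Op} → (E : ECtx Γ D C) →
    {M N : Comp Γ D} → CEq M N → CEq (E.plug M) (E.plug N)
  | _, .hole, _, _, h => h
  | _, .letIn E N, _, _, h => .letIn (E.plug_congr h) (.refl N)
  | _, .handle E H N, _, _, h => .handle (E.plug_congr h) (fun o => .refl (H o)) (.refl N)

/-- Induction on the `let` frames: the empty context is the right unit law, and each frame is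
absorbed by associativity. Such frames preserve the signature, which keeps the induction within one
`S`. -/
theorem ECtx.HandleFree.plug_eq {Γ : Ctx Op} {X : VTy Op} {S : Sig Op (VTy Op)} :
    {A : VTy Op} → {E : ECtx Γ ⟨X, S⟩ ⟨A, S⟩} → E.HandleFree → (M : Comp Γ ⟨X, S⟩) →
    CEq (E.plug M) (.letIn M ((E.ren Ren.wk).plug (.ret (.var .zero))))
  | _, .hole, _, M => (CEq.let_ret M).symm
  | _, .letIn E N, h, M =>
      (CEq.letIn (ECtx.HandleFree.plug_eq (E := E) h M) (.refl N)).trans (.let_let M _ N)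
  | _, .handle _ _ _, h, _ => h.elim

/-- Only the reduction of an operation under a handler is not already an axiom or congruence.
Writing `𝒞[op(V)]` as a `let`, the equations for handling a `let` and an operation yield exactly the
captured continuation of the rule. -/
theorem Red.ceq {C : CTy Op} {M N : Comp [] C} (h : Red M N) : CEq M N := by
  induction h with
  | ctx E _ ih => exact E.plug_congr ih
  | ret_let V M => exact .ret_let V M
  | lam_beta M V => exact .lam_beta M V
  | handle_ret V H M => exact .handle_ret V H M
  | handle_op o E hE V H M =>
    exact (CEq.handle (hE.plug_eq (.op o V)) (fun o => .refl (H o)) (.refl M)).trans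
      ((CEq.handle_let _ _ H M).trans (.handle_op o V H _))

/-! ### The CPS transformation and substitution -/

theorem Ren.lift_idx {Γ Δ : Ctx Op} {ρ : Ren Γ Δ} {σ : ℕ → Tm 0}
    (h : ∀ A (x : Var Γ A), Tm.var (ρ A x).idx = σ x.idx) {B : VTy Op} :
    ∀ A (x : Var (B :: Γ) A), Tm.var (ρ.lift A x).idx = upS σ x.idx
  | _, .zero => rfl
  | _, .succ x => congrArg Tm.wk (h _ x)

theorem Ren.wk_idx {Γ : Ctx Op} {B : VTy Op} (A : VTy Op) (x : Var Γ A) :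
    Tm.var (Ren.wk (B := B) A x).idx = (fun i => (Tm.var (i + 1) : Tm 0)) x.idx := rfl

variable [DecidableEq Op]

/-- A clause binds `x` and `k` in the source but a single pair in the target, so two liftings of `σ`
before unpairing match one lifting after it. -/
theorem clause_subst (A B C : Ty 0) (t : Tm 0) (σ : ℕ → Tm 0) :
    (Tm.lam (.prod A (.arr B C)) (t.subst Ty.var unpair)).subst Ty.var σ =
      .lam (.prod A (.arr B C)) ((t.subst Ty.var (upS (upS σ))).subst Ty.var unpair) := by
  show Tm.lam ((Ty.prod A (.arr B C)).subst Ty.var) _ = _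
  rw [Ty.subst_var, Tm.subst_subst, Tm.subst_subst]
  congr 2; funext i
  match i with
  | 0 => rfl
  | 1 => rfl
  | i + 2 =>
    simp only [upS, Tm.wk_subst, unpair, Tm.subst]
    exact Tm.wk_eq (σ i)

/-- The hypothesis is clausewise so that the mutual recursions below can supply it from their
recursive calls; it serves renamings and substitutions alike. -/
theorem Handler.cps_eq_subst {Γ Δ : Ctx Op} {S : Sig Op (VTy Op)} {C : CTy Op}
    {H : Handler Γ S C} {H' : Handler Δ S C} {σ : ℕ → Tm 0}
    (h : ∀ o, (H' o).cps = (H o).cps.subst Ty.var (upS (upS σ))) :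
    Handler.cps H' = (Handler.cps H).subst Ty.var σ := by
  refine .trans ?_ (Tm.listTuple_subst _ _ _ _).symm
  refine congrArg (Tm.listTuple · _) (funext fun o => ?_)
  rw [h o]
  exact (clause_subst _ _ _ _ _).symm

mutual
-- A typed renaming has no canonical counterpart on indices outside the context, so it is compared
-- with any `σ` that agrees with it on variables. Taking `σ` to be a substitution lets the same
-- commutation rules serve here and in `Val.cps_subst`.
theorem Val.cps_ren : {Γ Δ : Ctx Op} → {A : VTy Op} → (V : Val Γ A) → (ρ : Ren Γ Δ) →
    (σ : ℕ → Tm 0) → (∀ A (x : Var Γ A), Tm.var (ρ A x).idx = σ x.idx) →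
    (V.ren ρ).cps = V.cps.subst Ty.var σ
  | _, _, _, .var x, _, _, h => h _ x
  | _, _, _, .lam (A := A) M, ρ, σ, h => by
      show Tm.lam A.cps (M.ren ρ.lift).cps = .lam (A.cps.subst Ty.var) (M.cps.subst _ _)
      rw [Comp.cps_ren M ρ.lift _ (Ren.lift_idx h), Ty.subst_var]
  | _, _, _, .tuple (n := n) V, ρ, σ, h => by
      show Tm.listTuple (fun i => ((V i).ren ρ).cps) (List.finRange n) =
        (Tm.listTuple (fun i => (V i).cps) (List.finRange n)).subst _ _
      rw [Tm.listTuple_subst]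
      exact congrArg (Tm.listTuple · _) (funext fun i => Val.cps_ren (V i) ρ σ h)
  | _, _, _, .proj (n := n) (A := _) V i, ρ, σ, h => by
      show Tm.listProj (List.finRange n) i (V.ren ρ).cps =
        (Tm.listProj (List.finRange n) i V.cps).subst _ _
      rw [Tm.listProj_subst, Val.cps_ren V ρ σ h]
theorem Comp.cps_ren : {Γ Δ : Ctx Op} → {C : CTy Op} → (M : Comp Γ C) → (ρ : Ren Γ Δ) →
    (σ : ℕ → Tm 0) → (∀ A (x : Var Γ A), Tm.var (ρ A x).idx = σ x.idx) →
    (M.ren ρ).cps = M.cps.subst Ty.var σ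
  | _, _, _, .app V W, ρ, σ, h => congrArg₂ Tm.app (Val.cps_ren V ρ σ h) (Val.cps_ren W ρ σ h)
  | _, _, _, .ret (A := A) (S := S) V, ρ, σ, h => by
      show dRet S.cps A.cps (V.ren ρ).cps = (dRet S.cps A.cps V.cps).subst _ _
      rw [dRet_subst₀, Val.cps_ren V ρ σ h]
  | _, _, _, .letIn (A := A) (B := B) (S := S) M N, ρ, σ, h => by
      show lett S.cps A.cps B.cps (M.ren ρ).cps (N.ren ρ.lift).cps =
        (lett S.cps A.cps B.cps M.cps N.cps).subst _ _
      rw [lett_subst₀, Comp.cps_ren M ρ σ h, Comp.cps_ren N ρ.lift _ (Ren.lift_idx h)]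
  | _, _, _, .op (S := S) o V, ρ, σ, h => by
      exact (congrArg (dOp S.cps o) (Val.cps_ren V ρ σ h)).trans
        (dOp_subst₀ S.cps o V.cps σ).symm
  | _, _, _, .handle (A := A) (S := S) (C := C) M H N, ρ, σ, h => by
      show dRun (M.ren ρ).cps C.cps (.lam A.cps (N.ren ρ.lift).cps)
        (Handler.cps fun o => (H o).ren ρ.lift.lift) =
        dRun (M.cps.subst _ _) (C.cps.subst _) (.lam (A.cps.subst _) (N.cps.subst _ _))
          ((Handler.cps H).subst _ _)
      rw [Comp.cps_ren M ρ σ h, Comp.cps_ren N ρ.lift _ (Ren.lift_idx h), Ty.subst_var,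
        Ty.subst_var]
      exact congrArg (dRun _ _ _) (Handler.cps_eq_subst fun o =>
        Comp.cps_ren (H o) ρ.lift.lift _ (Ren.lift_idx (Ren.lift_idx h)))
end

theorem Val.cps_wk {Γ : Ctx Op} {A B : VTy Op} (V : Val Γ A) :
    (V.ren (Ren.wk (B := B))).cps = V.cps.wk := by
  rw [V.cps_ren _ (fun i => .var (i + 1)) Ren.wk_idx, Tm.wk_eq]

theorem Subst.lift_cps {Γ Δ : Ctx Op} {τ : Subst Γ Δ} {σ : ℕ → Tm 0}
    (h : ∀ A (x : Var Γ A), (τ A x).cps = σ x.idx) {B : VTy Op} :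
    ∀ A (x : Var (B :: Γ) A), (τ.lift A x).cps = upS σ x.idx
  | _, .zero => rfl
  | _, .succ x => (Val.cps_wk _).trans (congrArg Tm.wk (h _ x))

mutual
-- Substitution commutes with the transformation strictly, not just up to `βη`, because values are
-- transformed homomorphically. The case of renamings is needed first, since lifting a substitution
-- weakens its values.
theorem Val.cps_subst : {Γ Δ : Ctx Op} → {A : VTy Op} → (V : Val Γ A) → (τ : Subst Γ Δ) →
    (σ : ℕ → Tm 0) → (∀ A (x : Var Γ A), (τ A x).cps = σ x.idx) →
    (V.subst τ).cps = V.cps.subst Ty.var σ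
  | _, _, _, .var x, _, _, h => h _ x
  | _, _, _, .lam (A := A) M, τ, σ, h => by
      show Tm.lam A.cps (M.subst τ.lift).cps = .lam (A.cps.subst Ty.var) (M.cps.subst _ _)
      rw [Comp.cps_subst M τ.lift _ (Subst.lift_cps h), Ty.subst_var]
  | _, _, _, .tuple (n := n) V, τ, σ, h => by
      show Tm.listTuple (fun i => ((V i).subst τ).cps) (List.finRange n) =
        (Tm.listTuple (fun i => (V i).cps) (List.finRange n)).subst _ _
      rw [Tm.listTuple_subst]
      exact congrArg (Tm.listTuple · _) (funext fun i => Val.cps_subst (V i) τ σ h)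
  | _, _, _, .proj (n := n) (A := _) V i, τ, σ, h => by
      show Tm.listProj (List.finRange n) i (V.subst τ).cps =
        (Tm.listProj (List.finRange n) i V.cps).subst _ _
      rw [Tm.listProj_subst, Val.cps_subst V τ σ h]
theorem Comp.cps_subst : {Γ Δ : Ctx Op} → {C : CTy Op} → (M : Comp Γ C) → (τ : Subst Γ Δ) →
    (σ : ℕ → Tm 0) → (∀ A (x : Var Γ A), (τ A x).cps = σ x.idx) →
    (M.subst τ).cps = M.cps.subst Ty.var σ
  | _, _, _, .app V W, τ, σ, h => congrArg₂ Tm.app (Val.cps_subst V τ σ h) (Val.cps_subst W τ σ h)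
  | _, _, _, .ret (A := A) (S := S) V, τ, σ, h => by
      show dRet S.cps A.cps (V.subst τ).cps = (dRet S.cps A.cps V.cps).subst _ _
      rw [dRet_subst₀, Val.cps_subst V τ σ h]
  | _, _, _, .letIn (A := A) (B := B) (S := S) M N, τ, σ, h => by
      show lett S.cps A.cps B.cps (M.subst τ).cps (N.subst τ.lift).cps =
        (lett S.cps A.cps B.cps M.cps N.cps).subst _ _
      rw [lett_subst₀, Comp.cps_subst M τ σ h, Comp.cps_subst N τ.lift _ (Subst.lift_cps h)]
  | _, _, _, .op (S := S) o V, τ, σ, h => by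
      exact (congrArg (dOp S.cps o) (Val.cps_subst V τ σ h)).trans
        (dOp_subst₀ S.cps o V.cps σ).symm
  | _, _, _, .handle (A := A) (S := S) (C := C) M H N, τ, σ, h => by
      show dRun (M.subst τ).cps C.cps (.lam A.cps (N.subst τ.lift).cps)
        (Handler.cps fun o => (H o).subst τ.lift.lift) =
        dRun (M.cps.subst _ _) (C.cps.subst _) (.lam (A.cps.subst _) (N.cps.subst _ _))
          ((Handler.cps H).subst _ _)
      rw [Comp.cps_subst M τ σ h, Comp.cps_subst N τ.lift _ (Subst.lift_cps h), Ty.subst_var,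
        Ty.subst_var]
      exact congrArg (dRun _ _ _) (Handler.cps_eq_subst fun o =>
        Comp.cps_subst (H o) τ.lift.lift _ (Subst.lift_cps (Subst.lift_cps h)))
end

theorem Comp.cps_subst_one {Γ : Ctx Op} {A : VTy Op} {C : CTy Op} (M : Comp (A :: Γ) C)
    (V : Val Γ A) : (M.subst (Subst.one V)).cps = M.cps.inst V.cps := by
  rw [Tm.inst_eq]
  refine M.cps_subst _ _ fun B x => ?_
  cases x <;> rfl

theorem Comp.cps_subst_two {Γ : Ctx Op} {A B : VTy Op} {C : CTy Op} (M : Comp (B :: A :: Γ) C)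
    (V : Val Γ A) (W : Val Γ B) : (M.subst (Subst.two V W)).cps =
      M.cps.subst Ty.var (scons W.cps (scons V.cps Tm.var)) := by
  refine M.cps_subst _ _ fun D x => ?_
  cases x with
  | zero => rfl
  | succ x => cases x <;> rfl

theorem Comp.cps_wk_lift {Γ : Ctx Op} {A B : VTy Op} {C : CTy Op} (M : Comp (A :: Γ) C) :
    (M.ren (Ren.wk (B := B)).lift).cps = M.cps.ren id (upV (· + 1)) := by
  rw [M.cps_ren _ _ (Ren.lift_idx (σ := fun i => .var (i + 1)) Ren.wk_idx), Tm.ren_eq]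
  congr 1; funext i; cases i <;> rfl

theorem Handler.cps_wk {Γ : Ctx Op} {B : VTy Op} {S : Sig Op (VTy Op)} {C : CTy Op}
    (H : Handler Γ S C) :
    (Handler.cps fun o => (H o).ren (Ren.wk (B := B)).lift.lift) = (Handler.cps H).wk := by
  rw [Tm.wk_eq]
  exact Handler.cps_eq_subst fun o =>
    (H o).cps_ren _ _ (Ren.lift_idx (Ren.lift_idx (σ := fun i => .var (i + 1)) Ren.wk_idx))

/-! ### Soundness of the CPS transformation -/

theorem hasType_unpair {Γ : List (Ty 0)} {A B C : Ty 0} (i : ℕ) (D : Ty 0)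
    (hD : (Ty.arr B C :: A :: Γ)[i]? = some D) :
    HasType (.prod A (.arr B C) :: Γ) (unpair i) D := by
  match i with
  | 0 =>
    simp only [List.getElem?_cons_zero, Option.some.injEq] at hD; subst hD
    exact .snd (.var rfl)
  | 1 =>
    simp only [List.getElem?_cons_succ, List.getElem?_cons_zero, Option.some.injEq] at hD
    subst hD; exact .fst (.var rfl)
  | i + 2 => exact .var hD

theorem beq_clause {Γ : List (Ty 0)} {A B C : Ty 0} {t t' : Tm 0}
    (h : SysF.BEq (.arr B C :: A :: Γ) t t' C) :
    SysF.BEq Γ (.lam (.prod A (.arr B C)) (t.subst Ty.var unpair))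
      (.lam (.prod A (.arr B C)) (t'.subst Ty.var unpair)) (.arr (.prod A (.arr B C)) C) :=
  .lam (h.subst₀ h.hasType.1 hasType_unpair fun i D hD => .refl (hasType_unpair i D hD))

/-- After `β` for the abstraction, `x` and `k` are replaced by the projections of `⟨s, r⟩`. These
are equal to `s` and `r` by `β`, and equality of substitutions is a congruence. -/
theorem beq_clause_app {Γ : List (Ty 0)} {A B C : Ty 0} {t s r : Tm 0}
    (ht : HasType (.arr B C :: A :: Γ) t C) (hs : HasType Γ s A) (hr : HasType Γ r (.arr B C)) :
    SysF.BEq Γ (.app (.lam (.prod A (.arr B C)) (t.subst Ty.var unpair)) (.pair s r))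
      (t.subst Ty.var (scons r (scons s Tm.var))) C := by
  refine (SysF.BEq.lam_beta (ht.subst₀ hasType_unpair) (.pair hs hr)).trans ?_
  rw [Tm.inst_eq, Tm.subst_subst]
  refine SysF.BEq.subst₀ (.refl ht) ht (hasType_scons hr (hasType_scons hs fun i D hD => .var hD))
    fun i D hD => ?_
  match i with
  | 0 =>
    simp only [List.getElem?_cons_zero, Option.some.injEq] at hD; subst hD
    exact .snd_beta hs hr
  | 1 =>
    simp only [List.getElem?_cons_succ, List.getElem?_cons_zero, Option.some.injEq] at hD
    subst hD; exact .fst_beta hs hr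
  | i + 2 => exact .refl (.var hD)

mutual
/-- Derivably equal value terms have `βη`-equal CPS transforms. -/
theorem VEq.cps_beq : {Γ : Ctx Op} → {A : VTy Op} → {V W : Val Γ A} → VEq V W →
    SysF.BEq (Ctx.cps Γ) V.cps W.cps A.cps
  | _, _, _, _, .refl V => .refl V.cps_hasType
  | _, _, _, _, .symm h => (VEq.cps_beq h).symm
  | _, _, _, _, .trans h₁ h₂ => (VEq.cps_beq h₁).trans (VEq.cps_beq h₂)
  | _, _, _, _, .lam h => .lam (CEq.cps_beq h)
  | _, _, _, _, .tuple h => .listTuple fun i _ => VEq.cps_beq (h i)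
  | _, _, _, _, .proj (A := A) i h =>
      .listProj (A := fun i => (A i).cps) (List.mem_finRange i) (VEq.cps_beq h)
  | _, _, _, _, .lam_eta (A := A) (C := C) V => by
      show SysF.BEq _ _ (.lam A.cps (.app (V.ren Ren.wk).cps (.var 0))) (.arr A.cps C.cps)
      rw [V.cps_wk]
      exact .lam_eta V.cps_hasType
  | _, _, _, _, .prod_beta (A := A) V i =>
      .listProj_listTuple (A := fun i => (A i).cps) (fun i => (V i).cps_hasType)
        (List.mem_finRange i)
  | _, _, _, _, .prod_eta (n := n) V => .listTuple_listProj (List.nodup_finRange n) V.cps_hasType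
/-- Derivably equal computation terms have `βη`-equal CPS transforms. -/
theorem CEq.cps_beq : {Γ : Ctx Op} → {C : CTy Op} → {M N : Comp Γ C} → CEq M N →
    SysF.BEq (Ctx.cps Γ) M.cps N.cps C.cps
  | _, _, _, _, .refl M => .refl M.cps_hasType
  | _, _, _, _, .symm h => (CEq.cps_beq h).symm
  | _, _, _, _, .trans h₁ h₂ => (CEq.cps_beq h₁).trans (CEq.cps_beq h₂)
  | _, _, _, _, .app h₁ h₂ => .app (VEq.cps_beq h₁) (VEq.cps_beq h₂)
  | _, _, _, _, .ret h => .dRet _ (VEq.cps_beq h)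
  | _, _, _, _, .letIn h₁ h₂ => .lett (CEq.cps_beq h₁) (CEq.cps_beq h₂)
  | _, _, _, _, .op (S := S) o h => .dOp (S := S.cps) o (VEq.cps_beq h)
  | _, _, _, _, .handle h₁ h₂ h₃ =>
      .dRun (CEq.cps_beq h₁) (.lam (CEq.cps_beq h₃))
        (.listTuple fun o _ => beq_clause (CEq.cps_beq (h₂ o)))
  | _, _, _, _, .lam_beta M V => by
      rw [M.cps_subst_one]; exact .lam_beta M.cps_hasType V.cps_hasType
  | _, _, _, _, .ret_let V M => by
      rw [M.cps_subst_one]; exact lett_dRet_left V.cps_hasType M.cps_hasType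
  | _, _, _, _, .let_ret M => lett_dRet_right M.cps_hasType
  | _, _, _, _, .let_let (S := S) (A₁ := A₁) (A₂ := A₂) (A₃ := A₃) M N L => by
      have := lett_assoc M.cps_hasType N.cps_hasType L.cps_hasType
      rw [← L.cps_wk_lift (B := A₁)] at this
      exact this
  | _, _, _, _, .handle_ret V H M => by
      rw [M.cps_subst_one]
      exact (dRet_run V.cps_hasType (.lam M.cps_hasType) (Handler.cps_hasType H)).trans
        (.lam_beta M.cps_hasType V.cps_hasType)
  | _, _, _, _, .handle_let (A := A) (B := B) (C := C) L M H N => by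
      -- A handled computation is a run with continuation `λx.N` and the handler tuple, so the law
      -- is the computation rule for `let` at these arguments; extensionality is not needed.
      have := lett_run L.cps_hasType M.cps_hasType (.lam N.cps_hasType) (Handler.cps_hasType H)
      rw [lam_wk, ← N.cps_wk_lift (B := A), ← Handler.cps_wk] at this
      exact this
  | _, _, _, _, .handle_op (S := S) (C := C) o V H M => by
      rw [Comp.cps_subst_two]
      have hk := HasType.lam M.cps_hasType
      refine (dOp_run (S := S.cps) o V.cps_hasType hk (Handler.cps_hasType H)).trans
        (.trans (.app ?_ (.refl (.pair V.cps_hasType hk)))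
          (beq_clause_app (H o).cps_hasType V.cps_hasType hk))
      exact SysF.BEq.listProj_listTuple
        (A := fun o : {o // o ∈ S.dom} => .arr (.prod (S.arg o).cps (.arr (S.res o).cps C.cps)) C.cps)
        (fun o => hasType_clause (H o).cps_hasType) (S.cps.mem_ops o)
end

theorem HEqv.cps_beq {Γ : Ctx Op} {S : Sig Op (VTy Op)} {C : CTy Op} {H H' : Handler Γ S C}
    (h : HEqv H H') :
    SysF.BEq (Ctx.cps Γ) (Handler.cps H) (Handler.cps H') (hTy S.cps C.cps) :=
  .listTuple fun o _ => beq_clause (CEq.cps_beq (h o))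

end LamEff

namespace SysF

/-! ### The tuple of the variables of a context -/

/-- The tuple of the variables of a context, as a term of type `ctxTy Γ`. -/
def ctxTuple {m : ℕ} : List (Ty m) → Tm m
  | [] => .star
  | _ :: Γ => .pair (ctxTuple Γ).wk (.var 0)

theorem hasType_ctxTuple {m : ℕ} : (Γ : List (Ty m)) → HasType Γ (ctxTuple Γ) (ctxTy Γ)
  | [] => .star
  | A :: Γ => .pair ((hasType_ctxTuple Γ).wk A) (.var rfl)

/-- Surjective pairing iterated along the context: the tuple of the projections of `t` is `t`. -/
theorem ctxTuple_subst_ctxProj {m : ℕ} {Δ : List (Ty m)} : (Γ : List (Ty m)) → {t : Tm m} →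
    HasType Δ t (ctxTy Γ) →
    BEq Δ ((ctxTuple Γ).subst Ty.var (fun i => ctxProj i t)) t (ctxTy Γ)
  | [], _, h => (BEq.unit_eta h).symm
  | A :: Γ, t, h => by
      show BEq Δ (.pair ((ctxTuple Γ).wk.subst _ _) (.snd t)) t (.prod (ctxTy Γ) A)
      rw [Tm.wk_subst]
      exact (BEq.pair (ctxTuple_subst_ctxProj Γ (.fst h)) (.refl (.snd h))).trans
        (BEq.pair_eta h).symm

theorem ctxProj_ren {m n : ℕ} (ξ : Fin m → Fin n) (ρ : ℕ → ℕ) (i : ℕ) (t : Tm m) :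
    (ctxProj i t).ren ξ ρ = ctxProj i (t.ren ξ ρ) := by
  induction i generalizing t with
  | zero => rfl
  | succ i ih => exact ih (.fst t)

/-- Any two representatives of `f` are `βη`-equal, by exactness of the quotient, so `App` is
functional. -/
theorem App.unique {m : ℕ} {Γ : List (Ty m)} {A B : Ty m} {f : A ⟶ B} {s t u : Tm m}
    (h : App Γ f s t) (h' : App Γ f s u) : BEq Γ t u B := by
  obtain ⟨_, r, hr, rfl, e⟩ := h
  obtain ⟨_, r', hr', e', e''⟩ := h'
  exact e.symm.trans (((Quotient.exact (s := TTm.setoid [A] B) e' : BEq [A] r r' B).ap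
    (.refl (by assumption))).trans e'')

/-- A morphism is the class of the term to which it sends the tuple of variables of the context. -/
theorem App.eq_cls {m : ℕ} {Γ : List (Ty m)} {A B B' : Ty m} {f : A ⟶ B'} {t : Tm m}
    (hA : A = ctxTy Γ) (hB : B' = B) (h : App Γ f (ctxTuple Γ) t) (ht : HasType Γ t B) :
    f = eqToHom hA ≫ cls t ht ≫ eqToHom hB.symm := by
  subst hA hB
  rw [eqToHom_refl, eqToHom_refl, Category.comp_id, Category.id_comp]
  have hv : HasType [ctxTy Γ] (.var 0) (ctxTy Γ) := .var rfl
  have hσ := fun i C hC => hasType_ctxProj Γ i C hC hv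
  have hc := ht.subst₀ hσ
  -- Substituting the projections turns the tuple of variables into the single variable and `t` into
  -- the representative that defines `cls`.
  refine App.hom_ext₁ ((h.subst hσ).conv_left (ctxTuple_subst_ctxProj Γ hv))
    (App.of_mk hc hv (.refl (hc.ap hv))) ?_
  rw [Tm.ap, hc.subst_single]
  exact .refl hc

end SysF

namespace LamEff

open SysF

variable {Op : Type u} [DecidableEq Op]

/-! ### The interpretation in the CPS model -/

theorem cpsModel_ty_eq : (cpsModel Op).ty = VTy.cps := funext cpsModel_ty

/-- The types of a context, as interpreted in the CPS model. -/
noncomputable def Ctx.tys (Γ : Ctx Op) : List (Ty 0) := Γ.map (cpsModel Op).ty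

/-- Interpreted types agree with CPS types only propositionally. The induction on terms is therefore
carried out over `Ctx.tys`, where the morphisms need no transport, and the contexts are exchanged
once at the end. -/
theorem Ctx.tys_eq (Γ : Ctx Op) : Γ.tys = Γ.cps := by
  rw [Ctx.tys, cpsModel_ty_eq, Ctx.cps]

theorem cpsModel_ctx_eq : (Γ : Ctx Op) → (cpsModel Op).ctx Γ = ctxTy Γ.tys
  | [] => rfl
  | A :: Γ => congrArg (Ty.prod · ((cpsModel Op).ty A)) (cpsModel_ctx_eq Γ)

theorem hasType_ctxTuple_tys (Γ : Ctx Op) :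
    HasType Γ.tys (ctxTuple Γ.tys) ((cpsModel Op).ctx Γ) :=
  cpsModel_ctx_eq Γ ▸ hasType_ctxTuple Γ.tys

theorem app_var : {Γ : Ctx Op} → {A : VTy Op} → (x : Var Γ A) →
    App Γ.tys ((cpsModel Op).var x) (ctxTuple Γ.tys) (.var x.idx)
  | _ :: Γ, _, .zero => .snd ((hasType_ctxTuple_tys Γ).wk _) (.var rfl)
  | _ :: Γ, _, .succ x =>
      .comp (.fst ((hasType_ctxTuple_tys Γ).wk _) (.var rfl)) (app_var x).wk

/-- The inverse associator takes `⟨γ, ⟨x, k⟩⟩` to `⟨⟨γ, x⟩, k⟩`, and `unpair` does the same to the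
tuple of variables of the clause. The clauses enter as a hypothesis so that `app_comp` can use its
recursive calls. -/
theorem app_handler {Γ : Ctx Op} {S : Sig Op (VTy Op)} {C : CTy Op} {H : Handler Γ S C}
    (h : ∀ o, App (Ctx.tys ((S.res o).arr C :: S.arg o :: Γ)) ((cpsModel Op).comp (H o))
      (ctxTuple (Ctx.tys ((S.res o).arr C :: S.arg o :: Γ))) (H o).cps) :
    App Γ.tys ((cpsModel Op).handler H) (ctxTuple Γ.tys) (Handler.cps H) := by
  have hs := hasType_ctxTuple_tys Γ
  refine .listTuple hs (fun o => ?_) _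
  let A := (cpsModel Op).ty (S.arg o)
  let K := Ty.arr ((cpsModel Op).ty (S.res o)) ((cpsModel Op).cty C)
  have hv : HasType (Ty.prod A K :: Γ.tys) (.var 0) (.prod A K) := .var rfl
  have h₁ : App (Ty.prod A K :: Γ.tys)
      (α_ ((cpsModel Op).ctx Γ) A K).inv (.pair (ctxTuple Γ.tys).wk (.var 0))
      (.pair (.pair (ctxTuple Γ.tys).wk (.fst (.var 0))) (.snd (.var 0))) :=
    (App.associator_inv (hs.wk _) (.fst hv) (.snd hv)).conv_left
      (.pair (.refl (hs.wk _)) (SysF.BEq.pair_eta hv).symm)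
  have h₂ := (h o).subst (Δ := Ty.prod A K :: Γ.tys) (σ := unpair) fun i D hD =>
    hasType_unpair i D hD
  have e : (ctxTuple (Ctx.tys ((S.res o).arr C :: S.arg o :: Γ))).subst Ty.var unpair =
      .pair (.pair (ctxTuple Γ.tys).wk (.fst (.var 0))) (.snd (.var 0)) := by
    show Tm.pair (.pair ((ctxTuple Γ.tys).wk.wk.subst _ _) _) _ = _
    rw [Tm.wk_subst, Tm.wk_subst, Tm.wk_eq]; rfl
  rw [e] at h₂
  have h₃ := app_curry (Op := Op) hs (h₁.comp h₂)
  have e' : Ty.prod A K = .prod (S.arg o).cps (.arr (S.res o).cps C.cps) := by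
    show Ty.prod ((cpsModel Op).ty (S.arg o))
      (.arr ((cpsModel Op).ty (S.res o)) ((cpsModel Op).cty C)) = _
    rw [cpsModel_ty, cpsModel_ty, cpsModel_cty]
  rw [← e']
  exact h₃

/-- In the induction below, the two descriptions of types differ only in the annotations inside
terms. Terms are raw, so they can be rewritten while the morphism stays fixed. -/
theorem app_cast {Γ : List (Ty 0)} {A B : Ty 0} {f : A ⟶ B} {s t u : Tm 0} (h : App Γ f s t)
    (e : t = u) : App Γ f s u := e ▸ h

mutual
theorem app_val : {Γ : Ctx Op} → {A : VTy Op} → (V : Val Γ A) →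
    App Γ.tys ((cpsModel Op).val V) (ctxTuple Γ.tys) V.cps
  | _, _, .var x => app_var x
  | Γ, _, .lam (A := A) M =>
      app_cast (app_curry (hasType_ctxTuple_tys Γ) (app_comp M))
        (congrArg (Tm.lam · _) (cpsModel_ty A))
  | Γ, _, .tuple V => .listTuple (hasType_ctxTuple_tys Γ) (fun i => app_val (V i)) _
  | _, _, .proj (A := _) V i => .comp (app_val V) (.listProj _ (app_val V).right)
theorem app_comp : {Γ : Ctx Op} → {C : CTy Op} → (M : Comp Γ C) →
    App Γ.tys ((cpsModel Op).comp M) (ctxTuple Γ.tys) M.cps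
  | _, _, .app V W =>
      .comp (.lift (app_val V) (app_val W)) (app_ev (app_val V).right (app_val W).right)
  | _, _, .ret (A := A) (S := S) V =>
      app_cast (.comp (app_val V) (app_unit _ (app_val V).right))
        (congrArg₂ (dRet · · V.cps) (cpsModel_sig S) (cpsModel_ty A))
  | Γ, _, .letIn (A := A) (B := B) (S := S) M N =>
      app_cast (.comp (.lift (.id (hasType_ctxTuple_tys Γ)) (app_comp M))
          (app_ext (hasType_ctxTuple_tys Γ) (app_comp M).right (app_comp N)))
        (by rw [cpsModel_sig, cpsModel_ty, cpsModel_ty]; rfl)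
  | _, _, .op (S := S) o V =>
      app_cast (.comp (app_val V) (app_opr (S := (cpsModel Op).sig S) o (app_val V).right)) (by
        show dOp (S.map (cpsModel Op).ty) o V.cps = dOp (S.map VTy.cps) o V.cps
        rw [cpsModel_ty_eq])
  | Γ, _, .handle (A := A) (S := S) (C := C) M H N => by
      have hs := hasType_ctxTuple_tys Γ
      have hM := app_comp M
      have hN := app_comp N
      have hH := app_handler fun o => app_comp (H o)
      let P := Ty.prod ((cpsModel Op).ctx Γ) ((cpsModel Op).ty A)
      -- The value of the interpretation of `N` at one variable for the pair of environment and
      -- argument. All variables of `N` become projections of it, which gives the independence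
      -- required by `dRun_lett_lett_id`.
      have hn {Δ : List (Ty 0)} : App (P :: Δ) ((cpsModel Op).comp N) (.var 0)
          (N.cps.subst Ty.var fun i => ctxProj i (.var 0)) := by
        have hv : HasType (P :: Δ) (.var 0) (ctxTy (Ctx.tys (A :: Γ))) :=
          cpsModel_ctx_eq (A :: Γ) ▸ (.var rfl : HasType (P :: Δ) (.var 0) P)
        have := hN.subst fun i D hD => hasType_ctxProj _ i D hD hv
        refine this.conv_left ?_
        have e := ctxTuple_subst_ctxProj _ hv
        rwa [← cpsModel_ctx_eq] at e
      have hst := app_str (S := (cpsModel Op).sig S) hs hM.right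
      have hp : HasType (Ctx.tys (A :: Γ)) (.pair (ctxTuple Γ.tys).wk (.var 0)) P :=
        .pair (hs.wk _) (.var rfl)
      have hh := App.comp (.lift hH (.comp (.lift (.id hs) hM) (.comp hst (app_map hst.right hn))))
        (app_handle hH.right (.lett hst.right (.dRet _ hn.right)))
      have e := dRun_lett_lett_id hM.right hp hn.right hn.right (by
        rw [Tm.ren_eq, Tm.subst_subst]
        congr 1; funext i
        have := ctxProj_ren id (upV (· + 1)) i (.var 0 : Tm 0)
        rwa [Tm.ren_eq] at this) hH.right
      -- The collapsed continuation and `N.cps` are both values of the same morphism at the tuple of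
      -- variables, so uniqueness identifies them without computing the substitution.
      have e' := SysF.BEq.dRun (.refl hM.right) (.lam ((hn.inst hp).unique hN)) (.refl hH.right)
      refine app_cast (hh.conv (e.trans e')) ?_
      show dRun M.cps ((cpsModel Op).cty C) (.lam ((cpsModel Op).ty A) N.cps) (Handler.cps H) =
        dRun M.cps C.cps (.lam A.cps N.cps) (Handler.cps H)
      rw [cpsModel_cty, cpsModel_ty]
end

theorem cpsModel_val {Γ : Ctx Op} {A : VTy Op} (V : Val Γ A) :
    (cpsModel Op).val V = eqToHom (cpsModel_ctx Γ) ≫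
      cls V.cps V.cps_hasType ≫ eqToHom (cpsModel_ty A).symm :=
  App.eq_cls _ (cpsModel_ty A) (Γ.tys_eq ▸ app_val V) _

theorem cpsModel_comp {Γ : Ctx Op} {C : CTy Op} (M : Comp Γ C) :
    (cpsModel Op).comp M = eqToHom (cpsModel_ctx Γ) ≫
      cls M.cps M.cps_hasType ≫ eqToHom (cpsModel_cty C).symm :=
  App.eq_cls _ (cpsModel_cty C) (Γ.tys_eq ▸ app_comp M) _

theorem cpsModel_handler {Γ : Ctx Op} {S : Sig Op (VTy Op)} {C : CTy Op} (H : Handler Γ S C) :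
    (cpsModel Op).handler H = eqToHom (cpsModel_ctx Γ) ≫
      cls (Handler.cps H) (Handler.cps_hasType H) ≫ eqToHom (cpsModel_bundle S C).symm :=
  App.eq_cls _ (cpsModel_bundle S C) (Γ.tys_eq ▸ app_handler fun o => app_comp (H o)) _

end LamEff

theorem mainTheorem6 {Op : Type u} [DecidableEq Op] :
    (cpsModel Op).IsModel ∧
    (∀ (Γ : Ctx Op) (A : VTy Op) (V : Val Γ A),
      (cpsModel Op).val V = eqToHom (cpsModel_ctx Γ) ≫
        SysF.cls V.cps V.cps_hasType ≫ eqToHom (cpsModel_ty A).symm) ∧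
    (∀ (Γ : Ctx Op) (C : CTy Op) (M : Comp Γ C),
      (cpsModel Op).comp M = eqToHom (cpsModel_ctx Γ) ≫
        SysF.cls M.cps M.cps_hasType ≫ eqToHom (cpsModel_cty C).symm) ∧
    (∀ (Γ : Ctx Op) (S : Sig Op (VTy Op)) (C : CTy Op) (H : Handler Γ S C),
      (cpsModel Op).handler H = eqToHom (cpsModel_ctx Γ) ≫
        SysF.cls (Handler.cps H) (Handler.cps_hasType H) ≫
          eqToHom (cpsModel_bundle S C).symm) ∧
    (∀ (Γ : Ctx Op) (A : VTy Op) (V W : Val Γ A), VEq V W →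
      SysF.BEq (Ctx.cps Γ) V.cps W.cps A.cps) ∧
    (∀ (Γ : Ctx Op) (C : CTy Op) (M N : Comp Γ C), CEq M N →
      SysF.BEq (Ctx.cps Γ) M.cps N.cps C.cps) ∧
    (∀ (Γ : Ctx Op) (S : Sig Op (VTy Op)) (C : CTy Op) (H H' : Handler Γ S C), HEqv H H' →
      SysF.BEq (Ctx.cps Γ) (Handler.cps H) (Handler.cps H') (SysF.hTy S.cps C.cps)) ∧
    (∀ (C : CTy Op) (M N : Comp [] C), Red M N → SysF.BEq [] M.cps N.cps C.cps) := by
  exact ⟨cpsModel_isModel, fun _ _ V => cpsModel_val V, fun _ _ M => cpsModel_comp M,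
    fun _ _ _ H => cpsModel_handler H, fun _ _ _ _ h => h.cps_beq, fun _ _ _ _ h => h.cps_beq,
    fun _ _ _ _ _ h => h.cps_beq, fun _ _ _ h => h.ceq.cps_beq⟩
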